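/- Conventions. A dual operator system is a weak$^*$-closed self-adjoint linear subspace $M\subseteq\mathcal B(H)$ ($H$ a complex Hilbert space) containing $\mathbf 1$; its predual $M_*$ consists of the restrictions to $M$ of the normal linear functionals of $\mathcal B(H)$, and a linear map of dual operator systems is normal if it is weak$^*$-continuous. For $n\ge 1$, $M^{(n)}=M_n(\mathbb C)\otimes M\subseteq\mathcal B(\mathbb C^n\otimes H)$. A UCP map means a normal unital completely positive linear map. For a UCP map $L:M\to M$, a reversible lift is a triple $(N,\alpha,E)$ consisting of a dual operator system $N$, a UCP map $\alpha:N\to N$ with UCP inverse, and a UCP map $E:N\to M$ with $E\circ\alpha=L\circ E$. It is an asymptotic lift of $L$ if, in addition, (a) for $y\in N$, if $E(\alpha^{-n}(y))=0$ for all $n=0,1,2,\dots$, then $y=0$; and (b) $\|\rho\circ(\mathrm{id}_n\otimes E)\|=\lim_{k\to\infty}\|\rho\circ(\mathrm{id}_n\otimes L)^k\|$ for every $n\ge1$ and every normal linear functional $\rho\in (M^{(n)})_*$. Proposition. Let $R\subseteq\mathcal B(H)$ be a hyperfinite $II_1$ factor (an infinite-dimensional factor with a faithful normal tracial state, generated as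 a von Neumann algebra by an increasing sequence of finite-dimensional $*$-subalgebras), let $\tau$ be its faithful normal tracial state, and let $R\otimes R\subseteq\mathcal B(H\otimes H)$ be the spatial (von Neumann algebra) tensor product. (1) Let $P:R\to R$ be a normal UCP map for which $\tau$ is absorbing, i.e. $\lim_{k\to\infty}\|\rho\circ P^k-\tau\|=0$ for every normal state $\rho$ of $R$, and let $\alpha$ be an arbitrary $*$-automorphism of $R$. Then there is a unique normal linear map $L=P\otimes\alpha$ on $R\otimes R$ with $L(x\otimes y)=P(x)\otimes\alpha(y)$ for all $x,y\in R$; it is a UCP map, and with $E:R\to R\otimes R$, $E(x)=\mathbf 1\otimes x$, the triple $(R,\alpha,E)$ is an asymptotic lift of $L$. (2) Consequently every $*$-automorphism $\alpha$ of $R$ arises in this way: there is a normal UCP map $P$ on $R$ for which $\tau$ is absorbing, and $(R,\alpha,E)$ is an asymptotic lift of $P\otimes\alpha$. -/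

import Mathlib

open Filter Topology
open scoped TensorProduct ENNReal InnerProductSpace

set_option linter.unusedSectionVars false

namespace UCP

noncomputable section

/-! ### Weak-star topology, dual operator systems, normal maps -/

section Basic

variable {H : Type*} [NormedAddCommGroup H] [InnerProductSpace ℂ H] [CompleteSpace H]
variable {K : Type*} [NormedAddCommGroup K] [InnerProductSpace ℂ K] [CompleteSpace K]

/-- Normal linear functionals on `B(H)`: `x ↦ ∑ ⟪aₙ, x bₙ⟫` with square-summable sequences of
vectors `aₙ`, `bₙ` (that is, `x ↦ trace (t x)` with `t` of trace class). -/
def IsNormalOnBH (f : (H →L[ℂ] H) →ₗ[ℂ] ℂ) : Prop :=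
  ∃ a b : ℕ → H, Summable (fun n => ‖a n‖ ^ 2) ∧ Summable (fun n => ‖b n‖ ^ 2) ∧
    ∀ x : H →L[ℂ] H, f x = ∑' n, ⟪a n, x (b n)⟫_ℂ

/-- The weak-star topology of `B(H)`: the coarsest topology making all normal functionals
continuous. -/
@[reducible]
def weakStarBH (H : Type*) [NormedAddCommGroup H] [InnerProductSpace ℂ H] [CompleteSpace H] :
    TopologicalSpace (H →L[ℂ] H) :=
  ⨅ f : {f : (H →L[ℂ] H) →ₗ[ℂ] ℂ // IsNormalOnBH f},
    TopologicalSpace.induced (fun x => f.1 x) inferInstance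

/-- A (concrete) dual operator system: a weak-star closed self-adjoint linear subspace of `B(H)`
that contains the identity. -/
structure IsDualOperatorSystem (M : Submodule ℂ (H →L[ℂ] H)) : Prop where
  star_mem : ∀ x ∈ M, star x ∈ M
  one_mem : (1 : H →L[ℂ] H) ∈ M
  weakStar_closed : IsClosed[weakStarBH H] (M : Set (H →L[ℂ] H))

/-- The weak-star topology of a subspace of `B(H)`. -/
@[reducible]
def weakStar (M : Submodule ℂ (H →L[ℂ] H)) : TopologicalSpace M :=
  (weakStarBH H).induced Subtype.val

/-- The predual `M_*`: restrictions to `M` of normal functionals on `B(H)`. -/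
def IsNormalFunctional (M : Submodule ℂ (H →L[ℂ] H)) (ρ : M →ₗ[ℂ] ℂ) : Prop :=
  ∃ f : (H →L[ℂ] H) →ₗ[ℂ] ℂ, IsNormalOnBH f ∧ ∀ x : M, ρ x = f x

/-- Normal maps: linear maps continuous for the weak-star topologies. -/
def IsNormalMap {M : Submodule ℂ (H →L[ℂ] H)} {N : Submodule ℂ (K →L[ℂ] K)}
    (L : M →ₗ[ℂ] N) : Prop :=
  @Continuous M N (weakStar M) (weakStar N) L

/-- The norm of a linear functional on `M`, in `[0, ∞]`. -/
def functionalNorm {M : Submodule ℂ (H →L[ℂ] H)} (ρ : M →ₗ[ℂ] ℂ) : ℝ≥0∞ :=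
  ⨆ x : M, ⨆ _ : ‖x‖ ≤ 1, ‖ρ x‖ₑ

/-- Positive linear functionals of value one at the identity. -/
structure IsState (M : Submodule ℂ (H →L[ℂ] H)) (ρ : M →ₗ[ℂ] ℂ) : Prop where
  nonneg : ∀ x : M, (x : H →L[ℂ] H).IsPositive → 0 ≤ (ρ x).re ∧ (ρ x).im = 0
  map_one : ∀ x : M, (x : H →L[ℂ] H) = 1 → ρ x = 1

/-! ### Matrix amplifications and UCP maps -/

/-- The direct sum of `n` copies of `H`, that is `ℂⁿ ⊗ H`. -/
abbrev HPow (n : ℕ) (H : Type*) [NormedAddCommGroup H] [InnerProductSpace ℂ H] : Type _ :=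
  PiLp 2 (fun _ : Fin n => H)

/-- The inclusion of the `j`-th summand in `Hⁿ`. -/
def incl (n : ℕ) (j : Fin n) : H →L[ℂ] HPow n H :=
  ((PiLp.continuousLinearEquiv 2 ℂ (fun _ : Fin n => H)).symm : (Fin n → H) →L[ℂ] HPow n H) ∘L
    ContinuousLinearMap.single ℂ (fun _ : Fin n => H) j

/-- The coordinate projection of `Hⁿ` onto its `i`-th summand. -/
def coord (n : ℕ) (i : Fin n) : HPow n H →L[ℂ] H :=
  PiLp.proj (𝕜 := ℂ) 2 (fun _ : Fin n => H) i

theorem coord_comp_incl (n : ℕ) (i j : Fin n) :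
    (coord n i ∘L incl n j : H →L[ℂ] H) = if i = j then 1 else 0 := by
  ext h
  by_cases hij : i = j
  · subst hij; simp [coord, incl]
  · simp [coord, incl, hij]

/-- The `(i, j)` entry of an operator on `Hⁿ`. -/
def entry {n : ℕ} (X : HPow n H →L[ℂ] HPow n H) (i j : Fin n) : H →L[ℂ] H :=
  coord n i ∘L X ∘L incl n j

/-- The operator on `Hⁿ` with a given matrix of entries. -/
def ofEntries {n : ℕ} (x : Fin n → Fin n → H →L[ℂ] H) : HPow n H →L[ℂ] HPow n H :=
  ∑ i, ∑ j, incl n i ∘L x i j ∘L coord n j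

theorem entry_ofEntries {n : ℕ} (x : Fin n → Fin n → H →L[ℂ] H) (i j : Fin n) :
    entry (ofEntries x) i j = x i j := by
  ext h
  have key : ∀ a b : Fin n, ∀ v : H, coord n a (incl n b v) = if a = b then v else 0 := by
    intro a b v
    have := congrArg (fun T : H →L[ℂ] H => T v) (coord_comp_incl (H := H) n a b)
    by_cases hab : a = b <;> simpa [hab] using this
  simp only [entry, ofEntries, ContinuousLinearMap.comp_apply, sum_apply,
    map_sum, key]
  simp [apply_ite]

theorem entry_add {n : ℕ} (X Y : HPow n H →L[ℂ] HPow n H) (i j : Fin n) :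
    entry (X + Y) i j = entry X i j + entry Y i j := by
  ext h; simp [entry]

theorem entry_smul {n : ℕ} (c : ℂ) (X : HPow n H →L[ℂ] HPow n H) (i j : Fin n) :
    entry (c • X) i j = c • entry X i j := by
  ext h; simp [entry]

theorem ofEntries_add {n : ℕ} (x y : Fin n → Fin n → H →L[ℂ] H) :
    ofEntries (fun i j => x i j + y i j) = ofEntries x + ofEntries y := by
  simp only [ofEntries, ContinuousLinearMap.add_comp, ContinuousLinearMap.comp_add,
    Finset.sum_add_distrib]

theorem ofEntries_smul {n : ℕ} (c : ℂ) (x : Fin n → Fin n → H →L[ℂ] H) :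
    ofEntries (fun i j => c • x i j) = c • ofEntries x := by
  simp only [ofEntries, ContinuousLinearMap.smul_comp, ContinuousLinearMap.comp_smul,
    Finset.smul_sum]

/-- `M⁽ⁿ⁾ = Mₙ(ℂ) ⊗ M`, the operators on `Hⁿ` all of whose entries belong to `M`. -/
def amp (n : ℕ) (M : Submodule ℂ (H →L[ℂ] H)) : Submodule ℂ (HPow n H →L[ℂ] HPow n H) where
  carrier := {X | ∀ i j, entry X i j ∈ M}
  add_mem' := fun hX hY i j => by rw [entry_add]; exact M.add_mem (hX i j) (hY i j)
  zero_mem' := fun i j => by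
    have : entry (0 : HPow n H →L[ℂ] HPow n H) i j = 0 := by ext h; simp [entry]
    rw [this]; exact M.zero_mem
  smul_mem' := fun c X hX i j => by rw [entry_smul]; exact M.smul_mem c (hX i j)

/-- `idₙ ⊗ L : M⁽ⁿ⁾ → N⁽ⁿ⁾`, that is, `L` applied to every entry. -/
def ampMap (n : ℕ) {M : Submodule ℂ (H →L[ℂ] H)} {N : Submodule ℂ (K →L[ℂ] K)}
    (L : M →ₗ[ℂ] N) : amp n M →ₗ[ℂ] amp n N where
  toFun X := ⟨ofEntries fun i j => (L ⟨entry X.1 i j, X.2 i j⟩ : K →L[ℂ] K), fun i j => by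
    rw [entry_ofEntries]; exact (L _).2⟩
  map_add' X Y := by
    apply Subtype.ext
    have h : ∀ i j, L ⟨entry (X + Y).1 i j, (X + Y).2 i j⟩ =
        L ⟨entry X.1 i j, X.2 i j⟩ + L ⟨entry Y.1 i j, Y.2 i j⟩ := by
      intro i j
      rw [← map_add]
      exact congrArg L (Subtype.ext (entry_add X.1 Y.1 i j))
    change ofEntries _ = ofEntries _ + ofEntries _
    rw [← ofEntries_add]
    congr 1
    funext i j
    rw [h]
    rfl
  map_smul' c X := by
    apply Subtype.ext
    have h : ∀ i j, L ⟨entry (c • X).1 i j, (c • X).2 i j⟩ =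
        c • L ⟨entry X.1 i j, X.2 i j⟩ := by
      intro i j
      rw [← map_smul]
      exact congrArg L (Subtype.ext (entry_smul c X.1 i j))
    change ofEntries _ = c • ofEntries _
    rw [← ofEntries_smul]
    congr 1
    funext i j
    rw [h]
    rfl

/-- Normal unital completely positive maps. -/
structure IsNormalUCP {M : Submodule ℂ (H →L[ℂ] H)} {N : Submodule ℂ (K →L[ℂ] K)}
    (L : M →ₗ[ℂ] N) : Prop where
  normal : IsNormalMap L
  unital : ∀ x : M, (x : H →L[ℂ] H) = 1 → (L x : K →L[ℂ] K) = 1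
  completely_positive : ∀ (n : ℕ) (X : amp n M), (X : HPow n H →L[ℂ] HPow n H).IsPositive →
    (ampMap n L X : HPow n K →L[ℂ] HPow n K).IsPositive

/-! ### Reversible lifts and asymptotic lifts -/

/-- `(N, α, E)` is a reversible lift of the UCP map `L : M → M` of dual operator systems. -/
structure IsReversibleLift {M : Submodule ℂ (H →L[ℂ] H)} (L : M →ₗ[ℂ] M)
    {N : Submodule ℂ (K →L[ℂ] K)} (α : N ≃ₗ[ℂ] N) (E : N →ₗ[ℂ] M) : Prop where
  dual_base : IsDualOperatorSystem M
  dual_lift : IsDualOperatorSystem N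
  ucp_base : IsNormalUCP L
  ucp_aut : IsNormalUCP (α : N →ₗ[ℂ] N)
  ucp_aut_symm : IsNormalUCP (α.symm : N →ₗ[ℂ] N)
  ucp_map : IsNormalUCP E
  equivariant : ∀ y, E (α y) = L (E y)

/-- `(N, α, E)` is an asymptotic lift of `L : M → M`: a nondegenerate reversible lift such that
`‖ρ ∘ (idₙ ⊗ E)‖ = lim_k ‖ρ ∘ (idₙ ⊗ L)ᵏ‖` for every normal functional `ρ` on `M⁽ⁿ⁾` and
every `n` (both sides vanish for `n = 0`). -/
structure IsAsymptoticLift {M : Submodule ℂ (H →L[ℂ] H)} (L : M →ₗ[ℂ] M)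
    {N : Submodule ℂ (K →L[ℂ] K)} (α : N ≃ₗ[ℂ] N) (E : N →ₗ[ℂ] M) : Prop
    extends IsReversibleLift L α E where
  nondegenerate : ∀ y : N, (∀ n : ℕ, E (((α.symm : N →ₗ[ℂ] N) ^ n) y) = 0) → y = 0
  norm_limit : ∀ (n : ℕ) (ρ : amp n M →ₗ[ℂ] ℂ), IsNormalFunctional (amp n M) ρ →
    Tendsto (fun k : ℕ => functionalNorm (ρ ∘ₗ ((ampMap n L) ^ k))) atTop
      (𝓝 (functionalNorm (ρ ∘ₗ ampMap n E)))

end Basic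

/-! ### Von Neumann algebras -/

section VN

variable {H : Type*} [NormedAddCommGroup H] [InnerProductSpace ℂ H] [CompleteSpace H]
variable {K : Type*} [NormedAddCommGroup K] [InnerProductSpace ℂ K] [CompleteSpace K]

/-- The underlying linear subspace of `B(H)` of a von Neumann algebra. -/
def space (R : VonNeumannAlgebra H) : Submodule ℂ (H →L[ℂ] H) :=
  Subalgebra.toSubmodule R.toStarSubalgebra.toSubalgebra

/-- The product of a von Neumann algebra. -/
def vnMul (R : VonNeumannAlgebra H) (x y : space R) : space R :=
  ⟨x.1 * y.1, R.toStarSubalgebra.mul_mem x.2 y.2⟩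

/-- The involution of a von Neumann algebra. -/
def vnStar (R : VonNeumannAlgebra H) (x : space R) : space R :=
  ⟨star x.1, R.toStarSubalgebra.star_mem' x.2⟩

/-- The von Neumann algebra generated by a set of operators: the double commutant of the
self-adjoint set `S ∪ S*`. -/
def vnGen (S : Set (H →L[ℂ] H)) : VonNeumannAlgebra H where
  toStarSubalgebra :=
    StarSubalgebra.centralizer ℂ (StarSubalgebra.centralizer ℂ S : Set (H →L[ℂ] H))
  centralizer_centralizer' := by
    have h : (StarSubalgebra.centralizer ℂ
        (StarSubalgebra.centralizer ℂ S : Set (H →L[ℂ] H)) : Set (H →L[ℂ] H)) =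
        (S ∪ star S).centralizer.centralizer := StarSubalgebra.coe_centralizer_centralizer ℂ S
    change Set.centralizer (Set.centralizer (StarSubalgebra.centralizer ℂ
        (StarSubalgebra.centralizer ℂ S : Set (H →L[ℂ] H)) : Set (H →L[ℂ] H))) =
      (StarSubalgebra.centralizer ℂ
        (StarSubalgebra.centralizer ℂ S : Set (H →L[ℂ] H)) : Set (H →L[ℂ] H))
    rw [h, Set.centralizer_centralizer_centralizer]

theorem subset_vnGen (S : Set (H →L[ℂ] H)) : S ⊆ (vnGen S : Set (H →L[ℂ] H)) := fun _ hx =>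
  StarAlgebra.adjoin_le_centralizer_centralizer ℂ S (StarAlgebra.subset_adjoin ℂ S hx)

/-- A *-automorphism of a von Neumann algebra, as a linear bijection. -/
def autLinear (R : VonNeumannAlgebra H) (α : R.toStarSubalgebra ≃⋆ₐ[ℂ] R.toStarSubalgebra) :
    space R ≃ₗ[ℂ] space R where
  toFun x := ⟨(α ⟨x.1, x.2⟩).1, (α ⟨x.1, x.2⟩).2⟩
  invFun x := ⟨(α.symm ⟨x.1, x.2⟩).1, (α.symm ⟨x.1, x.2⟩).2⟩
  left_inv x := Subtype.ext (congrArg Subtype.val (α.symm_apply_apply ⟨x.1, x.2⟩))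
  right_inv x := Subtype.ext (congrArg Subtype.val (α.apply_symm_apply ⟨x.1, x.2⟩))
  map_add' x y := Subtype.ext (congrArg Subtype.val (map_add α ⟨x.1, x.2⟩ ⟨y.1, y.2⟩))
  map_smul' c x := Subtype.ext (congrArg Subtype.val (map_smul α c ⟨x.1, x.2⟩))

/-- `τ` is a faithful normal tracial state. -/
structure IsTrace (R : VonNeumannAlgebra H) (τ : space R →ₗ[ℂ] ℂ) : Prop where
  state : IsState (space R) τ
  normal : IsNormalFunctional (space R) τ
  tracial : ∀ x y : space R, τ (vnMul R x y) = τ (vnMul R y x)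
  faithful : ∀ x : space R, τ (vnMul R (vnStar R x) x) = 0 → x = 0

/-- `R` is a hyperfinite II₁ factor: an infinite-dimensional factor with a faithful normal tracial
state, generated by an increasing sequence of finite-dimensional *-subalgebras. -/
structure IsHyperfiniteII1Factor (R : VonNeumannAlgebra H) : Prop where
  factor : ∀ z ∈ R, z ∈ R.commutant → ∃ c : ℂ, z = c • (1 : H →L[ℂ] H)
  infinite_dimensional : ¬ FiniteDimensional ℂ (space R)
  exists_trace : ∃ τ : space R →ₗ[ℂ] ℂ, IsTrace R τ
  hyperfinite : ∃ A : ℕ → StarSubalgebra ℂ (H →L[ℂ] H), Monotone A ∧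
    (∀ n, FiniteDimensional ℂ (A n)) ∧ vnGen (⋃ n, (A n : Set (H →L[ℂ] H))) = R

/-- `τ` is an absorbing state for `P`: `‖ρ ∘ Pᵏ - τ‖ → 0` for every normal state `ρ`. -/
def IsAbsorbing {M : Submodule ℂ (H →L[ℂ] H)} (P : M →ₗ[ℂ] M) (τ : M →ₗ[ℂ] ℂ) : Prop :=
  ∀ ρ : M →ₗ[ℂ] ℂ, IsState M ρ → IsNormalFunctional M ρ →
    Tendsto (fun k : ℕ => functionalNorm (ρ ∘ₗ (P ^ k) - τ)) atTop (𝓝 0)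

/-! ### Tensor products -/

/-- The Hilbert space tensor product. -/
abbrev HTensor (H K : Type*) [NormedAddCommGroup H] [InnerProductSpace ℂ H]
    [NormedAddCommGroup K] [InnerProductSpace ℂ K] : Type _ :=
  UniformSpace.Completion (H ⊗[ℂ] K)

/-- The operator `x ⊗ y` on the Hilbert space tensor product. -/
def opTensor (x : H →L[ℂ] H) (y : K →L[ℂ] K) : HTensor H K →L[ℂ] HTensor H K :=
  (TensorProduct.mapL x y).completion

theorem opTensor_coe (x : H →L[ℂ] H) (y : K →L[ℂ] K) (ζ : H ⊗[ℂ] K) :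
    opTensor x y (ζ : HTensor H K) = (TensorProduct.mapL x y ζ : HTensor H K) :=
  ContinuousLinearMap.completion_apply_coe _ _

theorem opTensor_add_right (x : H →L[ℂ] H) (y z : K →L[ℂ] K) :
    opTensor x (y + z) = opTensor x y + opTensor x z := by
  refine ContinuousLinearMap.coeFn_injective ?_
  refine UniformSpace.Completion.ext (ContinuousLinearMap.continuous _)
    (ContinuousLinearMap.continuous _) fun ζ => ?_
  change opTensor x (y + z) ζ = opTensor x y ζ + opTensor x z ζ
  rw [opTensor_coe, opTensor_coe, opTensor_coe, TensorProduct.mapL_add_right,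
    ← UniformSpace.Completion.coe_add]
  rfl

theorem opTensor_smul_right (c : ℂ) (x : H →L[ℂ] H) (y : K →L[ℂ] K) :
    opTensor x (c • y) = c • opTensor x y := by
  refine ContinuousLinearMap.coeFn_injective ?_
  refine UniformSpace.Completion.ext (ContinuousLinearMap.continuous _)
    (ContinuousLinearMap.continuous _) fun ζ => ?_
  change opTensor x (c • y) ζ = c • opTensor x y ζ
  rw [opTensor_coe, opTensor_coe, TensorProduct.mapL_smul_right,
    ← UniformSpace.Completion.coe_smul]
  rfl

/-- The spatial (von Neumann algebra) tensor product. -/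
def vnTensor (R : VonNeumannAlgebra H) (S : VonNeumannAlgebra K) :
    VonNeumannAlgebra (HTensor H K) :=
  vnGen {T | ∃ x ∈ R, ∃ y ∈ S, T = opTensor x y}

/-- The elementary tensor `x ⊗ y` as an element of the spatial tensor product. -/
def tmul {R : VonNeumannAlgebra H} {S : VonNeumannAlgebra K} (x : space R) (y : space S) :
    space (vnTensor R S) :=
  ⟨opTensor x.1 y.1, subset_vnGen _ ⟨x.1, x.2, y.1, y.2, rfl⟩⟩

/-- The map `E(x) = 1 ⊗ x`. -/
def oneTensor (R : VonNeumannAlgebra H) (S : VonNeumannAlgebra K) :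
    space S →ₗ[ℂ] space (vnTensor R S) where
  toFun y := tmul ⟨1, R.toStarSubalgebra.one_mem⟩ y
  map_add' y z := Subtype.ext (opTensor_add_right 1 y.1 z.1)
  map_smul' c y := Subtype.ext (opTensor_smul_right c 1 y.1)

/-- `L = P ⊗ Q` on the spatial tensor product: `L(x ⊗ y) = P(x) ⊗ Q(y)` on elementary tensors,
and `L` is the only normal linear map with this property. -/
structure IsTensorMap {R : VonNeumannAlgebra H} {S : VonNeumannAlgebra K}
    (P : space R →ₗ[ℂ] space R) (Q : space S →ₗ[ℂ] space S)
    (L : space (vnTensor R S) →ₗ[ℂ] space (vnTensor R S)) : Prop where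
  normal : IsNormalMap L
  map_tmul : ∀ x y, L (tmul x y) = tmul (P x) (Q y)
  unique : ∀ L' : space (vnTensor R S) →ₗ[ℂ] space (vnTensor R S), IsNormalMap L' →
    (∀ x y, L' (tmul x y) = tmul (P x) (Q y)) → L' = L

end VN

end

end UCP

open UCP

/-! Write E for `1 ⊗ ·` and T for the map `x ↦ τ(x)1`. The tensor map is the product of the
commuting maps P ⊗ id and id ⊗ α. At every matrix level the powers of id ⊗ α have completely
contractive inverses, so they do not change norms of functionals, and ‖ρ ∘ Lᵏ‖ = ‖ρ ∘ (Pᵏ ⊗ id)‖.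
Absorption, polarised from states to vector functionals, gives norm convergence of ρ ∘ Pᵏ to ρ(1)τ.
Slicing by elementary tensors carries this to ρ ∘ (Pᵏ ⊗ id) → ρ ∘ (T ⊗ id) for a total set of vector
functionals, and complete contractivity extends it to all normal ρ
(`IsAbsorbing.tendstoNorm_ampMap`). Finally T ⊗ id factors through E by a complete contraction and
fixes the range of E, so ρ ∘ (T ⊗ id) and ρ ∘ E have equal norms (`functionalNorm_ampMap_stateMap`).
Nondegeneracy is the injectivity of E. For the second part, P = ½(id + T) is absorbing because T is
idempotent.

The tensor maps have to be built. An orthonormal basis of one leg turns an operator on the tensor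
product into an infinite matrix over the von Neumann algebra of the other leg. Apply P to the
entries of each finite corner and pass to a weak limit along an ultrafilter
(`IsFrame.exists_slice`). Normality of the limit holds because the predual of a von Neumann algebra
is norm closed (`mem_strongPredual_of_mem_closure`). That the limit maps the tensor product into
itself, and that it is unique, follow from the density theorem `IsNormalOnBH.eq_zero_of_mem_vnGen`.

A *-automorphism is completely positive since a positive matrix over R is a square of a matrix over
R. Its normality uses the trace: a sequence argument with an operator monotone function shows that
A(x) is weakly small on positive contractions of small trace (`IsTrace.exists_re_inner_lt`). Hence
vector functionals of A obey a bound ε‖y‖ + C‖yη‖, and Hahn-Banach turns this bound into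
approximation by normal functionals. -/

namespace UCP

noncomputable section

/-! ### Normal functionals and normal maps -/

section NormalFunctionals

variable {H : Type*} [NormedAddCommGroup H] [InnerProductSpace ℂ H] [CompleteSpace H]
variable {K : Type*} [NormedAddCommGroup K] [InnerProductSpace ℂ K] [CompleteSpace K]

/-- The vector functional `x ↦ ⟪a, x b⟫`. -/
def vecFun (a b : H) : (H →L[ℂ] H) →L[ℂ] ℂ :=
  innerSL ℂ a ∘L ContinuousLinearMap.apply ℂ H b

@[simp] theorem vecFun_apply (a b : H) (x : H →L[ℂ] H) : vecFun a b x = ⟪a, x b⟫_ℂ := rfl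

theorem norm_vecFun_le (a b : H) : ‖vecFun a b‖ ≤ ‖a‖ * ‖b‖ := by
  refine ContinuousLinearMap.opNorm_le_bound _ (by positivity) fun x => ?_
  rw [vecFun_apply]
  calc ‖⟪a, x b⟫_ℂ‖ ≤ ‖a‖ * ‖x b‖ := norm_inner_le_norm _ _
    _ ≤ ‖a‖ * (‖x‖ * ‖b‖) := by gcongr; exact x.le_opNorm b
    _ = ‖a‖ * ‖b‖ * ‖x‖ := by ring

theorem summable_norm_mul_norm {ι : Type*} {a b : ι → H} (ha : Summable fun n => ‖a n‖ ^ 2)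
    (hb : Summable fun n => ‖b n‖ ^ 2) : Summable fun n => ‖a n‖ * ‖b n‖ := by
  refine Summable.of_nonneg_of_le (fun n => by positivity) (fun n => ?_) (ha.add hb)
  nlinarith [sq_nonneg (‖a n‖ - ‖b n‖), sq_nonneg (‖a n‖), sq_nonneg (‖b n‖)]

theorem summable_vecFun {ι : Type*} {a b : ι → H} (ha : Summable fun n => ‖a n‖ ^ 2)
    (hb : Summable fun n => ‖b n‖ ^ 2) : Summable fun n => vecFun (a n) (b n) :=
  Summable.of_norm_bounded (summable_norm_mul_norm ha hb) fun _ => norm_vecFun_le _ _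

theorem summable_inner_apply {ι : Type*} {a b : ι → H} (ha : Summable fun n => ‖a n‖ ^ 2)
    (hb : Summable fun n => ‖b n‖ ^ 2) (x : H →L[ℂ] H) : Summable fun n => ⟪a n, x (b n)⟫_ℂ :=
  Summable.of_norm_bounded ((summable_norm_mul_norm ha hb).mul_right ‖x‖) fun n =>
    ((vecFun (a n) (b n)).le_opNorm x).trans (by gcongr; exact norm_vecFun_le _ _)

theorem tsum_vecFun_apply {ι : Type*} {a b : ι → H} (ha : Summable fun n => ‖a n‖ ^ 2)
    (hb : Summable fun n => ‖b n‖ ^ 2) (x : H →L[ℂ] H) :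
    (∑' n, vecFun (a n) (b n)) x = ∑' n, ⟪a n, x (b n)⟫_ℂ :=
  (ContinuousLinearMap.apply ℂ ℂ x).map_tsum (summable_vecFun ha hb)

/-- Sums of functionals and double series are naturally indexed by `ℕ ⊕ ℕ` or `ℕ × ℕ`; this returns
them to the sequences indexed by ℕ in the definition. -/
theorem isNormalOnBH_of_equiv {ι : Type*} (e : ι ≃ ℕ) {a b : ι → H}
    (ha : Summable fun n => ‖a n‖ ^ 2) (hb : Summable fun n => ‖b n‖ ^ 2)
    {f : (H →L[ℂ] H) →ₗ[ℂ] ℂ} (hf : ∀ x, f x = ∑' n, ⟪a n, x (b n)⟫_ℂ) : IsNormalOnBH f :=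
  ⟨a ∘ e.symm, b ∘ e.symm, (e.symm.summable_iff (f := fun n => ‖a n‖ ^ 2)).2 ha,
    (e.symm.summable_iff (f := fun n => ‖b n‖ ^ 2)).2 hb, fun x => by
      rw [hf x]; exact (e.symm.tsum_eq fun n => ⟪a n, x (b n)⟫_ℂ).symm⟩

theorem isNormalOnBH_vecFun (a b : H) : IsNormalOnBH (vecFun a b : (H →L[ℂ] H) →ₗ[ℂ] ℂ) := by
  refine ⟨Pi.single 0 a, Pi.single 0 b, ?_, ?_, fun x => ?_⟩
  · exact summable_of_ne_finset_zero (s := {0}) fun n hn => by simp_all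
  · exact summable_of_ne_finset_zero (s := {0}) fun n hn => by simp_all
  · rw [tsum_eq_single 0 fun n hn => by simp [hn]]; simp

theorem IsNormalOnBH.add {f g : (H →L[ℂ] H) →ₗ[ℂ] ℂ} (hf : IsNormalOnBH f)
    (hg : IsNormalOnBH g) : IsNormalOnBH (f + g) := by
  obtain ⟨a, b, ha, hb, hf⟩ := hf
  obtain ⟨a', b', ha', hb', hg⟩ := hg
  refine isNormalOnBH_of_equiv Equiv.natSumNatEquivNat (a := Sum.elim a a') (b := Sum.elim b b')
    ?_ ?_ fun x => ?_
  · exact ha.sum (f := fun n => ‖Sum.elim a a' n‖ ^ 2) ha'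
  · exact hb.sum (f := fun n => ‖Sum.elim b b' n‖ ^ 2) hb'
  · have h := (summable_inner_apply ha hb x).hasSum.sum
      (f := fun n => ⟪Sum.elim a a' n, x (Sum.elim b b' n)⟫_ℂ)
      (summable_inner_apply ha' hb' x).hasSum
    rw [h.tsum_eq, LinearMap.add_apply, hf, hg]

theorem IsNormalOnBH.smul {f : (H →L[ℂ] H) →ₗ[ℂ] ℂ} (c : ℂ) (hf : IsNormalOnBH f) :
    IsNormalOnBH (c • f) := by
  obtain ⟨a, b, ha, hb, hf⟩ := hf
  refine ⟨a, fun n => c • b n, ha, ?_, fun x => ?_⟩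
  · simpa [norm_smul, mul_pow] using hb.mul_left (‖c‖ ^ 2)
  · simp [hf, tsum_mul_left]

/-- The space of normal functionals on `B(H)`. -/
def normalBH (H : Type*) [NormedAddCommGroup H] [InnerProductSpace ℂ H] [CompleteSpace H] :
    Submodule ℂ ((H →L[ℂ] H) →ₗ[ℂ] ℂ) where
  carrier := {f | IsNormalOnBH f}
  add_mem' := IsNormalOnBH.add
  zero_mem' := by simpa using (isNormalOnBH_vecFun (0 : H) 0).smul 0
  smul_mem' := fun c _ hf => hf.smul c

/-- The predual of a subspace of `B(H)`, as a space of linear functionals. -/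
def predual (M : Submodule ℂ (H →L[ℂ] H)) : Submodule ℂ (M →ₗ[ℂ] ℂ) :=
  (normalBH H).map (LinearMap.lcomp ℂ ℂ M.subtype)

theorem mem_predual {M : Submodule ℂ (H →L[ℂ] H)} {ρ : M →ₗ[ℂ] ℂ} :
    ρ ∈ predual M ↔ IsNormalFunctional M ρ := by
  constructor
  · rintro ⟨f, hf, rfl⟩
    exact ⟨f, hf, fun _ => rfl⟩
  · rintro ⟨f, hf, h⟩
    exact ⟨f, hf, LinearMap.ext fun x => (h x).symm⟩

theorem weakStar_eq (M : Submodule ℂ (H →L[ℂ] H)) :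
    weakStar M = ⨅ f : {f : (H →L[ℂ] H) →ₗ[ℂ] ℂ // IsNormalOnBH f},
      TopologicalSpace.induced (f.1 ∘ₗ M.subtype) inferInstance := by
  rw [weakStar, weakStarBH, induced_iInf]
  simp only [induced_compose]
  rfl

/-- A functional continuous for the topology induced by a family of functionals is a finite linear
combination of them, and here the family is already a linear subspace. -/
theorem continuous_iff_isNormalFunctional {M : Submodule ℂ (H →L[ℂ] H)} {ρ : M →ₗ[ℂ] ℂ} :
    @Continuous M ℂ (weakStar M) _ ρ ↔ IsNormalFunctional M ρ := by
  rw [weakStar_eq, ← LinearMap.mem_span_iff_continuous, ← mem_predual]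
  have : Set.range (fun f : {f : (H →L[ℂ] H) →ₗ[ℂ] ℂ // IsNormalOnBH f} => f.1 ∘ₗ M.subtype) =
      predual M := by
    ext ρ
    simp only [Set.mem_range, Subtype.exists, predual]
    constructor
    · rintro ⟨f, hf, rfl⟩; exact ⟨f, hf, rfl⟩
    · rintro ⟨f, hf, rfl⟩; exact ⟨f, hf, rfl⟩
  rw [this, Submodule.span_eq]

/-- Normality as the existence of a pre-adjoint; nearly every later normality proof goes through
this criterion. -/
theorem isNormalMap_iff {M : Submodule ℂ (H →L[ℂ] H)} {N : Submodule ℂ (K →L[ℂ] K)}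
    {L : M →ₗ[ℂ] N} :
    IsNormalMap L ↔ ∀ ρ, IsNormalFunctional N ρ → IsNormalFunctional M (ρ ∘ₗ L) := by
  constructor
  · intro h ρ hρ
    rw [← continuous_iff_isNormalFunctional] at hρ ⊢
    exact @Continuous.comp _ _ _ (weakStar M) (weakStar N) _ _ _ hρ h
  · intro h
    rw [IsNormalMap, weakStar_eq N, continuous_iInf_rng]
    rintro ⟨f, hf⟩
    rw [continuous_induced_rng]
    exact continuous_iff_isNormalFunctional.2 (h (f ∘ₗ N.subtype) ⟨f, hf, fun _ => rfl⟩)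

theorem isNormalFunctional_vecFun (M : Submodule ℂ (H →L[ℂ] H)) (a b : H) :
    IsNormalFunctional M ((vecFun a b : (H →L[ℂ] H) →ₗ[ℂ] ℂ) ∘ₗ M.subtype) :=
  ⟨_, isNormalOnBH_vecFun a b, fun _ => rfl⟩

theorem IsNormalMap.comp {L : Type*} [NormedAddCommGroup L] [InnerProductSpace ℂ L]
    [CompleteSpace L] {M : Submodule ℂ (H →L[ℂ] H)} {N : Submodule ℂ (K →L[ℂ] K)}
    {O : Submodule ℂ (L →L[ℂ] L)} {g : N →ₗ[ℂ] O} {f : M →ₗ[ℂ] N} (hg : IsNormalMap g)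
    (hf : IsNormalMap f) : IsNormalMap (g ∘ₗ f) :=
  @Continuous.comp _ _ _ (weakStar M) (weakStar N) (weakStar O) _ _ hg hf

theorem isNormalMap_id (M : Submodule ℂ (H →L[ℂ] H)) :
    IsNormalMap (LinearMap.id : M →ₗ[ℂ] M) :=
  @continuous_id _ (weakStar M)

theorem IsNormalOnBH.eq_tsum {f : (H →L[ℂ] H) →ₗ[ℂ] ℂ} (hf : IsNormalOnBH f) :
    ∃ a b : ℕ → H, Summable (fun n => ‖a n‖ ^ 2) ∧ Summable (fun n => ‖b n‖ ^ 2) ∧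
      f = (∑' n, vecFun (a n) (b n) : (H →L[ℂ] H) →L[ℂ] ℂ) := by
  obtain ⟨a, b, ha, hb, h⟩ := hf
  exact ⟨a, b, ha, hb, LinearMap.ext fun x => by
    rw [h]; exact (tsum_vecFun_apply ha hb x).symm⟩

theorem vecFun_add_left (a a' b : H) : vecFun (a + a') b = vecFun a b + vecFun a' b := by
  ext x; simp

theorem vecFun_add_right (a b b' : H) : vecFun a (b + b') = vecFun a b + vecFun a b' := by
  ext x; simp

theorem vecFun_smul_left (c : ℂ) (a b : H) : vecFun (c • a) b = star c • vecFun a b := by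
  ext x; simp [mul_comm]

theorem vecFun_smul_right (c : ℂ) (a b : H) : vecFun a (c • b) = c • vecFun a b := by
  ext x; simp

theorem continuous_vecFun_left (b : H) : Continuous fun a : H => vecFun a b :=
  ((ContinuousLinearMap.compL ℂ (H →L[ℂ] H) H ℂ).flip
    (ContinuousLinearMap.apply ℂ H b)).continuous.comp (innerSL ℂ).continuous

theorem continuous_vecFun_right (a : H) : Continuous fun b : H => vecFun a b :=
  (ContinuousLinearMap.compL ℂ (H →L[ℂ] H) H ℂ (innerSL ℂ a)).continuous.comp
    (ContinuousLinearMap.apply ℂ H).continuous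

/-- Normal functionals lie in the norm closure of the span of the vector functionals given by a
total set of vectors. -/
theorem IsNormalOnBH.mem_closure_span {D : Set H} (hD : Dense (Submodule.span ℂ D : Set H))
    {a b : ℕ → H} (ha : Summable fun n => ‖a n‖ ^ 2) (hb : Summable fun n => ‖b n‖ ^ 2) :
    (∑' n, vecFun (a n) (b n)) ∈ (Submodule.span ℂ
      {f | ∃ u ∈ D, ∃ v ∈ D, f = vecFun u v}).topologicalClosure := by
  set W := (Submodule.span ℂ {f | ∃ u ∈ D, ∃ v ∈ D, f = vecFun u v}).topologicalClosure
    with hW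
  have hWc : IsClosed (W : Set ((H →L[ℂ] H) →L[ℂ] ℂ)) :=
    Submodule.isClosed_topologicalClosure _
  -- The two vectors are freed one at a time, each by linearity and then continuity in that vector.
  have h1 : ∀ v ∈ D, ∀ u, vecFun u v ∈ W := by
    intro v hv
    refine hD.induction (P := fun u => vecFun u v ∈ W) ?_
      (hWc.preimage (continuous_vecFun_left v))
    intro u hu
    induction hu using Submodule.span_induction with
    | mem u hu =>
      exact Submodule.le_topologicalClosure _ (Submodule.subset_span ⟨u, hu, v, hv, rfl⟩)
    | zero =>
      have : vecFun (0 : H) v = 0 := by ext x; simp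
      rw [this]; exact W.zero_mem
    | add u u' _ _ h h' => rw [vecFun_add_left]; exact W.add_mem h h'
    | smul c u _ h => rw [vecFun_smul_left]; exact W.smul_mem _ h
  have h2 : ∀ u v, vecFun u v ∈ W := by
    intro u
    refine hD.induction (P := fun v => vecFun u v ∈ W) ?_
      (hWc.preimage (continuous_vecFun_right u))
    intro v hv
    induction hv using Submodule.span_induction with
    | mem v hv => exact h1 v hv u
    | zero =>
      have : vecFun u (0 : H) = 0 := by ext x; simp
      rw [this]; exact W.zero_mem
    | add v v' _ _ h h' => rw [vecFun_add_right]; exact W.add_mem h h'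
    | smul c v _ h => rw [vecFun_smul_right]; exact W.smul_mem _ h
  exact hWc.mem_of_tendsto (summable_vecFun ha hb).hasSum
    (Eventually.of_forall fun s => W.sum_mem fun n _ => h2 _ _)

/-- Normal functionals are norm limits of combinations of the vector functionals given by a
total set of vectors. -/
theorem IsNormalOnBH.exists_approx {D : Set H} (hD : Dense (Submodule.span ℂ D : Set H))
    {f : (H →L[ℂ] H) →ₗ[ℂ] ℂ} (hf : IsNormalOnBH f) {ε : ℝ} (hε : 0 < ε) :
    ∃ g ∈ Submodule.span ℂ {f | ∃ u ∈ D, ∃ v ∈ D, f = vecFun u v},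
      ∀ x, ‖f x - g x‖ ≤ ε * ‖x‖ := by
  obtain ⟨a, b, ha, hb, rfl⟩ := hf.eq_tsum
  have h := IsNormalOnBH.mem_closure_span hD ha hb
  obtain ⟨g, hg, hfg⟩ := Metric.mem_closure_iff.1 h ε hε
  refine ⟨g, hg, fun x => ?_⟩
  rw [dist_eq_norm] at hfg
  exact (ContinuousLinearMap.le_opNorm ((∑' n, vecFun (a n) (b n)) - g) x).trans
    (mul_le_mul_of_nonneg_right hfg.le (norm_nonneg x))

end NormalFunctionals

/-! ### Sesquilinear forms and weak operator limits -/

section WeakLimits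

variable {H : Type*} [NormedAddCommGroup H] [InnerProductSpace ℂ H] [CompleteSpace H]

/-- Riesz representation yields an operator in the left slot of the inner product; its adjoint is
the one wanted. -/
theorem exists_op_of_sesquilinear (B : H → H → ℂ) (C : ℝ)
    (hal : ∀ a a' b, B (a + a') b = B a b + B a' b) (hsl : ∀ c a b, B (c • a) b = star c * B a b)
    (har : ∀ a b b', B a (b + b') = B a b + B a b') (hsr : ∀ c a b, B a (c • b) = c * B a b)
    (hB : ∀ a b, ‖B a b‖ ≤ C * ‖a‖ * ‖b‖) : ∃ x : H →L[ℂ] H, ∀ a b, ⟪a, x b⟫_ℂ = B a b := by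
  let B' : H →L⋆[ℂ] H →L[ℂ] ℂ := LinearMap.mkContinuous₂
    (LinearMap.mk₂'ₛₗ (starRingEnd ℂ) (RingHom.id ℂ) B hal
      (fun c a b => by simp [hsl]) har (fun c a b => by simp [hsr])) C hB
  refine ⟨(InnerProductSpace.continuousLinearMapOfBilin B').adjoint, fun a b => ?_⟩
  rw [ContinuousLinearMap.adjoint_inner_right,
    InnerProductSpace.continuousLinearMapOfBilin_apply]
  rfl

theorem norm_apply_le_of_re_inner_le {x : H →L[ℂ] H} {C : ℝ}
    (h : ∀ a b : H, ‖a‖ ≤ 1 → ‖b‖ ≤ 1 → (⟪a, x b⟫_ℂ).re ≤ C) : ‖x‖ ≤ C := by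
  have hC : 0 ≤ C := by simpa using h 0 0 (by simp) (by simp)
  refine ContinuousLinearMap.opNorm_le_bound _ hC fun b => ?_
  by_cases hb : b = 0
  · simp [hb]
  by_cases hx : x b = 0
  · rw [hx, norm_zero]; positivity
  have hb' : 0 < ‖b‖ := norm_pos_iff.2 hb
  have hx' : 0 < ‖x b‖ := norm_pos_iff.2 hx
  -- Testing on the unit vectors in the directions of `x b` and `b` gives exactly ‖x b‖ / ‖b‖.
  have := h (((‖x b‖⁻¹ : ℝ) : ℂ) • x b) (((‖b‖⁻¹ : ℝ) : ℂ) • b)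
    (by simp [norm_smul, inv_mul_cancel₀ hx'.ne']) (by simp [norm_smul, inv_mul_cancel₀ hb'.ne'])
  rw [map_smul, inner_smul_left, inner_smul_right, Complex.conj_ofReal, Complex.re_ofReal_mul,
    Complex.re_ofReal_mul, inner_self_eq_norm_sq_to_K] at this
  norm_cast at this
  have h2 : ‖x b‖⁻¹ * (‖b‖⁻¹ * ‖x b‖ ^ 2) = ‖x b‖ / ‖b‖ := by field_simp
  change ‖x b‖⁻¹ * (‖b‖⁻¹ * ‖x b‖ ^ 2) ≤ C at this
  rw [h2, div_le_iff₀ hb'] at this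
  exact this

/-- A bounded family of operators has a weak operator limit along every ultrafilter. -/
theorem exists_weak_limit {ι : Type*} (U : Ultrafilter ι) (x : ι → H →L[ℂ] H) (C : ℝ)
    (hx : ∀ i, ‖x i‖ ≤ C) :
    ∃ y : H →L[ℂ] H, ∀ a b, Tendsto (fun i => ⟪a, x i b⟫_ℂ) U (𝓝 ⟪a, y b⟫_ℂ) := by
  have hb : ∀ a b i, ‖⟪a, x i b⟫_ℂ‖ ≤ C * ‖a‖ * ‖b‖ := fun a b i => by
    calc ‖⟪a, x i b⟫_ℂ‖ ≤ ‖a‖ * (‖x i‖ * ‖b‖) :=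
          (norm_inner_le_norm _ _).trans (by gcongr; exact (x i).le_opNorm b)
      _ ≤ ‖a‖ * (C * ‖b‖) := by gcongr; exact hx i
      _ = _ := by ring
  -- Each matrix coefficient stays in a compact disc, so it converges along the ultrafilter; the
  -- limits inherit sesquilinearity and the bound.
  have hlim : ∀ a b, ∃ z : ℂ, ‖z‖ ≤ C * ‖a‖ * ‖b‖ ∧
      Tendsto (fun i => ⟪a, x i b⟫_ℂ) U (𝓝 z) := by
    intro a b
    obtain ⟨z, hz, h⟩ := (isCompact_closedBall (0 : ℂ) (C * ‖a‖ * ‖b‖)).ultrafilter_le_nhds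
      (U.map fun i => ⟪a, x i b⟫_ℂ) (by
        rw [le_principal_iff]
        exact Eventually.of_forall (f := (U : Filter ι)) fun i => by simpa using hb a b i)
    exact ⟨z, by simpa using hz, h⟩
  choose B hBn hB using hlim
  obtain ⟨y, hy⟩ := exists_op_of_sesquilinear B C
    (fun a a' b => tendsto_nhds_unique (hB (a + a') b) (by
      simpa only [inner_add_left] using (hB a b).add (hB a' b)))
    (fun c a b => tendsto_nhds_unique (hB (c • a) b) (by
      simpa only [inner_smul_left, starRingEnd_apply] using (hB a b).const_mul (star c)))
    (fun a b b' => tendsto_nhds_unique (hB a (b + b')) (by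
      simpa only [map_add, inner_add_right] using (hB a b).add (hB a b')))
    (fun c a b => tendsto_nhds_unique (hB a (c • b)) (by
      simpa only [map_smul, inner_smul_right] using (hB a b).const_mul c)) hBn
  exact ⟨y, fun a b => by rw [hy]; exact hB a b⟩

theorem norm_le_of_tendsto_inner {ι : Type*} {l : Filter ι} [l.NeBot] {x : ι → H →L[ℂ] H}
    {C : ℝ} (hx : ∀ i, ‖x i‖ ≤ C) {y : H →L[ℂ] H}
    (hy : ∀ a b, Tendsto (fun i => ⟪a, x i b⟫_ℂ) l (𝓝 ⟪a, y b⟫_ℂ)) : ‖y‖ ≤ C := by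
  refine norm_apply_le_of_re_inner_le fun a b ha hb => ?_
  refine le_of_tendsto ((Complex.continuous_re.tendsto _).comp (hy a b))
    (Eventually.of_forall fun i => ?_)
  refine (Complex.re_le_norm _).trans ((norm_inner_le_norm _ _).trans ?_)
  have h1 : ‖x i b‖ ≤ C := ((x i).le_opNorm b).trans <| by
    have := hx i
    nlinarith [norm_nonneg (x i), norm_nonneg b]
  nlinarith [norm_nonneg (x i b), norm_nonneg a]

end WeakLimits

/-! ### The unit ball of the predual of a von Neumann algebra -/

section Predual

variable {H : Type*} [NormedAddCommGroup H] [InnerProductSpace ℂ H] [CompleteSpace H]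

theorem mem_of_commute_commutant (R : VonNeumannAlgebra H) {x : H →L[ℂ] H}
    (h : ∀ y ∈ R.commutant, x * y = y * x) : x ∈ R := by
  rw [← R.commutant_commutant, VonNeumannAlgebra.mem_commutant_iff]
  exact fun y hy => (h y hy).symm

theorem commute_of_mem_commutant {R : VonNeumannAlgebra H} {x y : H →L[ℂ] H} (hx : x ∈ R)
    (hy : y ∈ R.commutant) : x * y = y * x :=
  VonNeumannAlgebra.mem_commutant_iff.1 hy x hx

/-- The bicommutant theorem in terms of matrix coefficients, a form that survives weak limits and
can be tested with normal functionals. -/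
theorem mem_of_inner_commute (R : VonNeumannAlgebra H) {x : H →L[ℂ] H}
    (h : ∀ y ∈ R.commutant, ∀ a b : H, ⟪a, x (y b)⟫_ℂ = ⟪y.adjoint a, x b⟫_ℂ) : x ∈ R :=
  mem_of_commute_commutant R fun y hy => by
    ext b
    refine ext_inner_left ℂ fun a => ?_
    rw [mul_apply_eq_comp, h y hy, ContinuousLinearMap.adjoint_inner_left]
    rfl

theorem inner_commute_of_mem {R : VonNeumannAlgebra H} {x y : H →L[ℂ] H} (hx : x ∈ R)
    (hy : y ∈ R.commutant) (a b : H) : ⟪a, x (y b)⟫_ℂ = ⟪y.adjoint a, x b⟫_ℂ := by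
  rw [ContinuousLinearMap.adjoint_inner_left]
  congr 1
  exact congrArg (fun T : H →L[ℂ] H => T b) (commute_of_mem_commutant hx hy)

theorem mem_of_tendsto_inner (R : VonNeumannAlgebra H) {ι : Type*} {l : Filter ι} [l.NeBot]
    {x : ι → H →L[ℂ] H} (hx : ∀ i, x i ∈ R) {y : H →L[ℂ] H}
    (hy : ∀ a b, Tendsto (fun i => ⟪a, x i b⟫_ℂ) l (𝓝 ⟪a, y b⟫_ℂ)) : y ∈ R :=
  mem_of_inner_commute R fun z hz a b => by
    refine tendsto_nhds_unique (hy a (z b)) ?_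
    simp_rw [inner_commute_of_mem (hx _) hz]
    exact hy _ _

variable {V : Type*} [NormedAddCommGroup V] [NormedSpace ℂ V]

/-- The restriction of a vector functional to a subspace of `B(H)`. -/
def vecRestrict (j : V →ₗᵢ[ℂ] (H →L[ℂ] H)) (a b : H) : StrongDual ℂ V :=
  vecFun a b ∘L j.toContinuousLinearMap

theorem vecRestrict_apply (j : V →ₗᵢ[ℂ] (H →L[ℂ] H)) (a b : H) (x : V) :
    vecRestrict j a b x = ⟪a, j x b⟫_ℂ := rfl

theorem norm_vecRestrict_le (j : V →ₗᵢ[ℂ] (H →L[ℂ] H)) (a b : H) :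
    ‖vecRestrict j a b‖ ≤ ‖a‖ * ‖b‖ :=
  ContinuousLinearMap.opNorm_le_bound _ (by positivity) fun x =>
    ((vecFun a b).le_opNorm (j x)).trans (by rw [j.norm_map]; gcongr; exact norm_vecFun_le a b)

theorem summable_vecRestrict (j : V →ₗᵢ[ℂ] (H →L[ℂ] H)) {ι : Type*} {a b : ι → H}
    (ha : Summable fun n => ‖a n‖ ^ 2) (hb : Summable fun n => ‖b n‖ ^ 2) :
    Summable fun n => vecRestrict j (a n) (b n) :=
  Summable.of_norm_bounded (summable_norm_mul_norm ha hb) fun _ => norm_vecRestrict_le _ _ _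

theorem hasSum_vecRestrict_apply (j : V →ₗᵢ[ℂ] (H →L[ℂ] H)) {ι : Type*} {a b : ι → H}
    {φ : StrongDual ℂ V} (h : HasSum (fun n => vecRestrict j (a n) (b n)) φ) (x : V) :
    HasSum (fun n => ⟪a n, j x (b n)⟫_ℂ) (φ x) := by
  have := (ContinuousLinearMap.apply ℂ ℂ x).hasSum h
  simpa only [Function.comp_def, ContinuousLinearMap.apply_apply, vecRestrict_apply] using this

/-- Functionals `∑ ⟪aₙ, · bₙ⟫` with `∑ ‖aₙ‖² ≤ 1` and `∑ ‖bₙ‖² ≤ 1`. -/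
def predualBall (j : V →ₗᵢ[ℂ] (H →L[ℂ] H)) : Set (StrongDual ℂ V) :=
  {φ | ∃ a b : ℕ → H, Summable (fun n => ‖a n‖ ^ 2) ∧ Summable (fun n => ‖b n‖ ^ 2) ∧
    ∑' n, ‖a n‖ ^ 2 ≤ 1 ∧ ∑' n, ‖b n‖ ^ 2 ≤ 1 ∧
    HasSum (fun n => vecRestrict j (a n) (b n)) φ}

theorem vecRestrict_real_smul (j : V →ₗᵢ[ℂ] (H →L[ℂ] H)) {s : ℝ} (hs : 0 ≤ s) (a b : H) :
    vecRestrict j (((√s : ℝ) : ℂ) • a) (((√s : ℝ) : ℂ) • b) = s • vecRestrict j a b := by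
  ext x
  change ⟪_, j x _⟫_ℂ = s • ⟪a, j x b⟫_ℂ
  rw [map_smul, inner_smul_left, inner_smul_right, Complex.conj_ofReal, ← mul_assoc,
    ← Complex.ofReal_mul, Real.mul_self_sqrt hs, Complex.real_smul]

theorem norm_sqrt_smul_sq {s : ℝ} (hs : 0 ≤ s) (a : H) :
    ‖((√s : ℝ) : ℂ) • a‖ ^ 2 = s * ‖a‖ ^ 2 := by
  rw [norm_smul, mul_pow, Complex.norm_real, Real.norm_eq_abs, sq_abs, Real.sq_sqrt hs]

/-- Concatenate the two representing sequences after scaling them by √s and √t: the functionals then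
combine as sφ + tφ', and the square sums combine with the same weights. -/
theorem convex_predualBall (j : V →ₗᵢ[ℂ] (H →L[ℂ] H)) : Convex ℝ (predualBall j) := by
  rintro φ ⟨a, b, ha, hb, ha1, hb1, hφ⟩ φ' ⟨a', b', ha', hb', ha1', hb1', hφ'⟩ s t hs ht hst
  have key : ∀ {c c' : ℕ → H}, Summable (fun n => ‖c n‖ ^ 2) → Summable (fun n => ‖c' n‖ ^ 2) →
      ∑' n, ‖c n‖ ^ 2 ≤ 1 → ∑' n, ‖c' n‖ ^ 2 ≤ 1 →
      ∃ z ≤ (1 : ℝ), HasSum (fun n : ℕ ⊕ ℕ => ‖Sum.elim (fun n => ((√s : ℝ) : ℂ) • c n)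
        (fun n => ((√t : ℝ) : ℂ) • c' n) n‖ ^ 2) z := by
    intro c c' hc hc' hc1 hc1'
    refine ⟨s * ∑' n, ‖c n‖ ^ 2 + t * ∑' n, ‖c' n‖ ^ 2, by nlinarith, ?_⟩
    refine HasSum.sum ?_ ?_
    · simpa only [Function.comp_def, Sum.elim_inl, norm_sqrt_smul_sq hs] using hc.hasSum.mul_left s
    · simpa only [Function.comp_def, Sum.elim_inr, norm_sqrt_smul_sq ht] using
        hc'.hasSum.mul_left t
  obtain ⟨z, hz, hza⟩ := key ha ha' ha1 ha1'
  obtain ⟨w, hw, hwb⟩ := key hb hb' hb1 hb1'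
  let e := Equiv.natSumNatEquivNat.symm
  have hza' := (e.hasSum_iff (f := _)).2 hza
  have hwb' := (e.hasSum_iff (f := _)).2 hwb
  refine ⟨_ ∘ e, _ ∘ e, hza'.summable, hwb'.summable, hza'.tsum_eq.le.trans hz,
    hwb'.tsum_eq.le.trans hw, ?_⟩
  refine (e.hasSum_iff (f := fun n : ℕ ⊕ ℕ => vecRestrict j
      (Sum.elim (fun n => ((√s : ℝ) : ℂ) • a n) (fun n => ((√t : ℝ) : ℂ) • a' n) n)
      (Sum.elim (fun n => ((√s : ℝ) : ℂ) • b n) (fun n => ((√t : ℝ) : ℂ) • b' n) n))).2 ?_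
  refine HasSum.sum ?_ ?_
  · simpa only [Function.comp_def, Sum.elim_inl, vecRestrict_real_smul j hs] using
      hφ.const_smul s
  · simpa only [Function.comp_def, Sum.elim_inr, vecRestrict_real_smul j ht] using
      hφ'.const_smul t

theorem vecRestrict_mem_predualBall (j : V →ₗᵢ[ℂ] (H →L[ℂ] H)) {a b : H} (ha : ‖a‖ ≤ 1)
    (hb : ‖b‖ ≤ 1) : vecRestrict j a b ∈ predualBall j := by
  have key : ∀ c : H, ‖c‖ ≤ 1 → ∃ z ≤ (1 : ℝ),
      HasSum (fun n => ‖(Pi.single 0 c : ℕ → H) n‖ ^ 2) z := fun c hc => by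
    refine ⟨‖c‖ ^ 2, by nlinarith [norm_nonneg c], ?_⟩
    simpa using hasSum_single (f := fun n => ‖(Pi.single 0 c : ℕ → H) n‖ ^ 2) 0
      (fun n hn => by simp [hn])
  obtain ⟨z, hz, hza⟩ := key a ha
  obtain ⟨w, hw, hwb⟩ := key b hb
  refine ⟨_, _, hza.summable, hwb.summable, hza.tsum_eq.le.trans hz, hwb.tsum_eq.le.trans hw, ?_⟩
  have := hasSum_single (f := fun n => vecRestrict j ((Pi.single 0 a : ℕ → H) n)
    ((Pi.single 0 b : ℕ → H) n)) 0 (fun n hn => by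
      ext x; simp [vecRestrict_apply, hn])
  simpa using this

/-- The predual inside the Banach space dual. -/
def strongPredual (j : V →ₗᵢ[ℂ] (H →L[ℂ] H)) : Submodule ℂ (StrongDual ℂ V) :=
  ((normalBH H).map (LinearMap.lcomp ℂ ℂ j.toLinearMap)).comap (ContinuousLinearMap.coeLM ℂ)

theorem mem_strongPredual {j : V →ₗᵢ[ℂ] (H →L[ℂ] H)} {φ : StrongDual ℂ V} :
    φ ∈ strongPredual j ↔ ∃ f, IsNormalOnBH f ∧ ∀ x, φ x = f (j x) := by
  constructor
  · rintro ⟨f, hf, h⟩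
    exact ⟨f, hf, fun x => (congrArg (fun g : V →ₗ[ℂ] ℂ => g x) h).symm⟩
  · rintro ⟨f, hf, h⟩
    exact ⟨f, hf, LinearMap.ext fun x => (h x).symm⟩

theorem exists_hasSum_of_mem_strongPredual {j : V →ₗᵢ[ℂ] (H →L[ℂ] H)} {φ : StrongDual ℂ V}
    (hφ : φ ∈ strongPredual j) : ∃ a b : ℕ → H, HasSum (fun n => vecRestrict j (a n) (b n)) φ := by
  obtain ⟨f, ⟨a, b, ha, hb, h⟩, hf⟩ := mem_strongPredual.1 hφ
  refine ⟨a, b, ?_⟩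
  have hs := (summable_vecRestrict j ha hb).hasSum
  convert hs
  ext x
  rw [← (hasSum_vecRestrict_apply j hs x).tsum_eq, ← h]
  exact hf x

theorem predualBall_subset_strongPredual (j : V →ₗᵢ[ℂ] (H →L[ℂ] H)) :
    predualBall j ⊆ strongPredual j := by
  rintro φ ⟨a, b, ha, hb, -, -, hφ⟩
  refine mem_strongPredual.2
    ⟨(∑' n, vecFun (a n) (b n) : (H →L[ℂ] H) →L[ℂ] ℂ), ⟨a, b, ha, hb, fun x => ?_⟩, fun x => ?_⟩
  · exact tsum_vecFun_apply ha hb x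
  · exact (hasSum_vecRestrict_apply j hφ x).tsum_eq.symm.trans (tsum_vecFun_apply ha hb (j x)).symm

/-- If not, Hahn-Banach separates φ from the ball by some Λ in the bidual. The form (a, b) ↦ Λ(⟪a, ·
b⟫) is given by an operator; it commutes with the commutant, hence lies in R, and it has norm at
most the separating constant u. Evaluation at it agrees with Λ on the closed predual, so ‖φ‖ ≤ 1
contradicts the separation. -/
theorem mem_closure_predualBall (R : VonNeumannAlgebra H) {j : V →ₗᵢ[ℂ] (H →L[ℂ] H)}
    (hj : ∀ x, x ∈ R ↔ ∃ v, j v = x) {φ : StrongDual ℂ V}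
    (hφ : φ ∈ (strongPredual j).topologicalClosure) (h1 : ‖φ‖ ≤ 1) :
    φ ∈ closure (predualBall j) := by
  by_contra hn
  obtain ⟨Λ, u, hΛ, hu⟩ := RCLike.geometric_hahn_banach_closed_point (𝕜 := ℂ)
    (convex_predualBall j).closure isClosed_closure hn
  have hadd : ∀ a a' b : H, vecRestrict j (a + a') b =
      vecRestrict j a b + vecRestrict j a' b := fun a a' b => by
    ext x; simp [vecRestrict_apply]
  obtain ⟨x, hx⟩ := exists_op_of_sesquilinear (fun a b => Λ (vecRestrict j a b)) ‖Λ‖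
    (fun a a' b => by rw [hadd, map_add])
    (fun c a b => by
      rw [← smul_eq_mul, ← map_smul]; congr 1; ext x
      simp [vecRestrict_apply, mul_comm])
    (fun a b b' => by
      rw [← map_add]; congr 1; ext x; simp [vecRestrict_apply])
    (fun c a b => by
      rw [← smul_eq_mul, ← map_smul]; congr 1; ext x; simp [vecRestrict_apply])
    (fun a b => (Λ.le_opNorm _).trans (by
      rw [mul_assoc]; gcongr; exact norm_vecRestrict_le _ _ _))
  have hxR : x ∈ R := mem_of_inner_commute R fun y hy a b => by
    rw [hx, hx]
    congr 1
    ext z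
    exact inner_commute_of_mem ((hj _).2 ⟨z, rfl⟩) hy a b
  obtain ⟨v, rfl⟩ := (hj x).1 hxR
  have hxu : ‖j v‖ ≤ u := norm_apply_le_of_re_inner_le fun a b ha hb => by
    rw [hx]
    exact (hΛ _ (subset_closure (vecRestrict_mem_predualBall j ha hb))).le
  have hev : ∀ ψ ∈ (strongPredual j).topologicalClosure, Λ ψ = ψ v := by
    intro ψ hψ
    refine closure_minimal (s := (strongPredual j : Set (StrongDual ℂ V)))
      (t := {ψ | Λ ψ = ψ v}) ?_ (isClosed_eq Λ.continuous
        (ContinuousLinearMap.apply ℂ ℂ (v)).continuous) hψ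
    intro ψ hψ
    obtain ⟨a, b, hab⟩ := exists_hasSum_of_mem_strongPredual hψ
    have h1 := Λ.hasSum hab
    have h2 := hasSum_vecRestrict_apply _ hab v
    refine h1.unique ?_
    simpa only [Function.comp_def, ← hx] using h2
  have h3 : ‖φ v‖ ≤ u := (φ.le_opNorm _).trans (by
    have hv : ‖v‖ ≤ u := (j.norm_map v).symm.le.trans hxu
    nlinarith [norm_nonneg φ, norm_nonneg v])
  have h4 := Complex.re_le_norm (φ v)
  rw [hev φ hφ] at hu
  exact absurd (hu.trans_le h4) (not_lt.2 h3)

end Predual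

/-! ### Norm closedness of the predual -/

section PredualClosed

variable {H : Type*} [NormedAddCommGroup H] [InnerProductSpace ℂ H] [CompleteSpace H]
variable {V : Type*} [NormedAddCommGroup V] [NormedSpace ℂ V]

theorem vecRestrict_sqrt_smul (j : V →ₗᵢ[ℂ] (H →L[ℂ] H)) {s : ℝ} (hs : 0 ≤ s) (a b : H) :
    vecRestrict j (((√s : ℝ) : ℂ) • a) (((√s : ℝ) : ℂ) • b) = (s : ℂ) • vecRestrict j a b := by
  rw [vecRestrict_real_smul j hs]
  ext x
  simp [vecRestrict_apply]

/-- Each weight r k is shared as √(r k) between the two legs of a functional; block k then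
contributes at most r k to the square sum of a leg. -/
theorem summable_sqrt_smul {r : ℕ → ℝ} (hr : ∀ k, 0 < r k) (hrs : Summable r) {a : ℕ → ℕ → H}
    (ha : ∀ k, Summable fun n => ‖a k n‖ ^ 2) (ha1 : ∀ k, ∑' n, ‖a k n‖ ^ 2 ≤ 1) :
    Summable fun p : ℕ × ℕ => ‖((√(r p.1) : ℝ) : ℂ) • a p.1 p.2‖ ^ 2 := by
  simp_rw [norm_sqrt_smul_sq (hr _).le]
  rw [summable_prod_of_nonneg fun p => mul_nonneg (hr p.1).le (by positivity)]
  refine ⟨fun k => (ha k).mul_left (r k), ?_⟩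
  simp_rw [tsum_mul_left]
  refine Summable.of_nonneg_of_le (fun k => mul_nonneg (hr k).le
    (tsum_nonneg fun n => by positivity)) (fun k => ?_) hrs
  nlinarith [hr k, ha1 k]

theorem exists_predualBall_approx (R : VonNeumannAlgebra H) {j : V →ₗᵢ[ℂ] (H →L[ℂ] H)}
    (hj : ∀ x, x ∈ R ↔ ∃ v, j v = x) {φ : StrongDual ℂ V}
    (hφ : φ ∈ (strongPredual j).topologicalClosure) {r : ℝ} (hr : 0 < r) (h1 : ‖φ‖ ≤ r) :
    ∃ c ∈ predualBall j, ‖φ - (r : ℂ) • c‖ ≤ r / 2 := by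
  have h2 : ((r⁻¹ : ℝ) : ℂ) • φ ∈ closure (predualBall j) := by
    refine mem_closure_predualBall R hj (Submodule.smul_mem _ _ hφ) ?_
    rw [norm_smul, Complex.norm_real, norm_inv, Real.norm_of_nonneg hr.le, inv_mul_le_iff₀ hr]
    simpa using h1
  obtain ⟨c, hc, h⟩ := Metric.mem_closure_iff.1 h2 (1 / 2) (by norm_num)
  refine ⟨c, hc, ?_⟩
  have h3 : φ - (r : ℂ) • c = (r : ℂ) • (((r⁻¹ : ℝ) : ℂ) • φ - c) := by
    rw [smul_sub, smul_smul, ← Complex.ofReal_mul, mul_inv_cancel₀ hr.ne', Complex.ofReal_one,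
      one_smul]
  rw [dist_eq_norm] at h
  rw [h3, norm_smul, Complex.norm_real, Real.norm_of_nonneg hr.le]
  nlinarith

/-- The predual of a von Neumann algebra is norm closed in the Banach space dual. -/
theorem mem_strongPredual_of_mem_closure (R : VonNeumannAlgebra H) {j : V →ₗᵢ[ℂ] (H →L[ℂ] H)}
    (hj : ∀ x, x ∈ R ↔ ∃ v, j v = x) {φ : StrongDual ℂ V}
    (hφ : φ ∈ (strongPredual j).topologicalClosure) : φ ∈ strongPredual j := by
  -- Successive approximation: each stage leaves a remainder of at most half the previous radius.
  -- The `+ 1` keeps the radii positive when φ = 0.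
  set r : ℕ → ℝ := fun k => (‖φ‖ + 1) * (1 / 2) ^ k with hr
  have hrpos : ∀ k, 0 < r k := fun k => by positivity
  have hrs : Summable r := (summable_geometric_of_lt_one (by norm_num) (by norm_num)).mul_left _
  choose! c hc hcn using fun (ψ : StrongDual ℂ V) (k : ℕ)
    (h : ψ ∈ (strongPredual j).topologicalClosure ∧ ‖ψ‖ ≤ r k) =>
      exists_predualBall_approx R hj h.1 (hrpos k) h.2
  let ψ : ℕ → StrongDual ℂ V := fun k => Nat.rec φ (fun k ψ => ψ - (r k : ℂ) • c ψ k) k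
  have hψs : ∀ k, ψ (k + 1) = ψ k - (r k : ℂ) • c (ψ k) k := fun k => rfl
  have hψ : ∀ k, ψ k ∈ (strongPredual j).topologicalClosure ∧ ‖ψ k‖ ≤ r k := by
    intro k
    induction k with
    | zero => exact ⟨hφ, by simp only [hr, pow_zero]; change ‖φ‖ ≤ _; linarith⟩
    | succ k ih =>
      rw [hψs]
      refine ⟨Submodule.sub_mem _ ih.1 ?_, (hcn _ _ ih).trans (le_of_eq ?_)⟩
      · exact Submodule.smul_mem _ _ (Submodule.le_topologicalClosure _
          (predualBall_subset_strongPredual j (hc _ _ ih)))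
      · simp only [hr, pow_succ]; ring
  have hpart : ∀ n, ∑ k ∈ Finset.range n, (r k : ℂ) • c (ψ k) k = φ - ψ n := by
    intro n
    induction n with
    | zero => simp [ψ]
    | succ n ih => rw [Finset.sum_range_succ, ih, hψs]; abel
  have hψ0 : Tendsto ψ atTop (𝓝 0) :=
    squeeze_zero_norm (fun k => (hψ k).2) hrs.tendsto_atTop_zero
  choose a b ha hb ha1 hb1 hab using fun k => hc (ψ k) k (hψ k)
  have hA := summable_sqrt_smul hrpos hrs ha ha1
  have hB := summable_sqrt_smul hrpos hrs hb hb1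
  have hsum := summable_vecRestrict j hA hB
  -- The series of approximants is flattened into one family over ℕ × ℕ, which exhibits φ in the
  -- form required of a normal functional.
  have hφsum : HasSum (fun k => (r k : ℂ) • c (ψ k) k)
      (∑' p : ℕ × ℕ, vecRestrict j (((√(r p.1) : ℝ) : ℂ) • a p.1 p.2)
        (((√(r p.1) : ℝ) : ℂ) • b p.1 p.2)) := by
    refine hsum.hasSum.prod_fiberwise fun k => ?_
    simp_rw [vecRestrict_sqrt_smul j (hrpos k).le]
    exact (hab k).const_smul (r k : ℂ)
  have hφeq : φ = ∑' p : ℕ × ℕ, vecRestrict j (((√(r p.1) : ℝ) : ℂ) • a p.1 p.2)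
        (((√(r p.1) : ℝ) : ℂ) • b p.1 p.2) := by
    refine tendsto_nhds_unique ?_ hφsum.tendsto_sum_nat
    simp_rw [hpart]
    simpa using tendsto_const_nhds.sub hψ0
  refine mem_strongPredual.2 ⟨(∑' p : ℕ × ℕ, vecFun (((√(r p.1) : ℝ) : ℂ) • a p.1 p.2)
        (((√(r p.1) : ℝ) : ℂ) • b p.1 p.2) : (H →L[ℂ] H) →L[ℂ] ℂ),
    isNormalOnBH_of_equiv (Denumerable.eqv (ℕ × ℕ)) hA hB
      fun x => tsum_vecFun_apply hA hB x, fun x => ?_⟩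
  have h5 := hsum.hasSum
  rw [← hφeq] at h5
  exact (hasSum_vecRestrict_apply j h5 x).tsum_eq.symm.trans (tsum_vecFun_apply hA hB (j x)).symm

theorem IsNormalFunctional.exists_bound {M : Submodule ℂ (H →L[ℂ] H)} {ρ : M →ₗ[ℂ] ℂ}
    (hρ : IsNormalFunctional M ρ) : ∃ C, 0 ≤ C ∧ ∀ x, ‖ρ x‖ ≤ C * ‖x‖ := by
  obtain ⟨f, hf, h⟩ := hρ
  obtain ⟨a, b, ha, hb, rfl⟩ := hf.eq_tsum
  refine ⟨_, norm_nonneg (∑' n, vecFun (a n) (b n)), fun x => ?_⟩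
  rw [h]
  exact ContinuousLinearMap.le_opNorm (∑' n, vecFun (a n) (b n)) x.1

/-- The usable form of closedness: no continuity of φ is assumed, since one approximation already
bounds it. This is how normality is later checked on total sets of vectors only. -/
theorem isNormalFunctional_of_approx (R : VonNeumannAlgebra H) {φ : space R →ₗ[ℂ] ℂ}
    (h : ∀ ε > 0, ∃ ψ, IsNormalFunctional (space R) ψ ∧ ∀ x, ‖φ x - ψ x‖ ≤ ε * ‖x‖) :
    IsNormalFunctional (space R) φ := by
  obtain ⟨ψ, hψ, hφψ⟩ := h 1 one_pos
  obtain ⟨C, hC, hCψ⟩ := hψ.exists_bound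
  let Φ : StrongDual ℂ (space R) := φ.mkContinuous (1 + C) fun x => by
    calc ‖φ x‖ = ‖(φ x - ψ x) + ψ x‖ := by simp
      _ ≤ 1 * ‖x‖ + C * ‖x‖ := (norm_add_le _ _).trans (add_le_add (hφψ x) (hCψ x))
      _ = _ := by ring
  have hj : ∀ x, x ∈ R ↔ ∃ v, (space R).subtypeₗᵢ v = x := fun x =>
    ⟨fun hx => ⟨⟨x, hx⟩, rfl⟩, fun ⟨v, hv⟩ => hv ▸ v.2⟩
  have hmem : Φ ∈ (strongPredual (space R).subtypeₗᵢ).topologicalClosure := by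
    refine Metric.mem_closure_iff.2 fun ε hε => ?_
    obtain ⟨ψ, hψ, hφψ⟩ := h (ε / 2) (half_pos hε)
    obtain ⟨C, hC, hCψ⟩ := hψ.exists_bound
    obtain ⟨f, hf, hfψ⟩ := hψ
    refine ⟨ψ.mkContinuous C hCψ, mem_strongPredual.2 ⟨f, hf, hfψ⟩, ?_⟩
    rw [dist_eq_norm]
    exact (ContinuousLinearMap.opNorm_le_bound _ (by positivity) hφψ).trans_lt (by linarith)
  obtain ⟨f, hf, hfφ⟩ := mem_strongPredual.1 (mem_strongPredual_of_mem_closure R hj hmem)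
  exact ⟨f, hf, hfφ⟩

end PredualClosed

/-! ### The density theorem for generated von Neumann algebras -/

section Density

variable {H : Type*} [NormedAddCommGroup H] [InnerProductSpace ℂ H] [CompleteSpace H]

/-- The Hilbert space of square summable sequences in `H`. -/
abbrev SeqSpace (H : Type*) [NormedAddCommGroup H] [InnerProductSpace ℂ H] : Type _ :=
  lp (fun _ : ℕ => H) 2

theorem memℓp_two_iff {b : ℕ → H} : Memℓp b 2 ↔ Summable fun n => ‖b n‖ ^ 2 := by
  rw [memℓp_gen_iff (by norm_num)]
  simp

/-- A square summable sequence as an element of `SeqSpace H`. -/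
def seqVec (b : ℕ → H) (hb : Summable fun n => ‖b n‖ ^ 2) : SeqSpace H :=
  ⟨b, memℓp_two_iff.2 hb⟩

theorem SeqSpace.hasSum_norm_sq (f : SeqSpace H) : HasSum (fun n => ‖f n‖ ^ 2) (‖f‖ ^ 2) := by
  simpa using lp.hasSum_norm (p := 2) (by norm_num) f

/-- The diagonal action of an operator on square summable sequences. -/
def seqAmp (T : H →L[ℂ] H) : SeqSpace H →L[ℂ] SeqSpace H :=
  LinearMap.mkContinuous
    { toFun := fun f => seqVec (fun n => T (f n)) (by
        refine Summable.of_nonneg_of_le (fun n => by positivity) (fun n => ?_)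
          ((SeqSpace.hasSum_norm_sq f).summable.mul_left (‖T‖ ^ 2))
        rw [← mul_pow]
        gcongr
        exact T.le_opNorm _)
      map_add' := fun f g => by ext n; exact map_add T _ _
      map_smul' := fun c f => by ext n; exact map_smul T c _ } ‖T‖ (fun f => by
    refine le_of_sq_le_sq ?_ (by positivity)
    rw [← (SeqSpace.hasSum_norm_sq _).tsum_eq, mul_pow, ← (SeqSpace.hasSum_norm_sq f).tsum_eq,
      ← tsum_mul_left]
    refine (SeqSpace.hasSum_norm_sq _).summable.tsum_le_tsum (fun n => ?_)
      ((SeqSpace.hasSum_norm_sq f).summable.mul_left _)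
    rw [← mul_pow]
    gcongr
    exact T.le_opNorm _)

@[simp] theorem seqAmp_apply (T : H →L[ℂ] H) (f : SeqSpace H) (n : ℕ) :
    seqAmp T f n = T (f n) := rfl

theorem inner_seqAmp (T : H →L[ℂ] H) (f g : SeqSpace H) :
    ⟪f, seqAmp T g⟫_ℂ = ⟪seqAmp (star T) f, g⟫_ℂ := by
  rw [lp.inner_eq_tsum, lp.inner_eq_tsum]
  congr 1
  ext n
  rw [seqAmp_apply, seqAmp_apply, ContinuousLinearMap.star_eq_adjoint,
    ContinuousLinearMap.adjoint_inner_left]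

theorem seqAmp_single (T : H →L[ℂ] H) (n : ℕ) (v : H) :
    seqAmp T (lp.single 2 n v) = lp.single 2 n (T v) := by
  ext m
  rw [seqAmp_apply]
  by_cases h : m = n
  · subst h; simp
  · simp [lp.single_apply, h]

theorem seqSpace_clm_ext {F : Type*} [NormedAddCommGroup F] [NormedSpace ℂ F]
    {A B : SeqSpace H →L[ℂ] F} (h : ∀ n v, A (lp.single 2 n v) = B (lp.single 2 n v)) : A = B := by
  ext f
  have hf := lp.hasSum_single (p := 2) (by norm_num) f
  refine (A.hasSum hf).unique ?_
  simpa only [Function.comp_def, h] using B.hasSum hf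

/-- **Density theorem**: a normal functional that vanishes on a self-adjoint multiplicative set of
operators vanishes on the von Neumann algebra it generates. -/
theorem IsNormalOnBH.eq_zero_of_mem_vnGen {S : Set (H →L[ℂ] H)} (hone : 1 ∈ S)
    (hmul : ∀ x ∈ S, ∀ y ∈ S, x * y ∈ S) (hstar : ∀ x ∈ S, star x ∈ S)
    {f : (H →L[ℂ] H) →ₗ[ℂ] ℂ} (hf : IsNormalOnBH f) (h0 : ∀ s ∈ S, f s = 0)
    {T : H →L[ℂ] H} (hT : T ∈ vnGen S) : f T = 0 := by
  obtain ⟨a, b, ha, hb, hf⟩ := hf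
  -- On square summable sequences f becomes a single matrix coefficient of the diagonal
  -- amplification, so weak-star density reduces to a cyclic subspace argument.
  have hf' : ∀ x, f x = ⟪seqVec a ha, seqAmp x (seqVec b hb)⟫_ℂ := fun x => by
    rw [hf, lp.inner_eq_tsum]; rfl
  let K := (Submodule.span ℂ {w | ∃ s ∈ S, w = seqAmp s (seqVec b hb)}).topologicalClosure
  have hKinv : ∀ s ∈ S, ∀ u ∈ K, seqAmp s u ∈ K := by
    intro s hs u hu
    refine map_mem_closure (seqAmp s).continuous hu fun w hw => ?_
    change seqAmp s w ∈ Submodule.span ℂ _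
    induction hw using Submodule.span_induction with
    | mem w hw =>
      obtain ⟨t, ht, rfl⟩ := hw
      exact Submodule.subset_span ⟨s * t, hmul s hs t ht, rfl⟩
    | zero => rw [map_zero]; exact Submodule.zero_mem _
    | add w w' _ _ h h' => rw [map_add]; exact Submodule.add_mem _ h h'
    | smul c w _ h => rw [map_smul]; exact Submodule.smul_mem _ _ h
  have hKperp : ∀ s ∈ S, ∀ u ∈ Kᗮ, seqAmp s u ∈ Kᗮ := by
    intro s hs u hu w hw
    rw [inner_seqAmp]
    exact hu _ (hKinv _ (hstar s hs) w hw)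
  have : K.HasOrthogonalProjection :=
    have : CompleteSpace K := (Submodule.isClosed_topologicalClosure _).completeSpace_coe
    inferInstance
  let p := K.starProjection
  have hcomm : ∀ s ∈ S, ∀ u, p (seqAmp s u) = seqAmp s (p u) := by
    intro s hs u
    refine (Submodule.eq_starProjection_of_mem_orthogonal
      (hKinv s hs _ (Submodule.starProjection_apply_mem K u)) ?_)
    rw [← map_sub]
    exact hKperp s hs _ (Submodule.sub_starProjection_mem_orthogonal u)
  -- The projection onto the cyclic subspace K commutes with the amplified S, so its matrix entries
  -- lie in the commutant of S. Then T commutes with every entry, and its amplification commutes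
  -- with the projection and preserves K.
  let q : ℕ → ℕ → H →L[ℂ] H := fun m n =>
    lp.evalCLM ℂ (fun _ : ℕ => H) 2 m ∘L p ∘L lp.singleContinuousLinearMap ℂ (fun _ : ℕ => H) 2 n
  have hq : ∀ m n v, q m n v = p (lp.single 2 n v) m := fun m n v => rfl
  have hqS : ∀ m n, ∀ s ∈ S, s * q m n = q m n * s := by
    intro m n s hs
    ext v
    change s (q m n v) = q m n (s v)
    rw [hq, hq, ← seqAmp_single, hcomm s hs, seqAmp_apply]
  have hqT : ∀ m n, T * q m n = q m n * T := by
    intro m n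
    refine ((StarSubalgebra.mem_centralizer_iff ℂ).1 hT (q m n) ?_).1.symm
    refine (StarSubalgebra.mem_centralizer_iff ℂ).2 fun s hs => ⟨hqS m n s hs, ?_⟩
    exact hqS m n _ (hstar s hs)
  have hpT : p ∘L seqAmp T = seqAmp T ∘L p := by
    refine seqSpace_clm_ext fun n v => ?_
    ext m
    change p (seqAmp T _) m = T (p _ m)
    rw [seqAmp_single, ← hq, ← hq]
    exact congrArg (fun A : H →L[ℂ] H => A v) (hqT m n).symm
  have hbK : seqVec b hb ∈ K :=
    Submodule.le_topologicalClosure _ (Submodule.subset_span ⟨1, hone, rfl⟩)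
  have haK : seqVec a ha ∈ Kᗮ := by
    rw [Submodule.orthogonal_closure, Submodule.mem_orthogonal']
    intro w hw
    induction hw using Submodule.span_induction with
    | mem w hw =>
      obtain ⟨t, ht, rfl⟩ := hw
      rw [← hf', h0 t ht]
    | zero => rw [inner_zero_right]
    | add w w' _ _ h h' => rw [inner_add_right, h, h', add_zero]
    | smul c w _ h => rw [inner_smul_right, h, mul_zero]
  rw [hf']
  refine Submodule.inner_left_of_mem_orthogonal (K := K) ?_ haK
  have h2 := congrArg (fun A : SeqSpace H →L[ℂ] SeqSpace H => A (seqVec b hb)) hpT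
  change p (seqAmp T (seqVec b hb)) = seqAmp T (p (seqVec b hb)) at h2
  rw [Submodule.starProjection_eq_self_iff.2 hbK] at h2
  rw [← h2]
  exact Submodule.starProjection_apply_mem K _

end Density

/-! ### Positive operator matrices and complete contractivity -/

section CompletePositivity

open scoped ComplexOrder

variable {H : Type*} [NormedAddCommGroup H] [InnerProductSpace ℂ H] [CompleteSpace H]
variable {K : Type*} [NormedAddCommGroup K] [InnerProductSpace ℂ K] [CompleteSpace K]

theorem isPositive_iff_inner_right {T : H →L[ℂ] H} : T.IsPositive ↔ ∀ x, 0 ≤ ⟪x, T x⟫_ℂ := by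
  refine ⟨fun h x => h.inner_nonneg_right x, fun h => ?_⟩
  rw [ContinuousLinearMap.isPositive_iff_complex]
  intro x
  have h1 := h x
  rw [← inner_conj_symm, RCLike.nonneg_iff] at h1
  simp only [RCLike.conj_re, RCLike.conj_im, neg_eq_zero] at h1
  refine ⟨?_, h1.1⟩
  apply Complex.ext
  · simp
  · simpa using h1.2.symm

/-- The sesquilinear form of a matrix of operators. -/
def matForm {κ : Type*} [Fintype κ] (X : κ → κ → H →L[ℂ] H) (u v : κ → H) : ℂ :=
  ∑ i, ∑ j, ⟪u i, X i j (v j)⟫_ℂ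

/-- Positivity of a matrix of operators. -/
def IsPosMat {κ : Type*} [Fintype κ] (X : κ → κ → H →L[ℂ] H) : Prop :=
  ∀ u, 0 ≤ matForm X u u

theorem coord_apply (n : ℕ) (i : Fin n) (v : HPow n H) : coord n i v = v i := rfl

theorem sum_incl (n : ℕ) (v : HPow n H) : ∑ j, incl n j (v j) = v := by
  ext i
  rw [← coord_apply, map_sum]
  have : ∀ j, coord n i (incl n j (v j)) = if i = j then v j else 0 := fun j => by
    have := congrArg (fun T : H →L[ℂ] H => T (v j)) (coord_comp_incl (H := H) n i j)
    by_cases hij : i = j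
    · simpa [hij] using this
    · simpa [hij] using this
  simp [this]

theorem inner_eq_matForm_entry {n : ℕ} (X : HPow n H →L[ℂ] HPow n H) (u v : HPow n H) :
    ⟪u, X v⟫_ℂ = matForm (entry X) u v := by
  conv_lhs => rw [← sum_incl n v]
  rw [PiLp.inner_apply, matForm]
  refine Finset.sum_congr rfl fun i _ => ?_
  rw [map_sum, ← coord_apply n i (∑ j, X (incl n j (v j))), map_sum, inner_sum]
  rfl

theorem isPositive_iff_isPosMat_entry {n : ℕ} {X : HPow n H →L[ℂ] HPow n H} :
    X.IsPositive ↔ IsPosMat (entry X) := by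
  rw [isPositive_iff_inner_right]
  refine ⟨fun h u => ?_, fun h u => ?_⟩
  · have := h (WithLp.toLp 2 u)
    rwa [inner_eq_matForm_entry] at this
  · rw [inner_eq_matForm_entry]; exact h _

theorem matForm_reindex {κ κ' : Type*} [Fintype κ] [Fintype κ'] (e : κ' ≃ κ)
    (X : κ → κ → H →L[ℂ] H) (u v : κ → H) :
    matForm (fun i j => X (e i) (e j)) (u ∘ e) (v ∘ e) = matForm X u v := by
  unfold matForm
  rw [← e.sum_comp]
  exact Finset.sum_congr rfl fun i _ => e.sum_comp fun j => ⟪u (e i), X (e i) j (v j)⟫_ℂ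

theorem isPosMat_reindex {κ κ' : Type*} [Fintype κ] [Fintype κ'] (e : κ' ≃ κ)
    {X : κ → κ → H →L[ℂ] H} : IsPosMat (fun i j => X (e i) (e j)) ↔ IsPosMat X := by
  refine ⟨fun h u => ?_, fun h u => ?_⟩
  · rw [← matForm_reindex e]; exact h _
  · have := h (u ∘ e.symm)
    rw [← matForm_reindex e] at this
    simpa [Function.comp_assoc] using this

/-- Complete positivity, in terms of matrices of operators. -/
def IsCP {M : Submodule ℂ (H →L[ℂ] H)} {N : Submodule ℂ (K →L[ℂ] K)} (L : M →ₗ[ℂ] N) : Prop :=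
  ∀ (n : ℕ) (X : Fin n → Fin n → M), IsPosMat (fun i j => (X i j).1) →
    IsPosMat (fun i j => (L (X i j)).1)

theorem entry_ampMap {n : ℕ} {M : Submodule ℂ (H →L[ℂ] H)} {N : Submodule ℂ (K →L[ℂ] K)}
    (L : M →ₗ[ℂ] N) (X : amp n M) (i j : Fin n) :
    entry (ampMap n L X).1 i j = (L ⟨entry X.1 i j, X.2 i j⟩).1 :=
  entry_ofEntries _ i j

theorem isCP_iff {M : Submodule ℂ (H →L[ℂ] H)} {N : Submodule ℂ (K →L[ℂ] K)} {L : M →ₗ[ℂ] N} :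
    IsCP L ↔ ∀ (n : ℕ) (X : amp n M), (X : HPow n H →L[ℂ] HPow n H).IsPositive →
      (ampMap n L X : HPow n K →L[ℂ] HPow n K).IsPositive := by
  have h1 : ∀ n (X : amp n M), entry (ampMap n L X).1 =
      fun i j => (L ⟨entry X.1 i j, X.2 i j⟩).1 := fun n X => by
    ext1 i; ext1 j; exact entry_ampMap L X i j
  constructor
  · intro h n X hX
    rw [isPositive_iff_isPosMat_entry] at hX ⊢
    rw [h1]
    exact h n (fun i j => ⟨entry X.1 i j, X.2 i j⟩) hX
  · intro h n X hX
    have he : entry (ofEntries fun i j => (X i j).1) = fun i j => (X i j).1 := by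
      ext1 i; ext1 j; exact entry_ofEntries _ i j
    let Y : amp n M := ⟨ofEntries fun i j => (X i j).1, fun i j => by
      rw [entry_ofEntries]; exact (X i j).2⟩
    have h2 := h n Y (by
      rw [isPositive_iff_isPosMat_entry]; change IsPosMat (entry (ofEntries _)); rwa [he])
    rw [isPositive_iff_isPosMat_entry, h1] at h2
    have h3 : (fun i j => (L ⟨entry Y.1 i j, Y.2 i j⟩).1) = fun i j => (L (X i j)).1 := by
      ext1 i; ext1 j
      exact congrArg (fun x => (L x).1)
        (Subtype.ext (entry_ofEntries (fun i j => (X i j).1) i j))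
    rwa [h3] at h2

/-- Frees the index type, so that `Unit`, `κ ⊕ κ` and `Fin n × F` can be used directly. -/
theorem IsCP.isPosMat {M : Submodule ℂ (H →L[ℂ] H)} {N : Submodule ℂ (K →L[ℂ] K)}
    {L : M →ₗ[ℂ] N} (hL : IsCP L) {κ : Type*} [Fintype κ] {X : κ → κ → M}
    (hX : IsPosMat (fun i j => (X i j).1)) : IsPosMat (fun i j => (L (X i j)).1) := by
  let e := (Fintype.equivFin κ).symm
  rw [← isPosMat_reindex e] at hX ⊢
  exact hL _ (fun i j => X (e i) (e j)) hX

theorem matForm_smul_right {κ : Type*} [Fintype κ] (X : κ → κ → H →L[ℂ] H) (u v : κ → H)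
    (c : ℂ) : matForm X u (fun i => c • v i) = c * matForm X u v := by
  simp [matForm, Finset.mul_sum]

theorem matForm_smul_left {κ : Type*} [Fintype κ] (X : κ → κ → H →L[ℂ] H) (u v : κ → H)
    (c : ℂ) : matForm X (fun i => c • u i) v = star c * matForm X u v := by
  simp [matForm, Finset.sum_mul, mul_comm]

theorem matForm_star {κ : Type*} [Fintype κ] (X : κ → κ → H →L[ℂ] H) (u v : κ → H) :
    matForm (fun i j => star (X j i)) v u = star (matForm X u v) := by
  unfold matForm
  rw [Finset.sum_comm, star_sum]
  refine Finset.sum_congr rfl fun i _ => ?_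
  rw [star_sum]
  refine Finset.sum_congr rfl fun j _ => ?_
  change ⟪v j, (X i j).adjoint (u i)⟫_ℂ = _
  rw [ContinuousLinearMap.adjoint_inner_right]
  exact (inner_conj_symm _ _).symm

/-- The matrix `[c, -X; -X', c]`. -/
def blockMat {κ : Type*} [DecidableEq κ] {A : Type*} [AddCommGroup A] (c : A) (X X' : κ → κ → A) :
    κ ⊕ κ → κ ⊕ κ → A
  | .inl i, .inl j => if i = j then c else 0
  | .inl i, .inr j => -X i j
  | .inr i, .inl j => -X' i j
  | .inr i, .inr j => if i = j then c else 0

theorem map_blockMat {κ : Type*} [DecidableEq κ] {A B : Type*} [AddCommGroup A] [AddCommGroup B]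
    (f : A →+ B) (c : A) (X X' : κ → κ → A) (i j : κ ⊕ κ) :
    f (blockMat c X X' i j) =
      blockMat (f c) (fun i j => f (X i j)) (fun i j => f (X' i j)) i j := by
  rcases i with i | i <;> rcases j with j | j <;> simp [blockMat, apply_ite f]

theorem matForm_blockMat {κ : Type*} [Fintype κ] [DecidableEq κ] (c : ℝ)
    (X X' : κ → κ → H →L[ℂ] H) (w : κ ⊕ κ → H) :
    matForm (blockMat ((c : ℂ) • (1 : H →L[ℂ] H)) X X') w w =
      ((c * (∑ i, ‖w (.inl i)‖ ^ 2 + ∑ i, ‖w (.inr i)‖ ^ 2) : ℝ) : ℂ) -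
      matForm X (w ∘ .inl) (w ∘ .inr) - matForm X' (w ∘ .inr) (w ∘ .inl) := by
  have hd : ∀ u : κ → H, ∑ i, ∑ j, ⟪u i, (if i = j then (c : ℂ) • (1 : H →L[ℂ] H) else 0) (u j)⟫_ℂ =
      ((c * ∑ i, ‖u i‖ ^ 2 : ℝ) : ℂ) := by
    intro u
    push_cast
    rw [Finset.mul_sum]
    refine Finset.sum_congr rfl fun i _ => ?_
    rw [Finset.sum_eq_single i (fun j _ hj => by simp [hj.symm]) (by simp), if_pos rfl]
    rw [smul_apply, inner_smul_right, one_apply_eq_self, inner_self_eq_norm_sq_to_K]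
    rfl
  have h1 := hd (w ∘ .inl)
  have h2 := hd (w ∘ .inr)
  simp only [Function.comp_apply] at h1 h2
  simp only [matForm, Fintype.sum_sum_type, blockMat, Finset.sum_add_distrib, h1, h2,
    neg_apply, inner_neg_right, Finset.sum_neg_distrib, Function.comp_apply]
  push_cast
  ring

/-- Nonnegativity in ℂ includes being real: the second hypothesis forces A.re = B.re, and the first
then bounds their sum by c. In the application A and B come from L(X) and L(X*), so it need not be
known that L preserves adjoints. -/
theorem re_le_of_nonneg_sub {A B : ℂ} {c : ℝ} (h1 : 0 ≤ (c : ℂ) - A - B)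
    (h2 : 0 ≤ (c : ℂ) - Complex.I * A + Complex.I * B) : A.re ≤ c / 2 := by
  rw [Complex.nonneg_iff] at h1 h2
  simp at h1 h2
  linarith [h1.1, h2.2]

/-- Unital completely positive maps are completely contractive. -/
theorem IsCP.re_matForm_le {M : Submodule ℂ (H →L[ℂ] H)} {N : Submodule ℂ (K →L[ℂ] K)}
    {L : M →ₗ[ℂ] N} (hL : IsCP L) (hone : 1 ∈ M) (hstar : ∀ x ∈ M, star x ∈ M)
    (hu : (L ⟨1, hone⟩).1 = 1) {κ : Type*} [Fintype κ] {X : κ → κ → M} {c : ℝ}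
    (hX : ∀ u v, (matForm (fun i j => (X i j).1) u v).re ≤
      c / 2 * (∑ i, ‖u i‖ ^ 2 + ∑ i, ‖v i‖ ^ 2)) (u v : κ → K) :
    (matForm (fun i j => (L (X i j)).1) u v).re ≤
      c / 2 * (∑ i, ‖u i‖ ^ 2 + ∑ i, ‖v i‖ ^ 2) := by
  classical
  let X' : κ → κ → M := fun i j => ⟨star (X j i).1, hstar _ (X j i).2⟩
  -- The bound on X says that the block matrix with diagonal c and off-diagonal −X, −X* is positive;
  -- L preserves this, and unitality keeps the diagonal.
  let Y : κ ⊕ κ → κ ⊕ κ → M := blockMat ((c : ℂ) • ⟨1, hone⟩) X X'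
  have hY : IsPosMat fun i j => (Y i j).1 := by
    intro w
    have : (fun i j => (Y i j).1) = blockMat ((c : ℂ) • (1 : H →L[ℂ] H)) (fun i j => (X i j).1)
        (fun i j => star (X j i).1) := by
      ext1 i; ext1 j
      exact map_blockMat (M.subtype : M →+ (H →L[ℂ] H)) _ _ _ i j
    rw [this, matForm_blockMat, matForm_star (fun i j => (X i j).1)]
    have h := hX (w ∘ .inl) (w ∘ .inr)
    simp only [Function.comp_apply] at h
    rw [Complex.nonneg_iff]
    simp only [Complex.sub_re, Complex.sub_im, Complex.ofReal_re, Complex.ofReal_im,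
      Complex.star_def, Complex.conj_re, Complex.conj_im]
    constructor
    · linarith
    · ring
  have hLY := hL.isPosMat hY
  have hLYe : (fun i j => (L (Y i j)).1) = blockMat ((c : ℂ) • (1 : K →L[ℂ] K))
      (fun i j => (L (X i j)).1) (fun i j => (L (X' i j)).1) := by
    ext1 i; ext1 j
    refine (map_blockMat ((N.subtype ∘ₗ L : M →ₗ[ℂ] (K →L[ℂ] K)) : M →+ (K →L[ℂ] K)) _ _ _
      i j).trans ?_
    congr 1
    change (L ((c : ℂ) • ⟨1, hone⟩)).1 = _
    rw [map_smul, Submodule.coe_smul, hu]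
  rw [hLYe] at hLY
  have h1 := hLY (Sum.elim u v)
  have h2 := hLY (Sum.elim u (fun i => Complex.I • v i))
  rw [matForm_blockMat] at h1 h2
  simp only [Sum.elim_inl, Sum.elim_inr, Sum.elim_comp_inl, Sum.elim_comp_inr,
    matForm_smul_right, matForm_smul_left, norm_smul, Complex.norm_I, one_mul] at h1 h2
  have h3 := re_le_of_nonneg_sub h1 (by simpa [sub_eq_add_neg] using h2)
  linarith

/-- With its converse below, this trades ‖u‖‖v‖ for a sum of squares, which is additive over matrix
indices. -/
theorem norm_le_of_re_inner_le_sq {x : H →L[ℂ] H} {c : ℝ} (hc : 0 ≤ c)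
    (h : ∀ u v, (⟪u, x v⟫_ℂ).re ≤ c / 2 * (‖u‖ ^ 2 + ‖v‖ ^ 2)) : ‖x‖ ≤ c :=
  norm_apply_le_of_re_inner_le fun a b ha hb => (h a b).trans (by
    have h1 : ‖a‖ ^ 2 ≤ 1 := pow_le_one₀ (norm_nonneg a) ha
    have h2 : ‖b‖ ^ 2 ≤ 1 := pow_le_one₀ (norm_nonneg b) hb
    nlinarith)

theorem re_inner_le_of_norm_le {x : H →L[ℂ] H} {c : ℝ} (h : ‖x‖ ≤ c) (u v : H) :
    (⟪u, x v⟫_ℂ).re ≤ c / 2 * (‖u‖ ^ 2 + ‖v‖ ^ 2) := by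
  have h1 : (⟪u, x v⟫_ℂ).re ≤ ‖u‖ * (c * ‖v‖) :=
    (Complex.re_le_norm _).trans ((norm_inner_le_norm _ _).trans (by
      gcongr; exact (x.le_opNorm v).trans (by gcongr)))
  have h0 : 0 ≤ c := (norm_nonneg x).trans h
  nlinarith [mul_nonneg h0 (sq_nonneg (‖u‖ - ‖v‖))]

theorem HPow.norm_sq_eq {n : ℕ} (u : HPow n H) : ‖u‖ ^ 2 = ∑ i, ‖u i‖ ^ 2 :=
  PiLp.norm_sq_eq_of_L2 _ u

theorem IsCP.norm_ampMap_le {M : Submodule ℂ (H →L[ℂ] H)} {N : Submodule ℂ (K →L[ℂ] K)}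
    {L : M →ₗ[ℂ] N} (hL : IsCP L) (hone : 1 ∈ M) (hstar : ∀ x ∈ M, star x ∈ M)
    (hu : (L ⟨1, hone⟩).1 = 1) {n : ℕ} (X : amp n M) : ‖ampMap n L X‖ ≤ ‖X‖ := by
  refine norm_le_of_re_inner_le_sq (x := (ampMap n L X).1) (norm_nonneg X) fun u v => ?_
  rw [inner_eq_matForm_entry, HPow.norm_sq_eq, HPow.norm_sq_eq]
  have : entry (ampMap n L X).1 = fun i j => (L ⟨entry X.1 i j, X.2 i j⟩).1 := by
    ext1 i; ext1 j; exact entry_ampMap L X i j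
  rw [this]
  refine hL.re_matForm_le hone hstar hu (fun u v => ?_) _ _
  have h := re_inner_le_of_norm_le (le_refl ‖X.1‖) (WithLp.toLp 2 u) (WithLp.toLp 2 v)
  rwa [inner_eq_matForm_entry, HPow.norm_sq_eq, HPow.norm_sq_eq] at h

theorem IsCP.norm_map_le {M : Submodule ℂ (H →L[ℂ] H)} {N : Submodule ℂ (K →L[ℂ] K)}
    {L : M →ₗ[ℂ] N} (hL : IsCP L) (hone : 1 ∈ M) (hstar : ∀ x ∈ M, star x ∈ M)
    (hu : (L ⟨1, hone⟩).1 = 1) (x : M) : ‖L x‖ ≤ ‖x‖ := by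
  refine norm_le_of_re_inner_le_sq (x := (L x).1) (norm_nonneg x) fun u v => ?_
  have h := hL.re_matForm_le hone hstar hu (κ := Unit) (X := fun _ _ => x) (c := ‖x‖)
    (fun u v => by simpa [matForm] using re_inner_le_of_norm_le (le_refl ‖x.1‖) (u ()) (v ()))
    (fun _ => u) (fun _ => v)
  simpa [matForm] using h

theorem IsCP.nonneg {M : Submodule ℂ (H →L[ℂ] H)} {N : Submodule ℂ (K →L[ℂ] K)}
    {L : M →ₗ[ℂ] N} (hL : IsCP L) {x : M} (hx : x.1.IsPositive) : (L x).1.IsPositive := by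
  rw [isPositive_iff_inner_right] at hx ⊢
  intro u
  have := hL.isPosMat (κ := Unit) (X := fun _ _ => x)
    (fun u => by simpa [matForm] using hx (u ())) (fun _ => u)
  simpa [matForm] using this

theorem IsCP.comp {G : Type*} [NormedAddCommGroup G] [InnerProductSpace ℂ G] [CompleteSpace G]
    {M : Submodule ℂ (H →L[ℂ] H)} {N : Submodule ℂ (K →L[ℂ] K)} {O : Submodule ℂ (G →L[ℂ] G)}
    {g : N →ₗ[ℂ] O} {f : M →ₗ[ℂ] N} (hg : IsCP g) (hf : IsCP f) : IsCP (g ∘ₗ f) :=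
  fun n X hX => hg n (fun i j => f (X i j)) (hf n X hX)

theorem isNormalUCP_iff {M : Submodule ℂ (H →L[ℂ] H)} {N : Submodule ℂ (K →L[ℂ] K)}
    {L : M →ₗ[ℂ] N} : IsNormalUCP L ↔ IsNormalMap L ∧
      (∀ x : M, (x : H →L[ℂ] H) = 1 → (L x : K →L[ℂ] K) = 1) ∧ IsCP L := by
  rw [isCP_iff]
  exact ⟨fun h => ⟨h.1, h.2, h.3⟩, fun h => ⟨h.1, h.2.1, h.2.2⟩⟩

theorem IsNormalUCP.isCP {M : Submodule ℂ (H →L[ℂ] H)} {N : Submodule ℂ (K →L[ℂ] K)}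
    {L : M →ₗ[ℂ] N} (h : IsNormalUCP L) : IsCP L := (isNormalUCP_iff.1 h).2.2

end CompletePositivity

/-! ### Applying a completely positive map entrywise along a frame -/

section Slicing

open scoped ComplexOrder

variable {H : Type*} [NormedAddCommGroup H] [InnerProductSpace ℂ H] [CompleteSpace H]
variable {G : Type*} [NormedAddCommGroup G] [InnerProductSpace ℂ G] [CompleteSpace G]
variable {ι : Type*}

/-- A family of isometries `H → G` with mutually orthogonal ranges that span a dense subspace. -/
structure IsFrame (J : ι → H →L[ℂ] G) : Prop where
  inner_self : ∀ i u v, ⟪J i u, J i v⟫_ℂ = ⟪u, v⟫_ℂ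
  inner_ne : ∀ i j u v, i ≠ j → ⟪J i u, J j v⟫_ℂ = 0
  total : Dense (Submodule.span ℂ {g | ∃ i u, g = J i u} : Set G)

variable {J : ι → H →L[ℂ] G}

theorem IsFrame.adjoint_apply_self (hJ : IsFrame J) (i : ι) (u : H) : (J i).adjoint (J i u) = u :=
  ext_inner_left ℂ fun v => by rw [ContinuousLinearMap.adjoint_inner_right, hJ.inner_self]

theorem IsFrame.adjoint_apply_ne (hJ : IsFrame J) {i j : ι} (h : i ≠ j) (u : H) :
    (J i).adjoint (J j u) = 0 :=
  ext_inner_left ℂ fun v => by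
    rw [ContinuousLinearMap.adjoint_inner_right, hJ.inner_ne i j v u h, inner_zero_right]

/-- Bessel's inequality for the orthogonal ranges of the isometries. -/
theorem IsFrame.sum_norm_sq_le (hJ : IsFrame J) (F : Finset ι) (g : G) :
    ∑ i : F, ‖(J i).adjoint g‖ ^ 2 ≤ ‖g‖ ^ 2 := by
  classical
  set s := ∑ i : F, ‖(J i).adjoint g‖ ^ 2 with hs
  set p := ∑ i : F, J i ((J i).adjoint g) with hp
  have h1 : ⟪p, g⟫_ℂ = s := by
    rw [hp, sum_inner, hs]
    push_cast
    refine Finset.sum_congr rfl fun i _ => ?_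
    rw [← ContinuousLinearMap.adjoint_inner_right, inner_self_eq_norm_sq_to_K]
    rfl
  have h2 : ⟪p, p⟫_ℂ = s := by
    conv_lhs => rw [hp]
    rw [sum_inner, hs]
    push_cast
    refine Finset.sum_congr rfl fun i _ => ?_
    rw [inner_sum, Finset.sum_eq_single i, hJ.inner_self, inner_self_eq_norm_sq_to_K]
    · rfl
    · intro j _ hj
      exact hJ.inner_ne _ _ _ _ fun h => hj (Subtype.ext h).symm
    · simp
  have h3 : ⟪g, p⟫_ℂ = s := by rw [← inner_conj_symm, h1, Complex.conj_ofReal]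
  have h4 : (⟪g - p, g - p⟫_ℂ).re = ‖g‖ ^ 2 - s := by
    rw [inner_sub_left, inner_sub_right, inner_sub_right, h1, h2, h3, inner_self_eq_norm_sq_to_K]
    simp [← Complex.ofReal_pow]
  have h5 : 0 ≤ (⟪g - p, g - p⟫_ℂ).re := inner_self_nonneg (𝕜 := ℂ)
  linarith

theorem IsFrame.clm_ext (hJ : IsFrame J) {S T : G →L[ℂ] G}
    (h : ∀ i j u v, ⟪J i u, S (J j v)⟫_ℂ = ⟪J i u, T (J j v)⟫_ℂ) : S = T := by
  have h1 : ∀ j v, S (J j v) = T (J j v) := by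
    intro j v
    refine ext_inner_left ℂ fun g => ?_
    refine hJ.total.induction (P := fun g => ⟪g, S (J j v)⟫_ℂ = ⟪g, T (J j v)⟫_ℂ) (fun g hg => ?_)
      (isClosed_eq (by fun_prop) (by fun_prop)) g
    induction hg using Submodule.span_induction with
    | mem g hg => obtain ⟨i, u, rfl⟩ := hg; exact h i j u v
    | zero => simp
    | add g g' _ _ h h' => rw [inner_add_left, inner_add_left, h, h']
    | smul c g _ h => rw [inner_smul_left, inner_smul_left, h]
  ext g
  refine hJ.total.induction (P := fun g => S g = T g) (fun g hg => ?_)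
    (isClosed_eq (by fun_prop) (by fun_prop)) g
  induction hg using Submodule.span_induction with
  | mem g hg => obtain ⟨i, u, rfl⟩ := hg; exact h1 i u
  | zero => simp
  | add g g' _ _ h h' => rw [map_add, map_add, h, h']
  | smul c g _ h => rw [map_smul, map_smul, h]

variable {M : Submodule ℂ (H →L[ℂ] H)} {W : Submodule ℂ (G →L[ℂ] G)}

/-- The compression `T ↦ J* T J'` between operator spaces. -/
def compress (A B : H →L[ℂ] G) (h : ∀ T ∈ W, A.adjoint ∘L T ∘L B ∈ M) : W →ₗ[ℂ] M where
  toFun T := ⟨A.adjoint ∘L T.1 ∘L B, h T.1 T.2⟩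
  map_add' S T := by ext; simp
  map_smul' c T := by ext; simp

theorem inner_compress (A B : H →L[ℂ] G) (h : ∀ T ∈ W, A.adjoint ∘L T ∘L B ∈ M) (T : W) (u v : H) :
    ⟪u, (compress A B h T).1 v⟫_ℂ = ⟪A u, T.1 (B v)⟫_ℂ :=
  ContinuousLinearMap.adjoint_inner_right A u (T.1 (B v))

/-- Finite truncations of the map that applies `P` to all matrix entries. -/
def sliceFin (hW : ∀ i j, ∀ T ∈ W, (J i).adjoint ∘L T ∘L J j ∈ M) (P : M →ₗ[ℂ] M) (F : Finset ι) :
    W →ₗ[ℂ] (G →L[ℂ] G) where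
  toFun T := ∑ i : F, ∑ j : F, J i ∘L (P (compress (J i) (J j) (hW i j) T)).1 ∘L (J j).adjoint
  map_add' S T := by
    simp only [map_add, Submodule.coe_add, ContinuousLinearMap.add_comp,
      ContinuousLinearMap.comp_add, Finset.sum_add_distrib]
  map_smul' c T := by
    simp only [map_smul, Submodule.coe_smul, ContinuousLinearMap.smul_comp,
      ContinuousLinearMap.comp_smul, Finset.smul_sum, RingHom.id_apply]

theorem inner_sliceFin (hW : ∀ i j, ∀ T ∈ W, (J i).adjoint ∘L T ∘L J j ∈ M) (P : M →ₗ[ℂ] M)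
    (F : Finset ι) (T : W) (a b : G) :
    ⟪a, sliceFin hW P F T b⟫_ℂ = matForm
      (fun i j : F => (P (compress (J i) (J j) (hW i j) T)).1)
      (fun i => (J i).adjoint a) (fun j => (J j).adjoint b) := by
  simp only [sliceFin, LinearMap.coe_mk, AddHom.coe_mk, sum_apply, inner_sum, matForm]
  refine Finset.sum_congr rfl fun i _ => Finset.sum_congr rfl fun j _ => ?_
  rw [ContinuousLinearMap.adjoint_inner_left]
  rfl

theorem matForm_compress (hW : ∀ i j, ∀ T ∈ W, (J i).adjoint ∘L T ∘L J j ∈ M) (F : Finset ι)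
    (T : W) (u v : F → H) :
    matForm (fun i j : F => (compress (J i) (J j) (hW i j) T).1) u v =
      ⟪∑ i : F, J i (u i), T.1 (∑ j : F, J j (v j))⟫_ℂ := by
  rw [map_sum, sum_inner]
  simp only [inner_sum, matForm, inner_compress]

theorem IsFrame.norm_sum_sq (hJ : IsFrame J) (F : Finset ι) (u : F → H) :
    ‖∑ i : F, J i (u i)‖ ^ 2 = ∑ i : F, ‖u i‖ ^ 2 := by
  have h : ⟪∑ i : F, J i (u i), ∑ i : F, J i (u i)⟫_ℂ = ((∑ i : F, ‖u i‖ ^ 2 : ℝ) : ℂ) := by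
    rw [sum_inner]
    push_cast
    refine Finset.sum_congr rfl fun i _ => ?_
    rw [inner_sum, Finset.sum_eq_single i, hJ.inner_self, inner_self_eq_norm_sq_to_K]
    · rfl
    · intro j _ hj
      exact hJ.inner_ne _ _ _ _ fun h => hj (Subtype.ext h).symm
    · simp
  rw [inner_self_eq_norm_sq_to_K] at h
  exact Complex.ofReal_injective (by rw [← h, Complex.ofReal_pow]; rfl)

/-- The finite corner of T has norm at most ‖T‖ as a matrix because the frame is isometric; complete
contractivity of P keeps the bound, and Bessel returns to vectors of G. -/
theorem IsFrame.norm_sliceFin_le (hJ : IsFrame J)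
    (hW : ∀ i j, ∀ T ∈ W, (J i).adjoint ∘L T ∘L J j ∈ M) {P : M →ₗ[ℂ] M} (hP : IsCP P)
    (hone : 1 ∈ M) (hstar : ∀ x ∈ M, star x ∈ M) (hu : (P ⟨1, hone⟩).1 = 1) (F : Finset ι)
    (T : W) : ‖sliceFin hW P F T‖ ≤ ‖T‖ := by
  refine norm_le_of_re_inner_le_sq (norm_nonneg T) fun a b => ?_
  rw [inner_sliceFin]
  refine (hP.re_matForm_le hone hstar hu (c := ‖T‖) (fun u v => ?_) _ _).trans ?_
  · rw [matForm_compress, ← hJ.norm_sum_sq, ← hJ.norm_sum_sq]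
    exact re_inner_le_of_norm_le (le_refl ‖T.1‖) _ _
  · have := hJ.sum_norm_sq_le F a
    have := hJ.sum_norm_sq_le F b
    gcongr

/-- An n × n matrix of operators on G, cut down to the corner F, is a matrix over M indexed by `Fin
n × F`. Positivity at that size is where the full complete positivity of P enters. -/
theorem isPosMat_sliceFin (hW : ∀ i j, ∀ T ∈ W, (J i).adjoint ∘L T ∘L J j ∈ M) {P : M →ₗ[ℂ] M}
    (hP : IsCP P) (F : Finset ι) {n : ℕ} {X : Fin n → Fin n → W}
    (hX : IsPosMat fun i j => (X i j).1) : IsPosMat fun i j => sliceFin hW P F (X i j) := by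
  let Y : Fin n × F → Fin n × F → M := fun p q => compress (J p.2) (J q.2) (hW p.2 q.2) (X p.1 q.1)
  have hY : IsPosMat fun p q => (Y p q).1 := by
    intro u
    have := hX fun k => ∑ i : F, J i (u (k, i))
    convert this using 1
    simp only [matForm, Fintype.sum_prod_type, Y, inner_compress, map_sum, sum_inner, inner_sum]
    refine Finset.sum_congr rfl fun k _ => ?_
    rw [Finset.sum_comm]
    refine Finset.sum_congr rfl fun l _ => ?_
    rw [Finset.sum_comm]
  intro g
  have := hP.isPosMat hY fun p => (J p.2).adjoint (g p.1)
  convert this using 1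
  simp only [matForm, Fintype.sum_prod_type, Y, inner_sliceFin]
  refine Finset.sum_congr rfl fun k _ => ?_
  rw [Finset.sum_comm]

/-- Applying a unital completely positive map to all matrix entries with respect to a frame. -/
theorem IsFrame.exists_slice (hJ : IsFrame J)
    (hW : ∀ i j, ∀ T ∈ W, (J i).adjoint ∘L T ∘L J j ∈ M) {P : M →ₗ[ℂ] M} (hP : IsCP P)
    (hone : 1 ∈ M) (hstar : ∀ x ∈ M, star x ∈ M) (hu : (P ⟨1, hone⟩).1 = 1) :
    ∃ Φ : W →ₗ[ℂ] (G →L[ℂ] G),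
      (∀ T i j u v, ⟪J i u, Φ T (J j v)⟫_ℂ = ⟪u, (P (compress (J i) (J j) (hW i j) T)).1 v⟫_ℂ) ∧
      (∀ T, ‖Φ T‖ ≤ ‖T‖) ∧
      ∀ (n : ℕ) (X : Fin n → Fin n → W), IsPosMat (fun i j => (X i j).1) →
        IsPosMat fun i j => Φ (X i j) := by
  classical
  let U : Ultrafilter (Finset ι) := Ultrafilter.of atTop
  have hbd := hJ.norm_sliceFin_le hW hP hone hstar hu
  choose Φ hΦ using fun T : W =>
    exists_weak_limit U (fun F => sliceFin hW P F T) ‖T‖ fun F => hbd F T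
  refine ⟨{ toFun := Φ, map_add' := fun S T => ?_, map_smul' := fun c T => ?_ }, ?_, ?_, ?_⟩
  · ext b
    refine ext_inner_left ℂ fun a => tendsto_nhds_unique (hΦ (S + T) a b) ?_
    simp only [map_add, add_apply, inner_add_right]
    exact (hΦ S a b).add (hΦ T a b)
  · ext b
    refine ext_inner_left ℂ fun a => tendsto_nhds_unique (hΦ (c • T) a b) ?_
    simp only [map_smul, smul_apply, inner_smul_right, RingHom.id_apply]
    exact (hΦ T a b).const_mul c
  · intro T i j u v
    refine tendsto_nhds_unique (hΦ T (J i u) (J j v)) ?_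
    refine tendsto_const_nhds.congr' ?_
    -- Along the ultrafilter, the (i, j) coefficient is constant as soon as F contains i and j, so
    -- the limit has the prescribed entries.
    have h1 : ∀ᶠ F : Finset ι in U, {i, j} ⊆ F :=
      (Ultrafilter.of_le atTop) (eventually_ge_atTop ({i, j} : Finset ι))
    filter_upwards [h1] with F hF
    have hi : i ∈ F := hF (by simp)
    have hj : j ∈ F := hF (by simp)
    rw [inner_sliceFin, matForm, Finset.sum_eq_single ⟨i, hi⟩, Finset.sum_eq_single ⟨j, hj⟩,
      hJ.adjoint_apply_self, hJ.adjoint_apply_self]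
    · intro k _ hk
      rw [hJ.adjoint_apply_ne fun h => hk (Subtype.ext h), map_zero, inner_zero_right]
    · simp
    · intro k _ hk
      refine Finset.sum_eq_zero fun l _ => ?_
      rw [hJ.adjoint_apply_ne fun h => hk (Subtype.ext h), inner_zero_left]
    · simp
  · exact fun T => norm_le_of_tendsto_inner (fun F => hbd F T) (hΦ T)
  · intro n X hX g
    have ht : Tendsto (fun F => matForm (fun i j => sliceFin hW P F (X i j)) g g) U
        (𝓝 (matForm (fun i j => Φ (X i j)) g g)) :=
      tendsto_finsetSum _ fun i _ => tendsto_finsetSum _ fun j _ => hΦ (X i j) (g i) (g j)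
    exact ge_of_tendsto ht (Eventually.of_forall fun F => isPosMat_sliceFin hW hP F hX g)

end Slicing

/-! ### Von Neumann algebras as dual operator systems; entrywise extension of normal maps -/

section VonNeumann

variable {H : Type*} [NormedAddCommGroup H] [InnerProductSpace ℂ H] [CompleteSpace H]
variable {G : Type*} [NormedAddCommGroup G] [InnerProductSpace ℂ G] [CompleteSpace G]

theorem one_mem_space (R : VonNeumannAlgebra H) : (1 : H →L[ℂ] H) ∈ space R :=
  R.toStarSubalgebra.one_mem

theorem star_mem_space (R : VonNeumannAlgebra H) (x : H →L[ℂ] H) (hx : x ∈ space R) :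
    star x ∈ space R :=
  R.toStarSubalgebra.star_mem' hx

theorem continuous_weakStarBH_of_isNormalOnBH {f : (H →L[ℂ] H) →ₗ[ℂ] ℂ} (hf : IsNormalOnBH f) :
    @Continuous _ _ (weakStarBH H) _ f :=
  continuous_iInf_dom (i := (⟨f, hf⟩ : {f : (H →L[ℂ] H) →ₗ[ℂ] ℂ // IsNormalOnBH f}))
    continuous_induced_dom

theorem isDualOperatorSystem_space (R : VonNeumannAlgebra H) : IsDualOperatorSystem (space R) where
  star_mem := star_mem_space R
  one_mem := one_mem_space R
  weakStar_closed := by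
    -- The bicommutant theorem writes R as the solution set of equations between normal functionals.
    have h : (space R : Set (H →L[ℂ] H)) = ⋂ y : R.commutant, ⋂ a : H, ⋂ b : H,
        {x | vecFun a (y.1 b) x = vecFun (y.1.adjoint a) b x} := by
      ext x
      simp only [Set.mem_iInter, Set.mem_ofPred_eq, vecFun_apply]
      exact ⟨fun hx y a b => inner_commute_of_mem hx y.2 a b,
        fun hx => mem_of_inner_commute R fun y hy a b => hx ⟨y, hy⟩ a b⟩
    rw [h]
    let := weakStarBH H
    refine isClosed_iInter fun y => isClosed_iInter fun a => isClosed_iInter fun b => ?_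
    exact isClosed_eq (continuous_weakStarBH_of_isNormalOnBH (isNormalOnBH_vecFun _ _))
      (continuous_weakStarBH_of_isNormalOnBH (isNormalOnBH_vecFun _ _))

theorem mem_commutant_vnGen {S : Set (H →L[ℂ] H)} (hstar : ∀ x ∈ S, star x ∈ S) {z : H →L[ℂ] H}
    (hz : ∀ s ∈ S, s * z = z * s) : z ∈ (vnGen S).commutant := by
  rw [VonNeumannAlgebra.mem_commutant_iff]
  intro T hT
  refine ((StarSubalgebra.mem_centralizer_iff ℂ).1 hT z ?_).1.symm
  exact (StarSubalgebra.mem_centralizer_iff ℂ).2 fun s hs => ⟨hz s hs, hz _ (hstar s hs)⟩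

theorem isNormalMap_compress {M : Submodule ℂ (H →L[ℂ] H)} {W : Submodule ℂ (G →L[ℂ] G)}
    (A B : H →L[ℂ] G) (h : ∀ T ∈ W, A.adjoint ∘L T ∘L B ∈ M) :
    IsNormalMap (compress A B h) := by
  have hs : ∀ (C : H →L[ℂ] G) {a : ℕ → H}, Summable (fun n => ‖a n‖ ^ 2) →
      Summable (fun n => ‖C (a n)‖ ^ 2) := fun C a ha =>
    Summable.of_nonneg_of_le (fun n => by positivity) (fun n => by
      rw [← mul_pow]; gcongr; exact C.le_opNorm _) (ha.mul_left (‖C‖ ^ 2))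
  rw [isNormalMap_iff]
  rintro ρ ⟨f, ⟨a, b, ha, hb, hf⟩, hρ⟩
  refine ⟨(∑' n, vecFun (A (a n)) (B (b n)) : (G →L[ℂ] G) →L[ℂ] ℂ),
    ⟨_, _, hs A ha, hs B hb, fun x => tsum_vecFun_apply (hs A ha) (hs B hb) x⟩, fun T => ?_⟩
  rw [LinearMap.comp_apply, hρ, hf]
  refine Eq.trans ?_ (tsum_vecFun_apply (hs A ha) (hs B hb) T.1).symm
  congr 1
  ext n
  exact inner_compress A B h T _ _

/-- Two normal maps on a generated von Neumann algebra that agree on a self-adjoint multiplicative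
generating set are equal. -/
theorem IsNormalMap.ext_of_vnGen {S : Set (G →L[ℂ] G)} (hone : 1 ∈ S)
    (hmul : ∀ x ∈ S, ∀ y ∈ S, x * y ∈ S) (hstar : ∀ x ∈ S, star x ∈ S)
    {V : VonNeumannAlgebra G} (hV : V = vnGen S)
    {N : Submodule ℂ (H →L[ℂ] H)} {L L' : space V →ₗ[ℂ] N} (hL : IsNormalMap L)
    (hL' : IsNormalMap L') (h : ∀ s : space V, s.1 ∈ S → L s = L' s) : L = L' := by
  subst hV
  refine LinearMap.ext fun T => Subtype.ext ?_
  ext b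
  refine ext_inner_left ℂ fun a => ?_
  have h1 := isNormalMap_iff.1 hL _ (isNormalFunctional_vecFun N a b)
  have h2 := isNormalMap_iff.1 hL' _ (isNormalFunctional_vecFun N a b)
  obtain ⟨f, hf, hfe⟩ := mem_predual.1 (Submodule.sub_mem _ (mem_predual.2 h1) (mem_predual.2 h2))
  have h3 := hf.eq_zero_of_mem_vnGen hone hmul hstar (fun s hs => by
    rw [← hfe ⟨s, subset_vnGen S hs⟩]
    exact sub_eq_zero.2 (congrArg (fun x : N => ⟪a, x.1 b⟫_ℂ) (h ⟨s, subset_vnGen S hs⟩ hs))) T.2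
  rw [← hfe T] at h3
  exact sub_eq_zero.1 h3

variable {ι : Type*} {J : ι → H →L[ℂ] G}

/-- Extension of a normal unital completely positive map from a von Neumann algebra to the matrices
over it, with respect to a frame. -/
theorem IsFrame.exists_normalUCP (hJ : IsFrame J) {R : VonNeumannAlgebra H} {S : Set (G →L[ℂ] G)}
    {V : VonNeumannAlgebra G} (hV : V = vnGen S) (hone : 1 ∈ S)
    (hmul : ∀ x ∈ S, ∀ y ∈ S, x * y ∈ S) (hstar : ∀ x ∈ S, star x ∈ S)
    (hW : ∀ i j, ∀ T ∈ space V, (J i).adjoint ∘L T ∘L J j ∈ space R)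
    {P : space R →ₗ[ℂ] space R} (hP : IsNormalUCP P)
    (hS : ∀ s : space V, s.1 ∈ S → ∃ s' ∈ S, ∀ i j u v, ⟪J i u, s' (J j v)⟫_ℂ =
      ⟪u, (P (compress (J i) (J j) (hW i j) s)).1 v⟫_ℂ) :
    ∃ Φ : space V →ₗ[ℂ] space V, IsNormalUCP Φ ∧
      ∀ T i j u v, ⟪J i u, (Φ T).1 (J j v)⟫_ℂ =
        ⟪u, (P (compress (J i) (J j) (hW i j) T)).1 v⟫_ℂ := by
  subst hV
  classical
  obtain ⟨Φ, hΦ, hΦn, hΦp⟩ := hJ.exists_slice hW hP.isCP (one_mem_space R) (star_mem_space R)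
    (hP.unital _ rfl)
  -- Normality is proved before the range is known to lie in V. On frame vectors it follows from
  -- normality of P and of compression; totality and contractivity give the rest by norm closedness
  -- of the predual.
  have hnorm : ∀ f, IsNormalOnBH f → IsNormalFunctional (space (vnGen S)) (f ∘ₗ Φ) := by
    intro f hf
    refine isNormalFunctional_of_approx _ fun ε hε => ?_
    obtain ⟨g, hg, hfg⟩ := hf.exists_approx hJ.total hε
    refine ⟨(g : (G →L[ℂ] G) →ₗ[ℂ] ℂ) ∘ₗ Φ, ?_, fun T => (hfg (Φ T)).trans (by
      gcongr; exact hΦn T)⟩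
    clear hfg
    rw [← mem_predual]
    induction hg using Submodule.span_induction with
    | mem g hg =>
      obtain ⟨_, ⟨i, u, rfl⟩, _, ⟨j, v, rfl⟩, rfl⟩ := hg
      have h := isNormalMap_iff.1 (hP.normal.comp (isNormalMap_compress (J i) (J j) (hW i j))) _
        (isNormalFunctional_vecFun (space R) u v)
      rw [mem_predual]
      convert h using 1
      exact LinearMap.ext fun T => hΦ T i j u v
    | zero => exact Submodule.zero_mem _
    | add g g' _ _ h h' => exact Submodule.add_mem _ h h'
    | smul c g _ h => exact Submodule.smul_mem _ c h
  have hmem : ∀ T, Φ T ∈ space (vnGen S) := by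
    intro T
    refine mem_of_inner_commute _ fun y hy a b => ?_
    -- The defect of commutation with y is a normal functional of T. It vanishes on S, which Φ maps
    -- into itself, hence on all of V by density.
    obtain ⟨f, hf, hfe⟩ := hnorm
      ((vecFun a (y b) : (G →L[ℂ] G) →ₗ[ℂ] ℂ) - (vecFun (y.adjoint a) b : (G →L[ℂ] G) →ₗ[ℂ] ℂ))
      (Submodule.sub_mem (normalBH G) (isNormalOnBH_vecFun _ _) (isNormalOnBH_vecFun _ _))
    have h3 := hf.eq_zero_of_mem_vnGen hone hmul hstar (fun s hs => by
      obtain ⟨s', hs', hse⟩ := hS ⟨s, subset_vnGen S hs⟩ hs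
      have h4 : Φ ⟨s, subset_vnGen S hs⟩ = s' :=
        hJ.clm_ext fun i j u v => by rw [hΦ, hse]
      rw [← hfe ⟨s, subset_vnGen S hs⟩, LinearMap.comp_apply, h4]
      exact sub_eq_zero.2 (inner_commute_of_mem (subset_vnGen S hs') hy a b)) T.2
    rw [← hfe T] at h3
    exact sub_eq_zero.1 h3
  refine ⟨Φ.codRestrict _ hmem, isNormalUCP_iff.2 ⟨?_, ?_, ?_⟩, hΦ⟩
  · rw [isNormalMap_iff]
    rintro ρ ⟨f, hf, hfe⟩
    convert hnorm f hf using 1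
    exact LinearMap.ext fun T => hfe _
  · intro T hT
    refine hJ.clm_ext fun i j u v => ?_
    change ⟪J i u, Φ T (J j v)⟫_ℂ = ⟪J i u, J j v⟫_ℂ
    rw [hΦ]
    by_cases hij : i = j
    · subst hij
      rw [hP.unital, hJ.inner_self]
      · rfl
      · ext v
        change (J i).adjoint (T.1 (J i v)) = v
        rw [hT]
        exact hJ.adjoint_apply_self i v
    · have : compress (J i) (J j) (hW i j) T = 0 := by
        ext v
        change (J i).adjoint (T.1 (J j v)) = 0
        rw [hT]
        exact hJ.adjoint_apply_ne hij v
      rw [this, map_zero, hJ.inner_ne i j u v hij]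
      simp
  · exact fun n X hX => hΦp n X hX

end VonNeumann

/-! ### Elementary tensors, slices, and the maps P ⊗ id and id ⊗ Q -/

section Tensor

variable {H : Type*} [NormedAddCommGroup H] [InnerProductSpace ℂ H] [CompleteSpace H]
variable {K : Type*} [NormedAddCommGroup K] [InnerProductSpace ℂ K] [CompleteSpace K]

/-- Elementary tensors in the Hilbert space tensor product. -/
def pureT (h : H) (k : K) : HTensor H K := ((h ⊗ₜ[ℂ] k : H ⊗[ℂ] K) : HTensor H K)

theorem inner_pureT (h h' : H) (k k' : K) :
    ⟪pureT h k, pureT h' k'⟫_ℂ = ⟪h, h'⟫_ℂ * ⟪k, k'⟫_ℂ := by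
  rw [pureT, pureT, UniformSpace.Completion.inner_coe, TensorProduct.inner_tmul]

theorem norm_pureT (h : H) (k : K) : ‖pureT h k‖ = ‖h‖ * ‖k‖ := by
  rw [pureT, UniformSpace.Completion.norm_coe, TensorProduct.norm_tmul]

theorem opTensor_pureT (x : H →L[ℂ] H) (y : K →L[ℂ] K) (h : H) (k : K) :
    opTensor x y (pureT h k) = pureT (x h) (y k) := by
  rw [pureT, opTensor_coe, TensorProduct.mapL_tmul]; rfl

/-- The map `h ↦ h ⊗ k`. -/
def tensorRight (k : K) : H →L[ℂ] HTensor H K :=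
  UniformSpace.Completion.toComplL ∘L (TensorProduct.mkL ℂ H K).flip k

/-- The map `k ↦ h ⊗ k`. -/
def tensorLeft (h : H) : K →L[ℂ] HTensor H K :=
  UniformSpace.Completion.toComplL ∘L TensorProduct.mkL ℂ H K h

theorem tensorRight_apply (k : K) (h : H) : tensorRight k h = pureT h k := rfl

theorem tensorLeft_apply (h : H) (k : K) : tensorLeft h k = pureT h k := rfl

theorem norm_tensorRight_le (k : K) : ‖(tensorRight k : H →L[ℂ] HTensor H K)‖ ≤ ‖k‖ :=
  ContinuousLinearMap.opNorm_le_bound _ (norm_nonneg k) fun h => by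
    rw [tensorRight_apply, norm_pureT, mul_comm]

theorem mem_of_pureT_mem {W : Submodule ℂ (HTensor H K)} (hW : IsClosed (W : Set (HTensor H K)))
    (h : ∀ u v, pureT u v ∈ W) (g : HTensor H K) : g ∈ W := by
  induction g using UniformSpace.Completion.induction_on with
  | hp => exact hW
  | ih z =>
    induction z using TensorProduct.induction_on with
    | zero => rw [UniformSpace.Completion.coe_zero]; exact W.zero_mem
    | tmul u v => exact h u v
    | add x y hx hy => rw [UniformSpace.Completion.coe_add]; exact W.add_mem hx hy

theorem dense_span_pureT :
    Dense (Submodule.span ℂ {g : HTensor H K | ∃ u v, g = pureT u v} : Set (HTensor H K)) := by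
  intro g
  exact mem_of_pureT_mem (Submodule.isClosed_topologicalClosure _)
    (fun u v => subset_closure (Submodule.subset_span (Set.mem_ofPred.2 ⟨u, v, rfl⟩))) g

theorem tensor_clm_ext {F : Type*} [NormedAddCommGroup F] [NormedSpace ℂ F]
    {S T : HTensor H K →L[ℂ] F} (h : ∀ u v, S (pureT u v) = T (pureT u v)) : S = T := by
  ext g
  exact mem_of_pureT_mem
    (W := LinearMap.eqLocus (S : HTensor H K →ₗ[ℂ] F) (T : HTensor H K →ₗ[ℂ] F))
    (isClosed_eq S.continuous T.continuous) h g

theorem opTensor_one : opTensor (1 : H →L[ℂ] H) (1 : K →L[ℂ] K) = 1 :=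
  tensor_clm_ext fun u v => by rw [opTensor_pureT]; rfl

theorem opTensor_mul (x x' : H →L[ℂ] H) (y y' : K →L[ℂ] K) :
    opTensor x y * opTensor x' y' = opTensor (x * x') (y * y') :=
  tensor_clm_ext fun u v => by
    rw [mul_apply_eq_comp, opTensor_pureT, opTensor_pureT, opTensor_pureT]; rfl

theorem star_opTensor (x : H →L[ℂ] H) (y : K →L[ℂ] K) :
    star (opTensor x y) = opTensor (star x) (star y) := by
  refine tensor_clm_ext fun u v => ?_
  refine ext_inner_left ℂ fun g => ?_
  rw [ContinuousLinearMap.star_eq_adjoint, ContinuousLinearMap.adjoint_inner_right]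
  have : innerSL ℂ (pureT u v) ∘L opTensor x y =
      innerSL ℂ (opTensor (star x) (star y) (pureT u v)) :=
    tensor_clm_ext fun u' v' => by
      rw [ContinuousLinearMap.comp_apply, opTensor_pureT, opTensor_pureT, innerSL_apply_apply,
        innerSL_apply_apply, inner_pureT, inner_pureT, ContinuousLinearMap.star_eq_adjoint,
        ContinuousLinearMap.star_eq_adjoint, ContinuousLinearMap.adjoint_inner_left,
        ContinuousLinearMap.adjoint_inner_left]
  have h2 := congrArg (fun f : HTensor H K →L[ℂ] ℂ => star (f g)) this
  simpa only [ContinuousLinearMap.comp_apply, innerSL_apply_apply, Complex.star_def,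
    inner_conj_symm] using h2

/-- The elementary tensors of two von Neumann algebras. -/
def tensorSet (R : VonNeumannAlgebra H) (S : VonNeumannAlgebra K) :
    Set (HTensor H K →L[ℂ] HTensor H K) :=
  {T | ∃ x ∈ R, ∃ y ∈ S, T = opTensor x y}

variable (R : VonNeumannAlgebra H) (S : VonNeumannAlgebra K)

theorem one_mem_tensorSet : 1 ∈ tensorSet R S :=
  ⟨1, one_mem R, 1, one_mem S, opTensor_one.symm⟩

theorem mul_mem_tensorSet : ∀ s ∈ tensorSet R S, ∀ t ∈ tensorSet R S, s * t ∈ tensorSet R S := by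
  rintro _ ⟨x, hx, y, hy, rfl⟩ _ ⟨x', hx', y', hy', rfl⟩
  exact ⟨_, mul_mem hx hx', _, mul_mem hy hy', opTensor_mul _ _ _ _⟩

theorem star_mem_tensorSet : ∀ s ∈ tensorSet R S, star s ∈ tensorSet R S := by
  rintro _ ⟨x, hx, y, hy, rfl⟩
  exact ⟨_, star_mem hx, _, star_mem hy, star_opTensor _ _⟩

variable {R S}

theorem IsNormalMap.tensor_ext {L : Type*} [NormedAddCommGroup L] [InnerProductSpace ℂ L]
    [CompleteSpace L] {N : Submodule ℂ (L →L[ℂ] L)} {f g : space (vnTensor R S) →ₗ[ℂ] N}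
    (hf : IsNormalMap f) (hg : IsNormalMap g) (h : ∀ x y, f (tmul x y) = g (tmul x y)) : f = g := by
  refine hf.ext_of_vnGen (one_mem_tensorSet R S) (mul_mem_tensorSet R S) (star_mem_tensorSet R S)
    rfl hg ?_
  rintro ⟨_, _⟩ ⟨x, hx, y, hy, rfl⟩
  exact h ⟨x, hx⟩ ⟨y, hy⟩

/-- Only this easy inclusion of the commutation theorem for tensor products, and its mirror image,
is needed. -/
theorem opTensor_left_mem_commutant {y : H →L[ℂ] H} (hy : y ∈ R.commutant) :
    opTensor y 1 ∈ (vnTensor R S).commutant := by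
  refine mem_commutant_vnGen (star_mem_tensorSet R S) ?_
  rintro _ ⟨x, hx, z, hz, rfl⟩
  rw [opTensor_mul, opTensor_mul, commute_of_mem_commutant hx hy, mul_one, one_mul]

theorem opTensor_right_mem_commutant {y : K →L[ℂ] K} (hy : y ∈ S.commutant) :
    opTensor 1 y ∈ (vnTensor R S).commutant := by
  refine mem_commutant_vnGen (star_mem_tensorSet R S) ?_
  rintro _ ⟨x, hx, z, hz, rfl⟩
  rw [opTensor_mul, opTensor_mul, commute_of_mem_commutant hz hy, mul_one, one_mul]

/-- For y in the commutant of R the operator y ⊗ 1 commutes with T, and moving it past h ↦ h ⊗ k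
turns it back into y. -/
theorem compress_right_mem (k k' : K) (T : HTensor H K →L[ℂ] HTensor H K)
    (hT : T ∈ space (vnTensor R S)) :
    (tensorRight k).adjoint ∘L T ∘L tensorRight k' ∈ space R := by
  refine mem_of_inner_commute R fun y hy a b => ?_
  have h := inner_commute_of_mem hT (opTensor_left_mem_commutant (S := S) hy)
    (pureT a k) (pureT b k')
  rw [← ContinuousLinearMap.star_eq_adjoint, star_opTensor, opTensor_pureT, opTensor_pureT,
    star_one] at h
  simpa only [ContinuousLinearMap.comp_apply, ContinuousLinearMap.adjoint_inner_right,
    tensorRight_apply, ContinuousLinearMap.star_eq_adjoint, one_apply_eq_self] using h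

theorem compress_left_mem (h h' : H) (T : HTensor H K →L[ℂ] HTensor H K)
    (hT : T ∈ space (vnTensor R S)) :
    (tensorLeft h).adjoint ∘L T ∘L tensorLeft h' ∈ space S := by
  refine mem_of_inner_commute S fun y hy a b => ?_
  have h := inner_commute_of_mem hT (opTensor_right_mem_commutant (R := R) hy)
    (pureT h a) (pureT h' b)
  rw [← ContinuousLinearMap.star_eq_adjoint, star_opTensor, opTensor_pureT, opTensor_pureT,
    star_one] at h
  simpa only [ContinuousLinearMap.comp_apply, ContinuousLinearMap.adjoint_inner_right,
    tensorLeft_apply, ContinuousLinearMap.star_eq_adjoint, one_apply_eq_self] using h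

theorem isFrame_tensorRight {ι : Type*} (b : HilbertBasis ι ℂ K) :
    IsFrame fun i => (tensorRight (b i) : H →L[ℂ] HTensor H K) where
  inner_self i u v := by
    rw [tensorRight_apply, tensorRight_apply, inner_pureT, inner_self_eq_norm_sq_to_K,
      b.orthonormal.1 i]
    simp
  inner_ne i j u v hij := by
    rw [tensorRight_apply, tensorRight_apply, inner_pureT, b.orthonormal.2 hij, mul_zero]
  total := by
    intro g
    set W :=
      (Submodule.span ℂ {g : HTensor H K | ∃ i u, g = tensorRight (b i) u}).topologicalClosure
    have hWc : IsClosed (W : Set (HTensor H K)) := Submodule.isClosed_topologicalClosure _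
    refine mem_of_pureT_mem hWc (fun u v => ?_) g
    have hs : HasSum (fun i => b.repr v i • pureT u (b i)) (pureT u v) := by
      simpa only [Function.comp_def, map_smul, tensorLeft_apply] using
        (tensorLeft u).hasSum (b.hasSum_repr v)
    refine hWc.mem_of_tendsto hs (Eventually.of_forall fun s => W.sum_mem fun i _ => ?_)
    exact W.smul_mem _ (Submodule.le_topologicalClosure _ (Submodule.subset_span ⟨i, u, rfl⟩))

theorem isFrame_tensorLeft {ι : Type*} (b : HilbertBasis ι ℂ H) :
    IsFrame fun i => (tensorLeft (b i) : K →L[ℂ] HTensor H K) where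
  inner_self i u v := by
    rw [tensorLeft_apply, tensorLeft_apply, inner_pureT, inner_self_eq_norm_sq_to_K,
      b.orthonormal.1 i]
    simp
  inner_ne i j u v hij := by
    rw [tensorLeft_apply, tensorLeft_apply, inner_pureT, b.orthonormal.2 hij, zero_mul]
  total := by
    intro g
    set W := (Submodule.span ℂ {g : HTensor H K | ∃ i u, g = tensorLeft (b i) u}).topologicalClosure
    have hWc : IsClosed (W : Set (HTensor H K)) := Submodule.isClosed_topologicalClosure _
    refine mem_of_pureT_mem hWc (fun u v => ?_) g
    have hs : HasSum (fun i => b.repr u i • pureT (b i) v) (pureT u v) := by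
      simpa only [Function.comp_def, map_smul, tensorRight_apply] using
        (tensorRight v).hasSum (b.hasSum_repr u)
    refine hWc.mem_of_tendsto hs (Eventually.of_forall fun s => W.sum_mem fun i _ => ?_)
    exact W.smul_mem _ (Submodule.le_topologicalClosure _ (Submodule.subset_span ⟨i, v, rfl⟩))

theorem compress_right_tmul (k k' : K) (x : space R) (y : space S) :
    compress (M := space R) (tensorRight k) (tensorRight k') (compress_right_mem k k') (tmul x y) =
      ⟪k, y.1 k'⟫_ℂ • x := by
  ext v
  refine ext_inner_left ℂ fun u => ?_
  rw [inner_compress]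
  change ⟪pureT u k, opTensor x.1 y.1 (pureT v k')⟫_ℂ = ⟪u, ⟪k, y.1 k'⟫_ℂ • x.1 v⟫_ℂ
  rw [opTensor_pureT, inner_pureT, inner_smul_right, mul_comm]

theorem compress_left_tmul (h h' : H) (x : space R) (y : space S) :
    compress (M := space S) (tensorLeft h) (tensorLeft h') (compress_left_mem h h') (tmul x y) =
      ⟪h, x.1 h'⟫_ℂ • y := by
  ext v
  refine ext_inner_left ℂ fun u => ?_
  rw [inner_compress]
  change ⟪pureT h u, opTensor x.1 y.1 (pureT h' v)⟫_ℂ = ⟪u, ⟪h, x.1 h'⟫_ℂ • y.1 v⟫_ℂ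
  rw [opTensor_pureT, inner_pureT, inner_smul_right]

/-- The normal unital completely positive map `P ⊗ id`. -/
theorem exists_tensor_id {P : space R →ₗ[ℂ] space R} (hP : IsNormalUCP P) :
    ∃ Φ : space (vnTensor R S) →ₗ[ℂ] space (vnTensor R S), IsNormalUCP Φ ∧
      ∀ x y, Φ (tmul x y) = tmul (P x) y := by
  obtain ⟨w, b, -⟩ := exists_hilbertBasis ℂ K
  have hJ := isFrame_tensorRight (H := H) b
  obtain ⟨Φ, h1, h2⟩ := hJ.exists_normalUCP (R := R) (V := vnTensor R S) rfl
    (one_mem_tensorSet R S) (mul_mem_tensorSet R S) (star_mem_tensorSet R S)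
    (fun i j => compress_right_mem (b i) (b j)) hP (by
      rintro ⟨_, _⟩ ⟨x, hx, y, hy, rfl⟩
      refine ⟨opTensor (P ⟨x, hx⟩).1 y, ⟨_, (P ⟨x, hx⟩).2, y, hy, rfl⟩, fun i j u v => ?_⟩
      have := compress_right_tmul (b i) (b j) (⟨x, hx⟩ : space R) (⟨y, hy⟩ : space S)
      change _ = ⟪u, (P (compress (M := space R) (tensorRight (b i)) (tensorRight (b j))
        (compress_right_mem (b i) (b j)) (tmul ⟨x, hx⟩ ⟨y, hy⟩))).1 v⟫_ℂ
      rw [this, map_smul, tensorRight_apply, tensorRight_apply, opTensor_pureT, inner_pureT,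
        Submodule.coe_smul, smul_apply, inner_smul_right, mul_comm])
  refine ⟨Φ, h1, fun x y => Subtype.ext (hJ.clm_ext fun i j u v => ?_)⟩
  refine (h2 (tmul x y) i j u v).trans ?_
  rw [compress_right_tmul (b i) (b j) x y, map_smul, Submodule.coe_smul, smul_apply,
    inner_smul_right]
  change _ = ⟪pureT u (b i), opTensor (P x).1 y.1 (pureT v (b j))⟫_ℂ
  rw [opTensor_pureT, inner_pureT, mul_comm]

/-- The normal unital completely positive map `id ⊗ Q`. -/
theorem exists_id_tensor {Q : space S →ₗ[ℂ] space S} (hQ : IsNormalUCP Q) :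
    ∃ Φ : space (vnTensor R S) →ₗ[ℂ] space (vnTensor R S), IsNormalUCP Φ ∧
      ∀ x y, Φ (tmul x y) = tmul x (Q y) := by
  obtain ⟨w, b, -⟩ := exists_hilbertBasis ℂ H
  have hJ := isFrame_tensorLeft (K := K) b
  obtain ⟨Φ, h1, h2⟩ := hJ.exists_normalUCP (R := S) (V := vnTensor R S) rfl
    (one_mem_tensorSet R S) (mul_mem_tensorSet R S) (star_mem_tensorSet R S)
    (fun i j => compress_left_mem (b i) (b j)) hQ (by
      rintro ⟨_, _⟩ ⟨x, hx, y, hy, rfl⟩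
      refine ⟨opTensor x (Q ⟨y, hy⟩).1, ⟨x, hx, _, (Q ⟨y, hy⟩).2, rfl⟩, fun i j u v => ?_⟩
      have := compress_left_tmul (b i) (b j) (⟨x, hx⟩ : space R) (⟨y, hy⟩ : space S)
      change _ = ⟪u, (Q (compress (M := space S) (tensorLeft (b i)) (tensorLeft (b j))
        (compress_left_mem (b i) (b j)) (tmul ⟨x, hx⟩ ⟨y, hy⟩))).1 v⟫_ℂ
      rw [this, map_smul, tensorLeft_apply, tensorLeft_apply, opTensor_pureT, inner_pureT,
        Submodule.coe_smul, smul_apply, inner_smul_right])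
  refine ⟨Φ, h1, fun x y => Subtype.ext (hJ.clm_ext fun i j u v => ?_)⟩
  refine (h2 (tmul x y) i j u v).trans ?_
  rw [compress_left_tmul (b i) (b j) x y, map_smul, Submodule.coe_smul, smul_apply,
    inner_smul_right]
  change _ = ⟪pureT (b i) u, opTensor x.1 (Q y).1 (pureT (b j) v)⟫_ℂ
  rw [opTensor_pureT, inner_pureT]

end Tensor

/-! ### Complete positivity of *-homomorphisms -/

section StarHom

open scoped ComplexOrder

variable {H : Type*} [NormedAddCommGroup H] [InnerProductSpace ℂ H] [CompleteSpace H]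
variable {K : Type*} [NormedAddCommGroup K] [InnerProductSpace ℂ K] [CompleteSpace K]

theorem coord_incl_apply (n : ℕ) (i j : Fin n) (v : H) :
    coord n i (incl n j v) = if i = j then v else 0 := by
  have := congrArg (fun T : H →L[ℂ] H => T v) (coord_comp_incl (H := H) n i j)
  by_cases hij : i = j <;> simpa [hij] using this

theorem entry_mul {n : ℕ} (X Y : HPow n H →L[ℂ] HPow n H) (i j : Fin n) :
    entry (X * Y) i j = ∑ k, entry X i k * entry Y k j := by
  ext v
  rw [sum_apply]
  change coord n i (X (Y (incl n j v))) = _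
  conv_lhs => rw [← sum_incl n (Y (incl n j v))]
  rw [map_sum, map_sum]
  rfl

theorem entry_ext {n : ℕ} {X Y : HPow n H →L[ℂ] HPow n H} (h : ∀ i j, entry X i j = entry Y i j) :
    X = Y := by
  ext1 v
  refine ext_inner_left ℂ fun u => ?_
  rw [inner_eq_matForm_entry, inner_eq_matForm_entry]
  simp only [matForm, h]

theorem incl_inner (n : ℕ) (i : Fin n) (u : H) (w : HPow n H) :
    ⟪incl n i u, w⟫_ℂ = ⟪u, coord n i w⟫_ℂ := by
  rw [PiLp.inner_apply, Finset.sum_eq_single i]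
  · rw [← coord_apply, coord_incl_apply, if_pos rfl]; rfl
  · intro j _ hj
    rw [← coord_apply, coord_incl_apply, if_neg hj, inner_zero_left]
  · simp

theorem entry_star {n : ℕ} (X : HPow n H →L[ℂ] HPow n H) (i j : Fin n) :
    entry (star X) i j = star (entry X j i) := by
  ext v
  refine ext_inner_left ℂ fun u => ?_
  rw [ContinuousLinearMap.star_eq_adjoint, ContinuousLinearMap.star_eq_adjoint,
    ContinuousLinearMap.adjoint_inner_right]
  change ⟪u, coord n i (X.adjoint (incl n j v))⟫_ℂ = ⟪coord n j (X (incl n i u)), v⟫_ℂ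
  rw [← incl_inner, ContinuousLinearMap.adjoint_inner_right, ← inner_conj_symm, incl_inner,
    inner_conj_symm]

/-- Entries of the square root of a positive matrix over a von Neumann algebra. -/
theorem entry_sqrt_mem (R : VonNeumannAlgebra H) {n : ℕ} {X : HPow n H →L[ℂ] HPow n H}
    (hX : ∀ i j, entry X i j ∈ R) (i j : Fin n) : entry (CFC.sqrt X) i j ∈ R := by
  refine mem_of_commute_commutant R fun y hy => ?_
  -- The diagonal amplification of y commutes with X, hence with √X; comparing entries gives
  -- commutation of y with each entry of √X.
  let D : HPow n H →L[ℂ] HPow n H := ofEntries fun i j => if i = j then y else 0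
  have hD : ∀ i j, entry D i j = if i = j then y else 0 := fun i j => entry_ofEntries _ i j
  have hl : ∀ Z i j, entry (Z * D) i j = entry Z i j * y := fun Z i j => by
    rw [entry_mul]; simp [hD]
  have hr : ∀ Z i j, entry (D * Z) i j = y * entry Z i j := fun Z i j => by
    rw [entry_mul]; simp [hD]
  have hc : Commute X D := entry_ext fun i j => by
    rw [hl, hr, commute_of_mem_commutant (hX i j) hy]
  have hc' : Commute (CFC.sqrt X) D := hc.cfcₙ_nnreal _
  rw [← hl, ← hr, hc'.eq]

/-- *-homomorphisms are completely positive. -/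
theorem isCP_of_starHom {R : VonNeumannAlgebra H} {N : Submodule ℂ (K →L[ℂ] K)}
    (A : space R →ₗ[ℂ] N) (hmul : ∀ x y, (A (vnMul R x y)).1 = (A x).1 * (A y).1)
    (hstar : ∀ x, (A (vnStar R x)).1 = star (A x).1) : IsCP A := by
  intro n X hX u
  set T : HPow n H →L[ℂ] HPow n H := ofEntries fun i j => (X i j).1 with hT
  have hTe : ∀ i j, entry T i j = (X i j).1 := fun i j => entry_ofEntries _ i j
  have hTpos : 0 ≤ T := by
    rw [ContinuousLinearMap.nonneg_iff_isPositive, isPositive_iff_isPosMat_entry]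
    have : entry T = fun i j => (X i j).1 := by ext1 i; ext1 j; exact hTe i j
    rwa [this]
  have hY : ∀ i j, entry (CFC.sqrt T) i j ∈ R :=
    entry_sqrt_mem R fun i j => by rw [hTe]; exact (X i j).2
  let Y : Fin n → Fin n → space R := fun i j => ⟨entry (CFC.sqrt T) i j, hY i j⟩
  -- X = √X* √X with entries in R, so A turns the quadratic form into a sum of squared norms.
  have hXY : ∀ i j, X i j = ∑ k, vnMul R (vnStar R (Y k i)) (Y k j) := by
    intro i j
    apply Subtype.ext
    rw [AddSubmonoidClass.coe_finsetSum, ← hTe, ← CFC.sqrt_mul_sqrt_self T hTpos, entry_mul]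
    refine Finset.sum_congr rfl fun k _ => ?_
    change _ = star (entry (CFC.sqrt T) k i) * entry (CFC.sqrt T) k j
    rw [← entry_star, (CFC.sqrt_nonneg T).isSelfAdjoint.star_eq]
  have hsum : matForm (fun i j => (A (X i j)).1) u u =
      ∑ k, ⟪∑ i, (A (Y k i)).1 (u i), ∑ j, (A (Y k j)).1 (u j)⟫_ℂ := by
    have h1 : ∀ i j, ⟪u i, (A (X i j)).1 (u j)⟫_ℂ =
        ∑ k, ⟪(A (Y k i)).1 (u i), (A (Y k j)).1 (u j)⟫_ℂ := by
      intro i j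
      rw [hXY, map_sum, AddSubmonoidClass.coe_finsetSum, sum_apply, inner_sum]
      refine Finset.sum_congr rfl fun k _ => ?_
      rw [hmul, hstar, mul_apply_eq_comp, ContinuousLinearMap.star_eq_adjoint,
        ContinuousLinearMap.adjoint_inner_right]
    simp only [matForm, h1, sum_inner, inner_sum]
    rw [Finset.sum_comm' (t' := Finset.univ) (s' := fun _ => Finset.univ) (by simp)]
    conv_rhs => rw [Finset.sum_comm]
    refine Finset.sum_congr rfl fun i _ => ?_
    conv_rhs => rw [Finset.sum_comm]
  rw [hsum]
  refine Finset.sum_nonneg fun k _ => ?_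
  exact RCLike.nonneg_iff.2 ⟨inner_self_nonneg, inner_self_im _⟩

end StarHom

/-! ### Splitting a dominated functional -/

section HahnBanachSplitting

/-- A functional dominated by `ε‖x‖ + C‖j x‖` is within `2ε` of one that factors through `j`. -/
theorem exists_inner_approx {V E : Type*} [NormedAddCommGroup V] [NormedSpace ℂ V]
    [NormedAddCommGroup E] [InnerProductSpace ℂ E] [CompleteSpace E] (j : V →L[ℂ] E)
    (φ : V →ₗ[ℂ] ℂ) {ε C : ℝ} (hε : 0 < ε) (hC : 0 ≤ C)
    (h : ∀ x, ‖φ x‖ ≤ ε * ‖x‖ + C * ‖j x‖) :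
    ∃ ζ : E, ∀ x, ‖φ x - ⟪ζ, j x⟫_ℂ‖ ≤ 2 * ε * ‖x‖ := by
  -- Embed x as (εx, C j x) with the sup norm. There φ has norm at most 2, and a norm-preserving
  -- extension splits into a part on V, of size 2ε, and a part on E represented by a vector.
  let ψ : V →ₗ[ℂ] V × E := LinearMap.prod ((ε : ℂ) • LinearMap.id) ((C : ℂ) • (j : V →ₗ[ℂ] E))
  have hψ : Function.Injective ψ := fun x y hxy => by
    have h1 : (ε : ℂ) • x = (ε : ℂ) • y := congrArg Prod.fst hxy
    exact smul_right_injective V (Complex.ofReal_ne_zero.2 hε.ne') h1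
  let e := LinearEquiv.ofInjective ψ hψ
  have hb : ∀ x, ‖φ x‖ ≤ 2 * ‖ψ x‖ := fun x => by
    have h1 : ε * ‖x‖ ≤ ‖ψ x‖ := by
      have := norm_fst_le (ψ x)
      change ‖(ε : ℂ) • x‖ ≤ _ at this
      rwa [norm_smul, Complex.norm_real, Real.norm_of_nonneg hε.le] at this
    have h2 : C * ‖j x‖ ≤ ‖ψ x‖ := by
      have := norm_snd_le (ψ x)
      change ‖(C : ℂ) • j x‖ ≤ _ at this
      rwa [norm_smul, Complex.norm_real, Real.norm_of_nonneg hC] at this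
    linarith [h x]
  let f : StrongDual ℂ (LinearMap.range ψ) :=
    (φ ∘ₗ (e.symm : LinearMap.range ψ →ₗ[ℂ] V)).mkContinuous 2 fun y => by
      have h1 := hb (e.symm y)
      have h2 : ψ (e.symm y) = y.1 := congrArg Subtype.val (e.apply_symm_apply y)
      rw [h2] at h1
      exact h1
  obtain ⟨g, hg, hgn⟩ := exists_extension_norm_eq _ f
  have hf2 : ‖f‖ ≤ 2 := LinearMap.mkContinuous_norm_le _ (by norm_num) _
  have hgψ : ∀ x, g (ψ x) = φ x := fun x => by
    have h1 := hg (e x)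
    have h2 : f (e x) = φ x := congrArg φ (e.symm_apply_apply x)
    rw [h2] at h1
    exact h1
  let k : StrongDual ℂ E := (C : ℂ) • (g ∘L ContinuousLinearMap.inr ℂ V E)
  refine ⟨(InnerProductSpace.toDual ℂ E).symm k, fun x => ?_⟩
  rw [InnerProductSpace.toDual_symm_apply, ← hgψ]
  have h1 : g (ψ x) - k (j x) = g ((ε : ℂ) • x, 0) := by
    have h2 : k (j x) = g (0, (C : ℂ) • j x) := by
      have : ((0, (C : ℂ) • j x) : V × E) = (C : ℂ) • (0, j x) := by simp
      rw [this, map_smul]; rfl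
    rw [h2, ← map_sub]
    congr 1
    ext <;> simp [ψ]
  rw [h1]
  refine (g.le_opNorm _).trans ?_
  rw [Prod.norm_mk, norm_zero, max_eq_left (norm_nonneg _), norm_smul, Complex.norm_real,
    Real.norm_of_nonneg hε.le, hgn]
  have : 0 ≤ ε * ‖x‖ := by positivity
  nlinarith

end HahnBanachSplitting


/-! ### A bounded operator monotone function -/

section Resolvent

variable {H : Type*} [NormedAddCommGroup H] [InnerProductSpace ℂ H] [CompleteSpace H]

/-- The operator monotone function `1 - (1 + S)⁻¹ = S (1 + S)⁻¹` of a positive operator. -/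
def boundedPart (S : H →L[ℂ] H) : H →L[ℂ] H := cfc (fun x : ℝ => 1 - (1 + x)⁻¹) S

theorem continuousOn_one_sub_inv {s : Set ℝ} (hs : ∀ x ∈ s, 0 ≤ x) :
    ContinuousOn (fun x : ℝ => 1 - (1 + x)⁻¹) s := by
  refine continuousOn_const.sub (ContinuousOn.inv₀ (by fun_prop) fun x hx => ?_)
  have := hs x hx
  positivity

theorem boundedPart_nonneg {S : H →L[ℂ] H} (hS : 0 ≤ S) : 0 ≤ boundedPart S :=
  cfc_nonneg fun x hx => by
    have := spectrum_nonneg_of_nonneg hS hx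
    have : (1 + x)⁻¹ ≤ 1 := inv_le_one_of_one_le₀ (by linarith)
    simpa using this

theorem boundedPart_le_one {S : H →L[ℂ] H} (hS : 0 ≤ S) : boundedPart S ≤ 1 :=
  cfc_le_one _ _ fun x hx => by
    have := spectrum_nonneg_of_nonneg hS hx
    have : 0 ≤ (1 + x)⁻¹ := by positivity
    simpa using this

/-- The function is x/(1 + x), at most x for x ≥ 0; this transfers trace bounds from S to its
bounded part. -/
theorem boundedPart_le_self {S : H →L[ℂ] H} (hS : 0 ≤ S) : boundedPart S ≤ S := by
  have hsa : IsSelfAdjoint S := hS.isSelfAdjoint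
  conv_rhs => rw [← cfc_id ℝ S hsa]
  refine (cfc_le_iff _ _ S
    (continuousOn_one_sub_inv fun _ hx => spectrum_nonneg_of_nonneg hS hx) continuousOn_id hsa).2 fun x hx => ?_
  have h0 := spectrum_nonneg_of_nonneg hS hx
  have : 1 - (1 + x)⁻¹ = x / (1 + x) := by field_simp; ring
  rw [this, id, div_le_iff₀ (by linarith)]
  nlinarith

/-- On [0, 1] the denominator 1 + x is at most 2, whence the factor 1/2. -/
theorem half_smul_le_boundedPart {S : H →L[ℂ] H} (hS : 0 ≤ S) (hS1 : S ≤ 1) :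
    (1 / 2 : ℝ) • S ≤ boundedPart S := by
  have hsa : IsSelfAdjoint S := hS.isSelfAdjoint
  conv_lhs => rw [← cfc_id ℝ S hsa, ← cfc_smul (1 / 2 : ℝ) id S continuousOn_id]
  refine (cfc_le_iff _ _ S (by fun_prop)
    (continuousOn_one_sub_inv fun _ hx => spectrum_nonneg_of_nonneg hS hx) hsa).2 fun x hx => ?_
  have h0 := spectrum_nonneg_of_nonneg hS hx
  have h1 : x ≤ 1 := by
    have h2 := hS1
    rw [← cfc_id ℝ S hsa] at h2
    exact (cfc_le_one_iff id S continuousOn_id hsa).1 h2 x hx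
  have : 1 - (1 + x)⁻¹ = x / (1 + x) := by field_simp; ring
  rw [this, id, le_div_iff₀ (by linarith), smul_eq_mul]
  nlinarith

/-- This operator monotonicity is why the resolvent is used; truncation by min(x, 1) would not have
it. -/
theorem boundedPart_mono {S T : H →L[ℂ] H} (hS : 0 ≤ S) (h : S ≤ T) :
    boundedPart S ≤ boundedPart T := by
  have key : ∀ {S : H →L[ℂ] H}, 0 ≤ S → cfcₙ (fun x : ℝ => 1 - (1 + x)⁻¹) S = boundedPart S :=
    fun hS => cfcₙ_eq_cfc (continuousOn_one_sub_inv fun _ => quasispectrum_nonneg_of_nonneg _ hS _)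
      (by simp)
  have := CFC.monotoneOn_one_sub_one_add_inv_real (A := H →L[ℂ] H) hS (hS.trans h) h
  rwa [key hS, key (hS.trans h)] at this

theorem boundedPart_mem (R : VonNeumannAlgebra H) {S : H →L[ℂ] H} (hS : S ∈ R) :
    boundedPart S ∈ R :=
  mem_of_commute_commutant R fun _ hy =>
    (Commute.cfc_real (commute_of_mem_commutant hS hy) _).eq

end Resolvent

/-! ### Order, weak limits and the trace -/

section OrderLimits

open scoped ComplexOrder

variable {H : Type*} [NormedAddCommGroup H] [InnerProductSpace ℂ H] [CompleteSpace H]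

theorem nonneg_iff_inner {x : H →L[ℂ] H} : 0 ≤ x ↔ ∀ a, 0 ≤ ⟪a, x a⟫_ℂ := by
  rw [ContinuousLinearMap.nonneg_iff_isPositive, isPositive_iff_inner_right]

theorem norm_le_one_of_nonneg {x : H →L[ℂ] H} (h0 : 0 ≤ x) (h1 : x ≤ 1) : ‖x‖ ≤ 1 :=
  (CStarAlgebra.norm_le_one_iff_of_nonneg x h0).2 h1

theorem re_inner_mono {x y : H →L[ℂ] H} (h : x ≤ y) (a : H) :
    (⟪a, x a⟫_ℂ).re ≤ (⟪a, y a⟫_ℂ).re := by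
  have := nonneg_iff_inner.1 (sub_nonneg.2 h) a
  rw [sub_apply, inner_sub_right] at this
  have := (Complex.nonneg_iff.1 this).1
  simpa using this

section

variable {ι : Type*} {l : Filter ι} [l.NeBot] {x : ι → H →L[ℂ] H} {y z : H →L[ℂ] H}

theorem nonneg_of_tendsto_inner (hy : ∀ a b, Tendsto (fun i => ⟪a, x i b⟫_ℂ) l (𝓝 ⟪a, y b⟫_ℂ))
    (h : ∀ᶠ i in l, 0 ≤ x i) : 0 ≤ y :=
  nonneg_iff_inner.2 fun a => ge_of_tendsto (hy a a) (h.mono fun _ hi => nonneg_iff_inner.1 hi a)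

theorem le_of_tendsto_inner_of_le {x' : ι → H →L[ℂ] H} {y' : H →L[ℂ] H}
    (hy : ∀ a b, Tendsto (fun i => ⟪a, x i b⟫_ℂ) l (𝓝 ⟪a, y b⟫_ℂ))
    (hy' : ∀ a b, Tendsto (fun i => ⟪a, x' i b⟫_ℂ) l (𝓝 ⟪a, y' b⟫_ℂ))
    (h : ∀ᶠ i in l, x i ≤ x' i) : y ≤ y' := by
  refine sub_nonneg.1 (nonneg_of_tendsto_inner (l := l) (x := fun i => x' i - x i) (fun a b => ?_)
    (h.mono fun _ hi => sub_nonneg.2 hi))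
  simp only [sub_apply, inner_sub_right]
  exact (hy' a b).sub (hy a b)

theorem ge_of_tendsto_inner (hy : ∀ a b, Tendsto (fun i => ⟪a, x i b⟫_ℂ) l (𝓝 ⟪a, y b⟫_ℂ))
    (h : ∀ᶠ i in l, z ≤ x i) : z ≤ y :=
  le_of_tendsto_inner_of_le (fun _ _ => tendsto_const_nhds) hy h

theorem le_of_tendsto_inner (hy : ∀ a b, Tendsto (fun i => ⟪a, x i b⟫_ℂ) l (𝓝 ⟪a, y b⟫_ℂ))
    (h : ∀ᶠ i in l, x i ≤ z) : y ≤ z :=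
  le_of_tendsto_inner_of_le hy (fun _ _ => tendsto_const_nhds) h

end

/-- On bounded sets weak operator convergence suffices, by dominated convergence in the series for
ρ. -/
theorem IsNormalFunctional.tendsto {M : Submodule ℂ (H →L[ℂ] H)} {ρ : M →ₗ[ℂ] ℂ}
    (hρ : IsNormalFunctional M ρ) {ι : Type*} {l : Filter ι} {x : ι → M} {y : M} {C : ℝ}
    (hx : ∀ i, ‖x i‖ ≤ C)
    (hy : ∀ a b, Tendsto (fun i => ⟪a, (x i).1 b⟫_ℂ) l (𝓝 ⟪a, y.1 b⟫_ℂ)) :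
    Tendsto (fun i => ρ (x i)) l (𝓝 (ρ y)) := by
  obtain ⟨f, ⟨a, b, ha, hb, hf⟩, h⟩ := hρ
  simp only [h, hf]
  refine tendsto_tsum_of_dominated_convergence (bound := fun n => C * (‖a n‖ * ‖b n‖))
    ((summable_norm_mul_norm ha hb).mul_left C) (fun n => hy _ _)
    (Eventually.of_forall fun i n => ?_)
  calc ‖⟪a n, (x i).1 (b n)⟫_ℂ‖ ≤ ‖a n‖ * (‖(x i).1‖ * ‖b n‖) :=
        (norm_inner_le_norm _ _).trans (by gcongr; exact (x i).1.le_opNorm _)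
    _ ≤ ‖a n‖ * (C * ‖b n‖) := by gcongr; exact hx i
    _ = _ := by ring

/-- The unit interval of a von Neumann algebra is compact for weak limits. -/
theorem exists_weak_limit_mem (R : VonNeumannAlgebra H) {ι : Type*} (U : Ultrafilter ι)
    (x : ι → space R) (h0 : ∀ i, 0 ≤ (x i).1) (h1 : ∀ i, (x i).1 ≤ 1) :
    ∃ y : space R, 0 ≤ y.1 ∧ y.1 ≤ 1 ∧
      ∀ a b, Tendsto (fun i => ⟪a, (x i).1 b⟫_ℂ) U (𝓝 ⟪a, y.1 b⟫_ℂ) := by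
  obtain ⟨y, hy⟩ := exists_weak_limit U (fun i => (x i).1) 1
    fun i => norm_le_one_of_nonneg (h0 i) (h1 i)
  exact ⟨⟨y, mem_of_tendsto_inner R (fun i => (x i).2) hy⟩,
    nonneg_of_tendsto_inner hy (Eventually.of_forall h0),
    le_of_tendsto_inner hy (Eventually.of_forall h1), hy⟩

theorem IsState.re_mono {M : Submodule ℂ (H →L[ℂ] H)} {ρ : M →ₗ[ℂ] ℂ} (hρ : IsState M ρ)
    {x y : M} (h : x.1 ≤ y.1) : (ρ x).re ≤ (ρ y).re := by
  have := (hρ.nonneg (y - x) h).1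
  rw [map_sub, Complex.sub_re] at this
  linarith

theorem IsState.re_nonneg {M : Submodule ℂ (H →L[ℂ] H)} {ρ : M →ₗ[ℂ] ℂ} (hρ : IsState M ρ)
    {x : M} (h : 0 ≤ x.1) : 0 ≤ (ρ x).re :=
  (hρ.nonneg x (ContinuousLinearMap.nonneg_iff_isPositive _ |>.1 h)).1

theorem sqrt_mem (R : VonNeumannAlgebra H) {x : H →L[ℂ] H} (hx : x ∈ R) : CFC.sqrt x ∈ R :=
  mem_of_commute_commutant R fun _ hy =>
    (Commute.cfcₙ_nnreal (commute_of_mem_commutant hx hy) _).eq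

/-- Faithfulness is stated for s*s; apply it to s = √x, which lies in R. -/
theorem IsTrace.eq_zero_of_nonneg {R : VonNeumannAlgebra H} {τ : space R →ₗ[ℂ] ℂ}
    (hτ : IsTrace R τ) {x : space R} (hx : 0 ≤ x.1) (h : (τ x).re ≤ 0) : x = 0 := by
  have h0 : τ x = 0 := Complex.ext (le_antisymm h (hτ.state.re_nonneg hx))
    (hτ.state.nonneg x (ContinuousLinearMap.nonneg_iff_isPositive _ |>.1 hx)).2
  let s : space R := ⟨CFC.sqrt x.1, sqrt_mem R x.2⟩
  have hs : vnMul R (vnStar R s) s = x := Subtype.ext (by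
    change star (CFC.sqrt x.1) * CFC.sqrt x.1 = x.1
    rw [(CFC.sqrt_nonneg x.1).isSelfAdjoint.star_eq, CFC.sqrt_mul_sqrt_self x.1 hx])
  have hs0 : s = 0 := hτ.faithful s (by rw [hs, h0])
  rw [← hs, hs0]
  exact Subtype.ext (mul_zero _)

end OrderLimits


/-! ### Automatic normality of *-automorphisms -/

section OrderIso

open scoped ComplexOrder

variable {H : Type*} [NormedAddCommGroup H] [InnerProductSpace ℂ H] [CompleteSpace H]

theorem map_mono_of_nonneg {M N : Submodule ℂ (H →L[ℂ] H)} {A : M →ₗ[ℂ] N}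
    (hA : ∀ x, 0 ≤ x.1 → 0 ≤ (A x).1) {x y : M} (h : x.1 ≤ y.1) : (A x).1 ≤ (A y).1 := by
  have := hA (y - x) (sub_nonneg.2 h)
  rw [map_sub] at this
  exact sub_nonneg.1 this

/-- Order automorphisms are absolutely continuous with respect to a faithful normal trace. -/
theorem IsTrace.exists_re_inner_lt {R : VonNeumannAlgebra H} {τ : space R →ₗ[ℂ] ℂ}
    (hτ : IsTrace R τ) (A : space R ≃ₗ[ℂ] space R) (hA : ∀ x, 0 ≤ x.1 → 0 ≤ (A x).1)
    (hA' : ∀ x, 0 ≤ x.1 → 0 ≤ (A.symm x).1) (hA1 : ∀ x, x.1 = 1 → (A x).1 = 1) (b : H)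
    {ε : ℝ} (hε : 0 < ε) : ∃ δ > 0, ∀ x : space R, 0 ≤ x.1 → x.1 ≤ 1 → (τ x).re < δ →
      (⟪b, (A x).1 b⟫_ℂ).re < ε := by
  by_contra! hcon
  choose x hx0 hx1 hxτ hxε using fun n : ℕ => hcon ((1 / 2) ^ n) (by positivity)
  have hmono : ∀ {y z : space R}, y.1 ≤ z.1 → (A y).1 ≤ (A z).1 :=
    map_mono_of_nonneg (A := (A : space R →ₗ[ℂ] space R)) hA
  have hmono' : ∀ {y z : space R}, y.1 ≤ z.1 → (A.symm y).1 ≤ (A.symm z).1 :=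
    map_mono_of_nonneg (A := (A.symm : space R →ₗ[ℂ] space R)) hA'
  let U : Ultrafilter ℕ := Ultrafilter.of atTop
  have hU : (U : Filter ℕ) ≤ atTop := Ultrafilter.of_le atTop
  let S : ℕ → ℕ → space R := fun m N => ∑ n ∈ Finset.Ico m N, x n
  have hS : ∀ m N, (S m N).1 = ∑ n ∈ Finset.Ico m N, (x n).1 := fun m N =>
    AddSubmonoidClass.coe_finsetSum _ _
  have hS0 : ∀ m N, 0 ≤ (S m N).1 := fun m N => by
    rw [hS]; exact Finset.sum_nonneg fun n _ => hx0 n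
  -- G m N is a bounded substitute for the supremum of x m, …, x (N − 1). Its weak limit g m in N
  -- dominates x m / 2, decreases in m and has trace at most the geometric tail.
  let G : ℕ → ℕ → space R := fun m N => ⟨boundedPart (S m N).1, boundedPart_mem R (S m N).2⟩
  have hG0 : ∀ m N, 0 ≤ (G m N).1 := fun m N => boundedPart_nonneg (hS0 m N)
  have hG1 : ∀ m N, (G m N).1 ≤ 1 := fun m N => boundedPart_le_one (hS0 m N)
  choose g hg0 hg1 hg using fun m => exists_weak_limit_mem R U (G m) (hG0 m) (hG1 m)
  have hanti : ∀ {m m'}, m ≤ m' → (g m').1 ≤ (g m).1 := fun {m m'} hm =>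
    le_of_tendsto_inner_of_le (hg m') (hg m) (Eventually.of_forall fun N => by
      refine boundedPart_mono (hS0 m' N) ?_
      rw [hS, hS]
      exact Finset.sum_le_sum_of_subset_of_nonneg (Finset.Ico_subset_Ico_left hm)
        fun n _ _ => hx0 n)
  have hge : ∀ m, (1 / 2 : ℝ) • (x m).1 ≤ (g m).1 := fun m =>
    ge_of_tendsto_inner (hg m) <| ((eventually_gt_atTop m).filter_mono hU).mono fun N hN => by
      refine (half_smul_le_boundedPart (hx0 m) (hx1 m)).trans (boundedPart_mono (hx0 m) ?_)
      rw [hS]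
      exact Finset.single_le_sum (f := fun n => (x n).1) (fun n _ => hx0 n)
        (Finset.mem_Ico.2 ⟨le_rfl, hN⟩)
  have hgτ : ∀ m, (τ (g m)).re ≤ 2 * (1 / 2) ^ m := fun m => by
    have h1 := hτ.normal.tendsto (l := (U : Filter ℕ)) (C := 1)
      (fun N => norm_le_one_of_nonneg (hG0 m N) (hG1 m N)) (hg m)
    refine le_of_tendsto ((Complex.continuous_re.tendsto _).comp h1)
      (Eventually.of_forall fun N => ?_)
    calc (τ (G m N)).re ≤ (τ (S m N)).re := hτ.state.re_mono (boundedPart_le_self (hS0 m N))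
      _ = ∑ n ∈ Finset.Ico m N, (τ (x n)).re := by rw [map_sum, Complex.re_sum]
      _ ≤ ∑ n ∈ Finset.Ico m N, (1 / 2 : ℝ) ^ n := Finset.sum_le_sum fun n _ => (hxτ n).le
      _ ≤ (1 / 2) ^ m / (1 - 1 / 2) := geom_sum_Ico_le_of_lt_one (by norm_num) (by norm_num)
      _ = _ := by ring
  obtain ⟨γ, hγ0, hγ1, hγ⟩ := exists_weak_limit_mem R U g hg0 hg1
  have hγz : γ = 0 := by
    refine hτ.eq_zero_of_nonneg hγ0 ?_
    have h1 := hτ.normal.tendsto (l := (U : Filter ℕ)) (C := 1)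
      (fun N => norm_le_one_of_nonneg (hg0 N) (hg1 N)) hγ
    have h2 : Tendsto (fun m : ℕ => 2 * (1 / 2 : ℝ) ^ m) U (𝓝 0) := by
      have := (tendsto_pow_atTop_nhds_zero_of_lt_one (r := (1 / 2 : ℝ)) (by norm_num)
        (by norm_num)).const_mul 2
      rw [mul_zero] at this
      exact this.mono_left hU
    exact le_of_tendsto_of_tendsto' ((Complex.continuous_re.tendsto _).comp h1) h2 hgτ
  have hAle : ∀ y : space R, y.1 ≤ 1 → (A y).1 ≤ 1 := fun y hy => by
    rw [← hA1 ⟨1, one_mem_space R⟩ rfl]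
    exact hmono hy
  -- A is not yet known to be normal, so the limit of A(g m) cannot be computed directly. Order
  -- replaces continuity: h ≤ A(g m) gives A⁻¹h ≤ g m for every m, so A⁻¹h ≤ γ = 0 and h = 0. But
  -- A(g m) ≥ A(x m)/2 keeps ⟪b, h b⟫ at least ε/2.
  obtain ⟨h, hh0, hh1, hh⟩ := exists_weak_limit_mem R U (fun m => A (g m))
    (fun m => hA _ (hg0 m)) (fun m => hAle _ (hg1 m))
  have hhle : ∀ m, h.1 ≤ (A (g m)).1 := fun m =>
    le_of_tendsto_inner hh (((eventually_ge_atTop m).filter_mono hU).mono fun m' hm =>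
      hmono (hanti hm))
  have hinv : (A.symm h).1 ≤ γ.1 := ge_of_tendsto_inner hγ (Eventually.of_forall fun m => by
    have := hmono' (hhle m)
    rwa [A.symm_apply_apply] at this)
  have hz : A.symm h = 0 := Subtype.ext (le_antisymm (by rw [hγz] at hinv; exact hinv) (hA' h hh0))
  have hz' : h = 0 := by rw [← A.apply_symm_apply h, hz, map_zero]
  have hlast : ε / 2 ≤ (⟪b, h.1 b⟫_ℂ).re := by
    refine ge_of_tendsto ((Complex.continuous_re.tendsto _).comp (hh b b))
      (Eventually.of_forall fun m => ?_)
    have h1 : (A (((1 / 2 : ℝ) : ℂ) • x m)).1 ≤ (A (g m)).1 := hmono (hge m)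
    have h2 := re_inner_mono h1 b
    rw [map_smul] at h2
    have h3 : (⟪b, (((1 / 2 : ℝ) : ℂ) • A (x m)).1 b⟫_ℂ).re =
        1 / 2 * (⟪b, (A (x m)).1 b⟫_ℂ).re := by
      change (⟪b, ((1 / 2 : ℝ) : ℂ) • (A (x m)).1 b⟫_ℂ).re = _
      rw [inner_smul_right, Complex.re_ofReal_mul]
    have h4 := hxε m
    change ε / 2 ≤ (⟪b, (A (g m)).1 b⟫_ℂ).re
    rw [h3] at h2
    linarith
  rw [hz'] at hlast
  simp at hlast
  linarith

/-- The evaluation of operators on a square summable sequence. -/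
def seqEval (η : SeqSpace H) : (H →L[ℂ] H) →L[ℂ] SeqSpace H :=
  LinearMap.mkContinuous
    { toFun := fun T => seqAmp T η
      map_add' := fun S T => by ext n; rfl
      map_smul' := fun c T => by ext n; rfl } ‖η‖ fun T => by
    rw [mul_comm]
    refine ((seqAmp T).le_opNorm η).trans ?_
    gcongr
    exact LinearMap.mkContinuous_norm_le _ (norm_nonneg T) _

theorem isNormalOnBH_inner_seqEval (ζ η : SeqSpace H) :
    IsNormalOnBH ((innerSL ℂ ζ ∘L seqEval η : (H →L[ℂ] H) →L[ℂ] ℂ) : (H →L[ℂ] H) →ₗ[ℂ] ℂ) :=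
  ⟨ζ, η, (SeqSpace.hasSum_norm_sq ζ).summable, (SeqSpace.hasSum_norm_sq η).summable,
    fun _ => lp.inner_eq_tsum _ _⟩

/-- A normal state is dominated by a sum of vector states. -/
theorem IsNormalFunctional.exists_re_le {R : VonNeumannAlgebra H} {ρ : space R →ₗ[ℂ] ℂ}
    (hρ : IsNormalFunctional (space R) ρ) :
    ∃ η : SeqSpace H, ∀ y, (ρ (vnMul R (vnStar R y) y)).re ≤ ‖seqEval η y.1‖ ^ 2 := by
  obtain ⟨f, ⟨a, b, ha, hb, hf⟩, h⟩ := hρ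
  -- Re⟪ya, yb⟫ = ‖y(a + b)/2‖² − ‖y(a − b)/2‖², and the last term is dropped.
  refine ⟨((1 / 2 : ℝ) : ℂ) • (seqVec a ha + seqVec b hb), fun y => ?_⟩
  rw [h, hf, Complex.re_tsum, ← (SeqSpace.hasSum_norm_sq _).tsum_eq]
  · refine Summable.tsum_le_tsum (fun n => ?_) ?_ (SeqSpace.hasSum_norm_sq _).summable
    · change (⟪a n, (star y.1) (y.1 (b n))⟫_ℂ).re ≤
        ‖y.1 (((1 / 2 : ℝ) : ℂ) • (a n + b n))‖ ^ 2
      rw [ContinuousLinearMap.star_eq_adjoint, ContinuousLinearMap.adjoint_inner_right, map_smul,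
        map_add, norm_smul, mul_pow, Complex.norm_real, Real.norm_eq_abs, sq_abs]
      have h1 := parallelogram_law_with_norm ℂ (y.1 (a n)) (y.1 (b n))
      have h2 := norm_add_sq (𝕜 := ℂ) (y.1 (a n)) (y.1 (b n))
      change _ = _ + 2 * (⟪y.1 (a n), y.1 (b n)⟫_ℂ).re + _ at h2
      nlinarith [mul_self_nonneg ‖y.1 (a n) - y.1 (b n)‖]
    · exact (Complex.hasSum_re (summable_inner_apply ha hb _).hasSum).summable
  · exact summable_inner_apply ha hb _

/-- Contractivity carries approximation of functionals on the target back to the source, where the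
predual is norm closed; so a total set of vectors is enough. -/
theorem isNormalMap_of_vecFun {K : Type*} [NormedAddCommGroup K] [InnerProductSpace ℂ K]
    [CompleteSpace K] {R : VonNeumannAlgebra H} {N : Submodule ℂ (K →L[ℂ] K)}
    (A : space R →ₗ[ℂ] N) (hA : ∀ x, ‖A x‖ ≤ ‖x‖) {D : Set K}
    (hD : Dense (Submodule.span ℂ D : Set K))
    (h : ∀ u ∈ D, ∀ v ∈ D, IsNormalFunctional (space R)
      ((vecFun u v : (K →L[ℂ] K) →ₗ[ℂ] ℂ) ∘ₗ N.subtype ∘ₗ A)) : IsNormalMap A := by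
  rw [isNormalMap_iff]
  rintro ρ ⟨f, hf, hfe⟩
  refine isNormalFunctional_of_approx _ fun ε hε => ?_
  obtain ⟨g, hg, hfg⟩ := hf.exists_approx hD hε
  refine ⟨(g : (K →L[ℂ] K) →ₗ[ℂ] ℂ) ∘ₗ N.subtype ∘ₗ A, ?_, fun T => ?_⟩
  · clear hfg
    rw [← mem_predual]
    induction hg using Submodule.span_induction with
    | mem g hg =>
      obtain ⟨u, hu, v, hv, rfl⟩ := hg
      exact mem_predual.2 (h u hu v hv)
    | zero => exact Submodule.zero_mem _
    | add g g' _ _ h h' => exact Submodule.add_mem _ h h'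
    | smul c g _ h => exact Submodule.smul_mem _ c h
  · rw [LinearMap.comp_apply, hfe]
    refine (hfg (A T).1).trans ?_
    gcongr
    exact hA T

/-- *-automorphisms of a von Neumann algebra with a faithful normal trace are normal. -/
theorem IsTrace.isNormalMap_of_starHom {R : VonNeumannAlgebra H} {τ : space R →ₗ[ℂ] ℂ}
    (hτ : IsTrace R τ) (A : space R ≃ₗ[ℂ] space R) (hA : ∀ x, 0 ≤ x.1 → 0 ≤ (A x).1)
    (hA' : ∀ x, 0 ≤ x.1 → 0 ≤ (A.symm x).1) (hA1 : ∀ x, x.1 = 1 → (A x).1 = 1)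
    (hmul : ∀ x y, (A (vnMul R x y)).1 = (A x).1 * (A y).1)
    (hstar : ∀ x, (A (vnStar R x)).1 = star (A x).1) (hnorm : ∀ x, ‖A x‖ ≤ ‖x‖) :
    IsNormalMap (A : space R →ₗ[ℂ] space R) := by
  refine isNormalMap_of_vecFun (D := Set.univ) _ hnorm (by simp) fun a _ b _ => ?_
  obtain ⟨η, hη⟩ := hτ.normal.exists_re_le
  refine isNormalFunctional_of_approx R fun ε hε => ?_
  set φ : space R →ₗ[ℂ] ℂ := (vecFun a b : (H →L[ℂ] H) →ₗ[ℂ] ℂ) ∘ₗ (space R).subtype ∘ₗ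
    (A : space R →ₗ[ℂ] space R) with hφ
  have hφa : ∀ y, φ y = ⟪a, (A y).1 b⟫_ℂ := fun y => rfl
  -- Chosen so that ‖a‖κ ≤ ε/2; the square κ² below appears because the estimate is applied to y*y
  -- and bounds ‖A(y)b‖².
  set κ : ℝ := ε / 2 / (‖a‖ + 1) with hκ
  have hκ0 : 0 < κ := by positivity
  obtain ⟨δ, hδ, hδA⟩ := hτ.exists_re_inner_lt A hA hA' hA1 b (ε := κ ^ 2) (by positivity)
  -- A dichotomy for x = y*y/‖y‖². If τ(x) < δ, absolute continuity makes ‖A(y)b‖ ≤ κ‖y‖. Otherwise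
  -- √δ‖y‖ ≤ ‖yη‖, and the trivial bound ‖a‖‖b‖‖y‖ is absorbed by the second term.
  have hbound : ∀ y : space R, ‖φ y‖ ≤ ε / 2 * ‖y‖ +
      ‖a‖ * ‖b‖ / √δ * ‖(seqEval η ∘L (space R).subtypeL) y‖ := by
    intro y
    rw [hφa]
    by_cases hy : y = 0
    · simp [hy]
    have hy0 : 0 < ‖y‖ := norm_pos_iff.2 hy
    let z : space R := vnMul R (vnStar R y) y
    have hz0 : 0 ≤ z.1 := star_mul_self_nonneg y.1
    let c : ℝ := (‖y‖ ^ 2)⁻¹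
    have hc : 0 ≤ c := by positivity
    let x : space R := (c : ℂ) • z
    have hx : x.1 = c • z.1 := rfl
    have hx0 : 0 ≤ x.1 := by rw [hx]; exact smul_nonneg hc hz0
    have hx1 : x.1 ≤ 1 := by
      rw [← CStarAlgebra.norm_le_one_iff_of_nonneg x.1 hx0, hx, norm_smul, Real.norm_of_nonneg hc]
      change c * ‖star y.1 * y.1‖ ≤ 1
      rw [CStarRing.norm_star_mul_self, ← pow_two]
      exact (inv_mul_cancel₀ (by positivity)).le
    by_cases hlt : (τ x).re < δ
    · have h1 := hδA x hx0 hx1 hlt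
      have h2 : (⟪b, (A x).1 b⟫_ℂ).re = c * ‖(A y).1 b‖ ^ 2 := by
        rw [map_smul]
        change (⟪b, (c : ℂ) • (A z).1 b⟫_ℂ).re = _
        rw [inner_smul_right, Complex.re_ofReal_mul, hmul, hstar, mul_apply_eq_comp,
          ContinuousLinearMap.star_eq_adjoint, ContinuousLinearMap.adjoint_inner_right,
          inner_self_eq_norm_sq_to_K]
        norm_cast
      have h3 : ‖(A y).1 b‖ ≤ κ * ‖y‖ := by
        refine le_of_sq_le_sq ?_ (by positivity)
        rw [h2, inv_mul_lt_iff₀ (by positivity)] at h1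
        rw [mul_pow, mul_comm]
        exact h1.le
      calc ‖⟪a, (A y).1 b⟫_ℂ‖ ≤ ‖a‖ * (κ * ‖y‖) :=
            (norm_inner_le_norm _ _).trans (by gcongr)
        _ ≤ (‖a‖ + 1) * (κ * ‖y‖) := by gcongr; linarith
        _ = ε / 2 * ‖y‖ := by rw [hκ]; field_simp
        _ ≤ _ := le_add_of_nonneg_right (by positivity)
    · have h1 : δ ≤ c * ‖seqEval η y.1‖ ^ 2 := by
        refine (not_lt.1 hlt).trans ?_
        rw [map_smul, smul_eq_mul, Complex.re_ofReal_mul]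
        gcongr
        exact hη y
      have h2 : √δ * ‖y‖ ≤ ‖seqEval η y.1‖ := by
        refine le_of_sq_le_sq ?_ (by positivity)
        rw [mul_pow, Real.sq_sqrt hδ.le, mul_comm]
        rwa [← div_eq_inv_mul, le_div_iff₀ (by positivity), mul_comm] at h1
      have hs : 0 < √δ := Real.sqrt_pos.2 hδ
      have h3 : ‖(A y).1‖ ≤ ‖y‖ := hnorm y
      calc ‖⟪a, (A y).1 b⟫_ℂ‖ ≤ ‖a‖ * (‖y‖ * ‖b‖) :=
            (norm_inner_le_norm _ _).trans (by
              gcongr; exact ((A y).1.le_opNorm b).trans (by gcongr))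
        _ = ‖a‖ * ‖b‖ / √δ * (√δ * ‖y‖) := by field_simp
        _ ≤ ‖a‖ * ‖b‖ / √δ * ‖seqEval η y.1‖ := by gcongr
        _ ≤ _ := le_add_of_nonneg_left (by positivity)
  obtain ⟨ζ, hζ⟩ := exists_inner_approx _ φ (half_pos hε) (by positivity) hbound
  exact ⟨((innerSL ℂ ζ ∘L seqEval η : (H →L[ℂ] H) →L[ℂ] ℂ) : (H →L[ℂ] H) →ₗ[ℂ] ℂ) ∘ₗ
    (space R).subtype, ⟨_, isNormalOnBH_inner_seqEval ζ η, fun x => rfl⟩,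
    fun x => (hζ x).trans_eq (by ring)⟩

end OrderIso


/-! ### *-automorphisms as normal UCP maps -/

section Automorphism

variable {H : Type*} [NormedAddCommGroup H] [InnerProductSpace ℂ H] [CompleteSpace H]

theorem autLinear_vnMul (R : VonNeumannAlgebra H)
    (α : R.toStarSubalgebra ≃⋆ₐ[ℂ] R.toStarSubalgebra) (x y : space R) :
    (autLinear R α (vnMul R x y)).1 = (autLinear R α x).1 * (autLinear R α y).1 :=
  congrArg Subtype.val (map_mul α ⟨x.1, x.2⟩ ⟨y.1, y.2⟩)

theorem autLinear_vnStar (R : VonNeumannAlgebra H)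
    (α : R.toStarSubalgebra ≃⋆ₐ[ℂ] R.toStarSubalgebra) (x : space R) :
    (autLinear R α (vnStar R x)).1 = star (autLinear R α x).1 := by
  have h : α (star (⟨x.1, x.2⟩ : R.toStarSubalgebra)) = star (α ⟨x.1, x.2⟩) := map_star α _
  exact congrArg Subtype.val h

theorem autLinear_one (R : VonNeumannAlgebra H)
    (α : R.toStarSubalgebra ≃⋆ₐ[ℂ] R.toStarSubalgebra) (x : space R) (hx : x.1 = 1) :
    (autLinear R α x).1 = 1 := by
  obtain ⟨x, hxR⟩ := x
  subst hx
  exact congrArg Subtype.val (map_one α)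

theorem isCP_autLinear (R : VonNeumannAlgebra H)
    (α : R.toStarSubalgebra ≃⋆ₐ[ℂ] R.toStarSubalgebra) :
    IsCP (autLinear R α : space R →ₗ[ℂ] space R) :=
  isCP_of_starHom _ (autLinear_vnMul R α) (autLinear_vnStar R α)

/-- *-automorphisms of a von Neumann algebra with a faithful normal trace are normal UCP maps. -/
theorem IsTrace.isNormalUCP_autLinear {R : VonNeumannAlgebra H} {τ : space R →ₗ[ℂ] ℂ}
    (hτ : IsTrace R τ) (α : R.toStarSubalgebra ≃⋆ₐ[ℂ] R.toStarSubalgebra) :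
    IsNormalUCP (autLinear R α : space R →ₗ[ℂ] space R) := by
  have hpos : ∀ (β : R.toStarSubalgebra ≃⋆ₐ[ℂ] R.toStarSubalgebra) (x : space R), 0 ≤ x.1 →
      0 ≤ (autLinear R β x).1 := fun β x hx => by
    rw [ContinuousLinearMap.nonneg_iff_isPositive] at hx ⊢
    exact (isCP_autLinear R β).nonneg hx
  refine isNormalUCP_iff.2 ⟨?_, autLinear_one R α, isCP_autLinear R α⟩
  exact hτ.isNormalMap_of_starHom _ (hpos α) (hpos α.symm) (autLinear_one R α)
    (autLinear_vnMul R α) (autLinear_vnStar R α)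
    ((isCP_autLinear R α).norm_map_le (one_mem_space R) (star_mem_space R)
      (autLinear_one R α _ rfl))

end Automorphism

/-! ### Norms of functionals and norm convergence -/

section FunctionalNorm

variable {H : Type*} [NormedAddCommGroup H] [InnerProductSpace ℂ H] [CompleteSpace H]
variable {K : Type*} [NormedAddCommGroup K] [InnerProductSpace ℂ K] [CompleteSpace K]
variable {M : Submodule ℂ (H →L[ℂ] H)} {N : Submodule ℂ (K →L[ℂ] K)}

theorem enorm_apply_le_functionalNorm (ρ : M →ₗ[ℂ] ℂ) {x : M} (hx : ‖x‖ ≤ 1) :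
    ‖ρ x‖ₑ ≤ functionalNorm ρ :=
  le_iSup₂ (f := fun (x : M) (_ : ‖x‖ ≤ 1) => ‖ρ x‖ₑ) x hx

theorem functionalNorm_le_ofReal {ρ : M →ₗ[ℂ] ℂ} {C : ℝ} (hC : 0 ≤ C)
    (h : ∀ x, ‖ρ x‖ ≤ C * ‖x‖) : functionalNorm ρ ≤ ENNReal.ofReal C :=
  iSup₂_le fun x hx => by
    rw [← ofReal_norm]
    exact ENNReal.ofReal_le_ofReal ((h x).trans (mul_le_of_le_one_right hC hx))

theorem norm_apply_le_of_functionalNorm_le {ρ : M →ₗ[ℂ] ℂ} {C : ℝ} (hC : 0 ≤ C)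
    (h : functionalNorm ρ ≤ ENNReal.ofReal C) (x : M) : ‖ρ x‖ ≤ C * ‖x‖ := by
  by_cases hx : x = 0
  · simp [hx]
  have hx0 : 0 < ‖x‖ := norm_pos_iff.2 hx
  have h1 := (enorm_apply_le_functionalNorm ρ (x := ((‖x‖⁻¹ : ℝ) : ℂ) • x)
    (by rw [norm_smul, Complex.norm_real, norm_inv, norm_norm, inv_mul_cancel₀ hx0.ne'])).trans h
  rw [← ofReal_norm, ENNReal.ofReal_le_ofReal_iff hC, map_smul, norm_smul, Complex.norm_real,
    norm_inv, norm_norm, inv_mul_le_iff₀ hx0] at h1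
  linarith

theorem functionalNorm_comp_le (ρ : N →ₗ[ℂ] ℂ) {A : M →ₗ[ℂ] N} (hA : ∀ x, ‖A x‖ ≤ ‖x‖) :
    functionalNorm (ρ ∘ₗ A) ≤ functionalNorm ρ :=
  iSup₂_le fun x hx => enorm_apply_le_functionalNorm ρ ((hA x).trans hx)

theorem functionalNorm_le_add {ρ σ : M →ₗ[ℂ] ℂ} {C : ℝ} (hC : 0 ≤ C)
    (h : ∀ x, ‖ρ x - σ x‖ ≤ C * ‖x‖) :
    functionalNorm ρ ≤ functionalNorm σ + ENNReal.ofReal C :=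
  iSup₂_le fun x hx => by
    have h1 : ‖ρ x - σ x‖ₑ ≤ ENNReal.ofReal C := by
      rw [← ofReal_norm]
      exact ENNReal.ofReal_le_ofReal ((h x).trans (mul_le_of_le_one_right hC hx))
    calc ‖ρ x‖ₑ = ‖σ x + (ρ x - σ x)‖ₑ := by rw [add_sub_cancel]
      _ ≤ ‖σ x‖ₑ + ‖ρ x - σ x‖ₑ := enorm_add_le _ _
      _ ≤ _ := add_le_add (enorm_apply_le_functionalNorm σ hx) h1

/-- Norm convergence of the functionals `φ ∘ Q k` to `φ ∘ G`. -/
def TendstoNorm (Q : ℕ → M →ₗ[ℂ] N) (G : M →ₗ[ℂ] N) (φ : N →ₗ[ℂ] ℂ) : Prop :=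
  ∀ ε > 0, ∀ᶠ k in atTop, ∀ x, ‖φ (Q k x) - φ (G x)‖ ≤ ε * ‖x‖

variable {Q : ℕ → M →ₗ[ℂ] N} {G : M →ₗ[ℂ] N}

theorem TendstoNorm.add {φ ψ : N →ₗ[ℂ] ℂ} (hφ : TendstoNorm Q G φ) (hψ : TendstoNorm Q G ψ) :
    TendstoNorm Q G (φ + ψ) := fun ε hε => by
  filter_upwards [hφ _ (half_pos hε), hψ _ (half_pos hε)] with k h1 h2 x
  calc ‖(φ + ψ) (Q k x) - (φ + ψ) (G x)‖
      = ‖(φ (Q k x) - φ (G x)) + (ψ (Q k x) - ψ (G x))‖ := by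
        rw [LinearMap.add_apply, LinearMap.add_apply]; ring_nf
    _ ≤ ε / 2 * ‖x‖ + ε / 2 * ‖x‖ := (norm_add_le _ _).trans (add_le_add (h1 x) (h2 x))
    _ = ε * ‖x‖ := by ring

theorem TendstoNorm.smul {φ : N →ₗ[ℂ] ℂ} (hφ : TendstoNorm Q G φ) (c : ℂ) :
    TendstoNorm Q G (c • φ) := fun ε hε => by
  filter_upwards [hφ (ε / (‖c‖ + 1)) (by positivity)] with k h1 x
  rw [LinearMap.smul_apply, LinearMap.smul_apply, ← smul_sub, norm_smul]
  calc ‖c‖ * ‖φ (Q k x) - φ (G x)‖ ≤ (‖c‖ + 1) * (ε / (‖c‖ + 1) * ‖x‖) := by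
        gcongr
        · linarith
        · exact h1 x
    _ = ε * ‖x‖ := by field_simp

theorem TendstoNorm.zero : TendstoNorm Q G 0 := fun ε hε =>
  Eventually.of_forall fun k x => by simp; positivity

/-- Since all the maps are contractions, the functionals along which convergence holds form a norm
closed set: an ε/3 argument. -/
theorem TendstoNorm.of_approx (hQ : ∀ k x, ‖Q k x‖ ≤ ‖x‖) (hG : ∀ x, ‖G x‖ ≤ ‖x‖)
    {φ : N →ₗ[ℂ] ℂ}
    (h : ∀ ε > 0, ∃ ψ, TendstoNorm Q G ψ ∧ ∀ y, ‖φ y - ψ y‖ ≤ ε * ‖y‖) : TendstoNorm Q G φ := by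
  intro ε hε
  obtain ⟨ψ, hψ, hφψ⟩ := h (ε / 3) (by positivity)
  filter_upwards [hψ (ε / 3) (by positivity)] with k hk x
  have h1 : ‖φ (Q k x) - ψ (Q k x)‖ ≤ ε / 3 * ‖x‖ := (hφψ _).trans (by gcongr; exact hQ k x)
  have h2 : ‖φ (G x) - ψ (G x)‖ ≤ ε / 3 * ‖x‖ := (hφψ _).trans (by gcongr; exact hG x)
  calc ‖φ (Q k x) - φ (G x)‖ = ‖(φ (Q k x) - ψ (Q k x)) + (ψ (Q k x) - ψ (G x)) -
        (φ (G x) - ψ (G x))‖ := by ring_nf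
    _ ≤ ε / 3 * ‖x‖ + ε / 3 * ‖x‖ + ε / 3 * ‖x‖ :=
        (norm_sub_le _ _).trans (add_le_add ((norm_add_le _ _).trans (add_le_add h1 (hk x))) h2)
    _ = ε * ‖x‖ := by ring

theorem TendstoNorm.tendsto_functionalNorm {φ : N →ₗ[ℂ] ℂ} (hφ : TendstoNorm Q G φ) :
    Tendsto (fun k => functionalNorm (φ ∘ₗ Q k)) atTop (𝓝 (functionalNorm (φ ∘ₗ G))) := by
  refine ENNReal.tendsto_nhds_of_Icc fun ε hε => ?_
  -- The tolerance lives in [0, ∞] and may be ∞; a positive real below it is enough.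
  obtain ⟨δ, hδ0, hδ⟩ : ∃ δ : ℝ, 0 < δ ∧ ENNReal.ofReal δ ≤ ε := by
    by_cases ht : ε = ∞
    · exact ⟨1, one_pos, ht ▸ le_top⟩
    · exact ⟨ε.toReal, ENNReal.toReal_pos hε.ne' ht, ENNReal.ofReal_toReal_le⟩
  filter_upwards [hφ δ hδ0] with k hk
  refine ⟨tsub_le_iff_right.2 ?_, ?_⟩
  · refine (functionalNorm_le_add (σ := φ ∘ₗ Q k) hδ0.le fun x => ?_).trans (by gcongr)
    rw [norm_sub_rev]
    exact hk x
  · exact (functionalNorm_le_add (σ := φ ∘ₗ G) hδ0.le hk).trans (by gcongr)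

end FunctionalNorm

/-! ### The map x ↦ ρ(x)1 and an explicit absorbing map -/

section TraceMap

open scoped ComplexOrder

variable {H : Type*} [NormedAddCommGroup H] [InnerProductSpace ℂ H] [CompleteSpace H]

/-- The map `x ↦ ρ(x) 1`. -/
def stateMap (R : VonNeumannAlgebra H) (ρ : space R →ₗ[ℂ] ℂ) : space R →ₗ[ℂ] space R :=
  ρ.smulRight ⟨1, one_mem_space R⟩

theorem stateMap_apply (R : VonNeumannAlgebra H) (ρ : space R →ₗ[ℂ] ℂ) (x : space R) :
    stateMap R ρ x = ρ x • ⟨1, one_mem_space R⟩ := rfl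

theorem IsState.apply_nonneg {M : Submodule ℂ (H →L[ℂ] H)} {ρ : M →ₗ[ℂ] ℂ} (hρ : IsState M ρ)
    {x : M} (hx : x.1.IsPositive) : 0 ≤ ρ x :=
  Complex.nonneg_iff.2 ⟨(hρ.nonneg x hx).1, (hρ.nonneg x hx).2.symm⟩

/-- The quadratic form pairs ρ(X i j) with the Gram matrix of u. That matrix is a sum of rank one
positive matrices, and each contributes ρ of a positive compression of X. -/
theorem isCP_stateMap {R : VonNeumannAlgebra H} {ρ : space R →ₗ[ℂ] ℂ}
    (hρ : IsState (space R) ρ) : IsCP (stateMap R ρ) := by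
  intro n X hX u
  obtain ⟨m, B', hB⟩ := Matrix.posSemidef_iff_eq_sum_vecMulVec.1 (Matrix.posSemidef_gram ℂ u)
  let B : Fin m → Fin n → ℂ := fun k i => star (B' k i)
  have hg : ∀ i j, ⟪u i, u j⟫_ℂ = ∑ k, star (B k i) * B k j := fun i j => by
    have := congrFun (congrFun hB i) j
    rw [Matrix.sum_apply] at this
    simpa [Matrix.gram, Matrix.vecMulVec_apply, B] using this
  have h1 : matForm (fun i j => (stateMap R ρ (X i j)).1) u u =
      ∑ k, ρ (∑ i, ∑ j, (star (B k i) * B k j) • X i j) := by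
    have h2 : ∀ i j, ⟪u i, (stateMap R ρ (X i j)).1 (u j)⟫_ℂ =
        ∑ k, (star (B k i) * B k j) * ρ (X i j) := fun i j => by
      change ⟪u i, ρ (X i j) • u j⟫_ℂ = _
      rw [inner_smul_right, hg, Finset.mul_sum]
      exact Finset.sum_congr rfl fun k _ => mul_comm _ _
    simp only [matForm, h2, map_sum, map_smul, smul_eq_mul]
    rw [Finset.sum_comm' (t' := Finset.univ) (s' := fun _ => Finset.univ) (by simp)]
    conv_rhs => rw [Finset.sum_comm]
    rw [Finset.sum_comm]
    refine Finset.sum_congr rfl fun i _ => ?_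
    rw [Finset.sum_comm]
  rw [h1]
  refine Finset.sum_nonneg fun k _ => hρ.apply_nonneg ?_
  rw [isPositive_iff_inner_right]
  intro v
  have h3 := hX fun i => B k i • v
  convert h3 using 1
  simp only [matForm, AddSubmonoidClass.coe_finsetSum, sum_apply, inner_sum, map_smul,
    inner_smul_left, inner_smul_right]
  refine Finset.sum_congr rfl fun i _ => Finset.sum_congr rfl fun j _ => ?_
  change ⟪v, (star (B k i) * B k j) • (X i j).1 v⟫_ℂ = _
  rw [inner_smul_right, mul_assoc]
  exact mul_left_comm _ _ _

theorem isNormalMap_stateMap {R : VonNeumannAlgebra H} {ρ : space R →ₗ[ℂ] ℂ}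
    (hρ : IsNormalFunctional (space R) ρ) : IsNormalMap (stateMap R ρ) := by
  rw [isNormalMap_iff]
  intro σ _
  have : σ ∘ₗ stateMap R ρ = σ ⟨1, one_mem_space R⟩ • ρ := by
    ext x
    rw [LinearMap.comp_apply, stateMap_apply, map_smul, smul_eq_mul, mul_comm]
    rfl
  rw [this, ← mem_predual]
  exact Submodule.smul_mem _ _ (mem_predual.2 hρ)

theorem isNormalUCP_stateMap {R : VonNeumannAlgebra H} {ρ : space R →ₗ[ℂ] ℂ}
    (hρ : IsState (space R) ρ) (hn : IsNormalFunctional (space R) ρ) :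
    IsNormalUCP (stateMap R ρ) :=
  isNormalUCP_iff.2 ⟨isNormalMap_stateMap hn, fun x hx => by
    rw [stateMap_apply, hρ.map_one x hx, one_smul], isCP_stateMap hρ⟩

/-- The average of the identity and `x ↦ ρ(x) 1`. -/
def mixMap (R : VonNeumannAlgebra H) (ρ : space R →ₗ[ℂ] ℂ) : space R →ₗ[ℂ] space R :=
  (2⁻¹ : ℂ) • (LinearMap.id + stateMap R ρ)

theorem isNormalUCP_mixMap {R : VonNeumannAlgebra H} {ρ : space R →ₗ[ℂ] ℂ}
    (hρ : IsState (space R) ρ) (hn : IsNormalFunctional (space R) ρ) :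
    IsNormalUCP (mixMap R ρ) := by
  refine isNormalUCP_iff.2 ⟨?_, fun x hx => ?_, fun n X hX u => ?_⟩
  · rw [isNormalMap_iff]
    intro σ hσ
    have h1 := isNormalMap_iff.1 (isNormalMap_stateMap hn) σ hσ
    rw [mixMap, LinearMap.comp_smul, LinearMap.comp_add, LinearMap.comp_id, ← mem_predual]
    exact Submodule.smul_mem _ _ (Submodule.add_mem _ (mem_predual.2 hσ) (mem_predual.2 h1))
  · change (2⁻¹ : ℂ) • (x.1 + (stateMap R ρ x).1) = 1
    rw [(isNormalUCP_stateMap hρ hn).unital x hx, hx, ← two_smul ℂ, smul_smul]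
    simp
  · have h1 : matForm (fun i j => (mixMap R ρ (X i j)).1) u u =
        2⁻¹ * (matForm (fun i j => (X i j).1) u u +
          matForm (fun i j => (stateMap R ρ (X i j)).1) u u) := by
      simp only [matForm]
      rw [← Finset.sum_add_distrib, Finset.mul_sum]
      refine Finset.sum_congr rfl fun i _ => ?_
      rw [← Finset.sum_add_distrib, Finset.mul_sum]
      refine Finset.sum_congr rfl fun j _ => ?_
      change ⟪u i, (2⁻¹ : ℂ) • ((X i j).1 (u j) + (stateMap R ρ (X i j)).1 (u j))⟫_ℂ = _
      rw [inner_smul_right, inner_add_right]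
    rw [h1]
    exact mul_nonneg (by simp) (add_nonneg (hX u) (isCP_stateMap hρ n X hX u))

/-- `stateMap R ρ` is idempotent because ρ(1) = 1, so at each step half of the identity component is
moved onto it. -/
theorem mixMap_pow_apply {R : VonNeumannAlgebra H} {ρ : space R →ₗ[ℂ] ℂ}
    (hρ : IsState (space R) ρ) (k : ℕ) (x : space R) :
    (mixMap R ρ ^ k) x = (2⁻¹ : ℂ) ^ k • x + (1 - (2⁻¹ : ℂ) ^ k) • stateMap R ρ x := by
  have hone : ρ ⟨1, one_mem_space R⟩ = 1 := hρ.map_one _ rfl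
  induction k with
  | zero => simp
  | succ k ih =>
    rw [pow_succ', Module.End.mul_apply, ih]
    simp only [mixMap, LinearMap.smul_apply, LinearMap.add_apply, LinearMap.id_apply, map_add,
      map_smul, stateMap_apply, hone, one_smul]
    module

/-- Because σ(1) = 1, the difference σ ∘ Pᵏ − ρ is exactly 2⁻ᵏ(σ − ρ). -/
theorem isAbsorbing_mixMap {R : VonNeumannAlgebra H} {ρ : space R →ₗ[ℂ] ℂ}
    (hρ : IsState (space R) ρ) (hn : IsNormalFunctional (space R) ρ) :
    IsAbsorbing (mixMap R ρ) ρ := by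
  intro σ hσ hσn
  obtain ⟨C, hC, hb⟩ := (mem_predual.1 (Submodule.sub_mem _ (mem_predual.2 hσn)
    (mem_predual.2 hn))).exists_bound
  have h1 : ∀ k, functionalNorm (σ ∘ₗ (mixMap R ρ ^ k) - ρ) ≤
      ENNReal.ofReal ((2⁻¹ : ℝ) ^ k * C) := fun k =>
    functionalNorm_le_ofReal (by positivity) fun x => by
      have h2 : (σ ∘ₗ (mixMap R ρ ^ k) - ρ) x = (2⁻¹ : ℂ) ^ k * (σ - ρ) x := by
        rw [LinearMap.sub_apply, LinearMap.comp_apply, mixMap_pow_apply hρ, map_add, map_smul,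
          map_smul, stateMap_apply, map_smul, hσ.map_one ⟨1, one_mem_space R⟩ rfl,
          LinearMap.sub_apply]
        simp only [smul_eq_mul]
        ring
      rw [h2, norm_mul, norm_pow, norm_inv, mul_assoc]
      simpa using hb x
  refine tendsto_of_tendsto_of_tendsto_of_le_of_le tendsto_const_nhds ?_ (fun _ => zero_le) h1
  have h3 : Tendsto (fun k : ℕ => (2⁻¹ : ℝ) ^ k * C) atTop (𝓝 0) := by
    simpa using (tendsto_pow_atTop_nhds_zero_of_lt_one (r := (2⁻¹ : ℝ)) (by norm_num)
      (by norm_num)).mul_const C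
  simpa using ENNReal.tendsto_ofReal h3

end TraceMap


/-! ### Functoriality and contractivity of matrix amplification -/

section AmpMap

variable {H : Type*} [NormedAddCommGroup H] [InnerProductSpace ℂ H] [CompleteSpace H]
variable {K : Type*} [NormedAddCommGroup K] [InnerProductSpace ℂ K] [CompleteSpace K]
variable {G : Type*} [NormedAddCommGroup G] [InnerProductSpace ℂ G] [CompleteSpace G]
variable {M : Submodule ℂ (H →L[ℂ] H)} {N : Submodule ℂ (K →L[ℂ] K)}
  {O : Submodule ℂ (G →L[ℂ] G)}

theorem ampMap_comp (n : ℕ) (g : N →ₗ[ℂ] O) (f : M →ₗ[ℂ] N) :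
    ampMap n (g ∘ₗ f) = ampMap n g ∘ₗ ampMap n f := by
  refine LinearMap.ext fun X => Subtype.ext (entry_ext fun i j => ?_)
  rw [LinearMap.comp_apply, entry_ampMap, entry_ampMap, LinearMap.comp_apply]
  congr 2
  exact Subtype.ext (entry_ampMap f X i j).symm

theorem ampMap_id (n : ℕ) : ampMap n (LinearMap.id : M →ₗ[ℂ] M) = LinearMap.id :=
  LinearMap.ext fun X => Subtype.ext (entry_ext fun i j => entry_ampMap _ X i j)

theorem ampMap_pow (n : ℕ) (f : M →ₗ[ℂ] M) (k : ℕ) : ampMap n (f ^ k) = ampMap n f ^ k := by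
  induction k with
  | zero => exact ampMap_id n
  | succ k ih =>
    rw [pow_succ, pow_succ, ← ih]
    exact ampMap_comp n (f ^ k) f

theorem IsNormalUCP.comp {g : N →ₗ[ℂ] O} {f : M →ₗ[ℂ] N} (hg : IsNormalUCP g)
    (hf : IsNormalUCP f) : IsNormalUCP (g ∘ₗ f) :=
  isNormalUCP_iff.2 ⟨hg.normal.comp hf.normal, fun x hx => hg.unital _ (hf.unital x hx),
    hg.isCP.comp hf.isCP⟩

theorem isNormalUCP_id : IsNormalUCP (LinearMap.id : M →ₗ[ℂ] M) :=
  isNormalUCP_iff.2 ⟨isNormalMap_id M, fun _ hx => hx, fun _ _ hX => hX⟩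

theorem IsNormalUCP.pow {f : M →ₗ[ℂ] M} (hf : IsNormalUCP f) (k : ℕ) : IsNormalUCP (f ^ k) := by
  induction k with
  | zero => exact isNormalUCP_id
  | succ k ih => rw [pow_succ]; exact ih.comp hf

theorem IsNormalUCP.norm_ampMap_le {R : VonNeumannAlgebra H} {f : space R →ₗ[ℂ] N}
    (hf : IsNormalUCP f) {n : ℕ} (X : amp n (space R)) : ‖ampMap n f X‖ ≤ ‖X‖ :=
  hf.isCP.norm_ampMap_le (one_mem_space R) (star_mem_space R) (hf.unital _ rfl) X

theorem norm_coord_le (n : ℕ) (i : Fin n) : ‖(coord n i : HPow n H →L[ℂ] H)‖ ≤ 1 :=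
  ContinuousLinearMap.opNorm_le_bound _ zero_le_one fun v => by
    rw [one_mul]; exact PiLp.norm_apply_le v i

theorem norm_incl_le (n : ℕ) (i : Fin n) : ‖(incl n i : H →L[ℂ] HPow n H)‖ ≤ 1 :=
  ContinuousLinearMap.opNorm_le_bound _ zero_le_one fun v => by
    rw [one_mul]
    refine le_of_sq_le_sq ?_ (norm_nonneg v)
    rw [HPow.norm_sq_eq, Finset.sum_eq_single i]
    · rw [← coord_apply, coord_incl_apply, if_pos rfl]
    · intro j _ hj
      rw [← coord_apply, coord_incl_apply, if_neg hj]; simp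
    · simp

theorem norm_entry_le {n : ℕ} (X : HPow n H →L[ℂ] HPow n H) (i j : Fin n) :
    ‖entry X i j‖ ≤ ‖X‖ := by
  calc ‖entry X i j‖ ≤ ‖(coord n i : HPow n H →L[ℂ] H)‖ * (‖X‖ * ‖(incl n j : H →L[ℂ] _)‖) :=
        (ContinuousLinearMap.opNorm_comp_le _ _).trans (by
          gcongr; exact ContinuousLinearMap.opNorm_comp_le _ _)
    _ ≤ 1 * (‖X‖ * 1) := by
        gcongr
        · exact norm_coord_le n i
        · exact norm_incl_le n j
    _ = ‖X‖ := by ring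

theorem dense_span_incl {D : Set H} (hD : Dense (Submodule.span ℂ D : Set H)) (n : ℕ) :
    Dense (Submodule.span ℂ {w : HPow n H | ∃ i, ∃ u ∈ D, w = incl n i u} : Set (HPow n H)) := by
  set W := (Submodule.span ℂ {w : HPow n H | ∃ i, ∃ u ∈ D, w = incl n i u}).topologicalClosure
  have h1 : ∀ i u, incl n i u ∈ W := fun i u => by
    have h2 : Submodule.span ℂ D ≤ W.comap (incl n i : H →L[ℂ] HPow n H).toLinearMap :=
      Submodule.span_le.2 fun u hu => subset_closure
        (Submodule.subset_span (Set.mem_ofPred.2 ⟨i, u, hu, rfl⟩))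
    have h3 : IsClosed {u : H | incl n i u ∈ W} :=
      (Submodule.isClosed_topologicalClosure _).preimage (incl n i).continuous
    exact closure_minimal (s := (Submodule.span ℂ D : Set H)) h2 h3 (hD u)
  intro v
  change v ∈ W
  rw [← sum_incl n v]
  exact Submodule.sum_mem _ fun i _ => h1 i _

end AmpMap

/-! ### Norm convergence tested on vector functionals -/

section NormConvergence

variable {H : Type*} [NormedAddCommGroup H] [InnerProductSpace ℂ H] [CompleteSpace H]
variable {K : Type*} [NormedAddCommGroup K] [InnerProductSpace ℂ K] [CompleteSpace K]
variable {M : Submodule ℂ (H →L[ℂ] H)} {N : Submodule ℂ (K →L[ℂ] K)}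

theorem TendstoNorm.of_vecFun {Q : ℕ → M →ₗ[ℂ] N} {G : M →ₗ[ℂ] N}
    (hQ : ∀ k x, ‖Q k x‖ ≤ ‖x‖) (hG : ∀ x, ‖G x‖ ≤ ‖x‖) {D : Set K}
    (hD : Dense (Submodule.span ℂ D : Set K))
    (h : ∀ u ∈ D, ∀ v ∈ D, TendstoNorm Q G ((vecFun u v : (K →L[ℂ] K) →ₗ[ℂ] ℂ) ∘ₗ N.subtype))
    {ρ : N →ₗ[ℂ] ℂ} (hρ : IsNormalFunctional N ρ) : TendstoNorm Q G ρ := by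
  refine TendstoNorm.of_approx hQ hG fun ε hε => ?_
  obtain ⟨f, hf, hfe⟩ := hρ
  obtain ⟨g, hg, hfg⟩ := hf.exists_approx hD hε
  refine ⟨(g : (K →L[ℂ] K) →ₗ[ℂ] ℂ) ∘ₗ N.subtype, ?_, fun X => by rw [hfe]; exact hfg X.1⟩
  clear hfg
  induction hg using Submodule.span_induction with
  | mem g hg =>
    obtain ⟨u, hu, v, hv, rfl⟩ := hg
    exact h u hu v hv
  | zero => exact TendstoNorm.zero
  | add g g' _ _ ih ih' =>
    have e : ((g + g' : (K →L[ℂ] K) →L[ℂ] ℂ) : (K →L[ℂ] K) →ₗ[ℂ] ℂ) ∘ₗ N.subtype =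
      (g : (K →L[ℂ] K) →ₗ[ℂ] ℂ) ∘ₗ N.subtype + (g' : (K →L[ℂ] K) →ₗ[ℂ] ℂ) ∘ₗ N.subtype := rfl
    rw [e]
    exact ih.add ih'
  | smul c g _ ih =>
    have e : ((c • g : (K →L[ℂ] K) →L[ℂ] ℂ) : (K →L[ℂ] K) →ₗ[ℂ] ℂ) ∘ₗ N.subtype =
      c • ((g : (K →L[ℂ] K) →ₗ[ℂ] ℂ) ∘ₗ N.subtype) := rfl
    rw [e]
    exact ih.smul c

end NormConvergence

/-! ### Absorption beyond states -/

section Absorbing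

variable {H : Type*} [NormedAddCommGroup H] [InnerProductSpace ℂ H] [CompleteSpace H]
variable {R : VonNeumannAlgebra H} {τ : space R →ₗ[ℂ] ℂ} {P : space R →ₗ[ℂ] space R}

theorem IsAbsorbing.tendstoNorm_of_isState (hP : IsAbsorbing P τ) {ρ : space R →ₗ[ℂ] ℂ}
    (hρ : IsState (space R) ρ) (hn : IsNormalFunctional (space R) ρ) :
    TendstoNorm (fun k => P ^ k) (stateMap R τ) ρ := by
  intro ε hε
  filter_upwards [(ENNReal.tendsto_nhds_zero.1 (hP ρ hρ hn)) (ENNReal.ofReal ε)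
    (ENNReal.ofReal_pos.2 hε)] with k hk x
  have := norm_apply_le_of_functionalNorm_le hε.le hk x
  rw [stateMap_apply, map_smul, hρ.map_one ⟨1, one_mem_space R⟩ rfl, smul_eq_mul, mul_one]
  exact this

theorem isState_vecFun {a : H} (ha : ‖a‖ = 1) (M : Submodule ℂ (H →L[ℂ] H)) :
    IsState M ((vecFun a a : (H →L[ℂ] H) →ₗ[ℂ] ℂ) ∘ₗ M.subtype) where
  nonneg x hx := by
    have := Complex.nonneg_iff.1 (isPositive_iff_inner_right.1 hx a)
    exact ⟨this.1, this.2.symm⟩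
  map_one x hx := by
    change ⟪a, x.1 a⟫_ℂ = 1
    rw [hx]
    change ⟪a, a⟫_ℂ = 1
    rw [inner_self_eq_norm_sq_to_K, ha]
    simp

/-- Absorption speaks of states only. Rescaling reaches ⟪a, · a⟫ for every a, and polarisation
writes ⟪a, · b⟫ as a combination of four of these. -/
theorem IsAbsorbing.tendstoNorm_vecFun (hP : IsAbsorbing P τ) (a b : H) :
    TendstoNorm (fun k => P ^ k) (stateMap R τ)
      ((vecFun a b : (H →L[ℂ] H) →ₗ[ℂ] ℂ) ∘ₗ (space R).subtype) := by
  have hd : ∀ a : H, TendstoNorm (fun k => P ^ k) (stateMap R τ)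
      ((vecFun a a : (H →L[ℂ] H) →ₗ[ℂ] ℂ) ∘ₗ (space R).subtype) := by
    intro a
    by_cases ha : a = 0
    · have h0 : (vecFun a a : (H →L[ℂ] H) →ₗ[ℂ] ℂ) ∘ₗ (space R).subtype = 0 := by
        ext x
        change ⟪a, x.1 a⟫_ℂ = 0
        rw [ha, inner_zero_left]
      rw [h0]
      exact TendstoNorm.zero
    have ha0 : ‖a‖ ≠ 0 := norm_ne_zero_iff.2 ha
    have ha1 : ‖((‖a‖⁻¹ : ℝ) : ℂ) • a‖ = 1 := by
      rw [norm_smul, Complex.norm_real, norm_inv, norm_norm, inv_mul_cancel₀ ha0]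
    have := (hP.tendstoNorm_of_isState (isState_vecFun ha1 (space R))
      (isNormalFunctional_vecFun _ _ _)).smul ((‖a‖ : ℂ) ^ 2)
    convert this using 1
    ext x
    change ⟪a, x.1 a⟫_ℂ = (‖a‖ : ℂ) ^ 2 * ⟪((‖a‖⁻¹ : ℝ) : ℂ) • a, x.1 (((‖a‖⁻¹ : ℝ) : ℂ) • a)⟫_ℂ
    rw [map_smul, inner_smul_left, inner_smul_right, Complex.conj_ofReal]
    have : (‖a‖ : ℂ) ≠ 0 := Complex.ofReal_ne_zero.2 ha0
    push_cast
    field_simp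
  have := (((hd (a + b)).add ((hd (a - b)).smul (-1))).add ((((hd (a + Complex.I • b)).smul
    (-Complex.I)).add ((hd (a - Complex.I • b)).smul Complex.I)))).smul 4⁻¹
  convert this using 1
  ext x
  change ⟪a, x.1 b⟫_ℂ = 4⁻¹ * ((⟪a + b, x.1 (a + b)⟫_ℂ + -1 * ⟪a - b, x.1 (a - b)⟫_ℂ) +
    (-Complex.I * ⟪a + Complex.I • b, x.1 (a + Complex.I • b)⟫_ℂ +
      Complex.I * ⟪a - Complex.I • b, x.1 (a - Complex.I • b)⟫_ℂ))
  simp only [map_add, map_sub, map_smul, inner_add_left, inner_add_right, inner_sub_left,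
    inner_sub_right, inner_smul_left, inner_smul_right, Complex.conj_I]
  linear_combination (1 / 2 * ⟪a, x.1 b⟫_ℂ - 1 / 2 * ⟪b, x.1 a⟫_ℂ) * Complex.I_sq

end Absorbing


/-! ### The embedding x ↦ 1 ⊗ x -/

section OneTensor

variable {H : Type*} [NormedAddCommGroup H] [InnerProductSpace ℂ H] [CompleteSpace H]
variable {K : Type*} [NormedAddCommGroup K] [InnerProductSpace ℂ K] [CompleteSpace K]

theorem oneTensor_apply (R : VonNeumannAlgebra H) (S : VonNeumannAlgebra K) (y : space S) :
    oneTensor R S y = tmul ⟨1, one_mem_space R⟩ y := rfl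

theorem isNormalUCP_oneTensor (R : VonNeumannAlgebra H) (S : VonNeumannAlgebra K) :
    IsNormalUCP (oneTensor R S) := by
  have hone : ∀ x : space S, x.1 = 1 → (oneTensor R S x).1 = 1 := fun x hx => by
    change opTensor 1 x.1 = 1
    rw [hx, opTensor_one]
  have hcp : IsCP (oneTensor R S) := isCP_of_starHom _
    (fun x y => by
      change opTensor 1 (x.1 * y.1) = opTensor 1 x.1 * opTensor 1 y.1
      rw [opTensor_mul, one_mul])
    (fun x => by
      change opTensor 1 (star x.1) = star (opTensor 1 x.1)
      rw [star_opTensor, star_one])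
  refine isNormalUCP_iff.2 ⟨?_, hone, hcp⟩
  refine isNormalMap_of_vecFun _
    (hcp.norm_map_le (one_mem_space S) (star_mem_space S) (hone _ rfl)) dense_span_pureT ?_
  rintro _ ⟨h, k, rfl⟩ _ ⟨h', k', rfl⟩
  have : (vecFun (pureT h k) (pureT h' k') : (HTensor H K →L[ℂ] HTensor H K) →ₗ[ℂ] ℂ) ∘ₗ
      (space (vnTensor R S)).subtype ∘ₗ oneTensor R S =
      ⟪h, h'⟫_ℂ • ((vecFun k k' : (K →L[ℂ] K) →ₗ[ℂ] ℂ) ∘ₗ (space S).subtype) := by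
    ext y
    change ⟪pureT h k, opTensor 1 y.1 (pureT h' k')⟫_ℂ = ⟪h, h'⟫_ℂ * ⟪k, y.1 k'⟫_ℂ
    rw [opTensor_pureT, inner_pureT]
    rfl
  rw [this, ← mem_predual]
  exact Submodule.smul_mem _ _ (mem_predual.2 (isNormalFunctional_vecFun _ _ _))

/-- Norms multiply on elementary tensors, so a single nonzero h in the first leg detects y. -/
theorem oneTensor_injective [Nontrivial H] (R : VonNeumannAlgebra H) (S : VonNeumannAlgebra K)
    {y : space S} (hy : oneTensor R S y = 0) : y = 0 := by
  obtain ⟨h, hh⟩ := exists_ne (0 : H)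
  ext k
  have h1 : opTensor (1 : H →L[ℂ] H) y.1 (pureT h k) = 0 :=
    congrArg (fun T : space (vnTensor R S) => T.1 (pureT h k)) hy
  rw [opTensor_pureT] at h1
  have h2 := norm_pureT h (y.1 k)
  change pureT h (y.1 k) = 0 at h1
  rw [h1, norm_zero] at h2
  have h3 := (mul_eq_zero.1 h2.symm).resolve_left (norm_ne_zero_iff.2 hh)
  exact norm_eq_zero.1 h3

end OneTensor

/-! ### Norm limits and the asymptotic lift -/

section TensorLift

variable {H : Type*} [NormedAddCommGroup H] [InnerProductSpace ℂ H] [CompleteSpace H]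
variable {K : Type*} [NormedAddCommGroup K] [InnerProductSpace ℂ K] [CompleteSpace K]
variable {R : VonNeumannAlgebra H} {S : VonNeumannAlgebra K}

theorem isNormalUCP_compress_left {h : H} (hh : ‖h‖ = 1) :
    IsNormalUCP (compress (M := space S) (W := space (vnTensor R S)) (tensorLeft h) (tensorLeft h)
      (compress_left_mem h h)) := by
  refine isNormalUCP_iff.2 ⟨isNormalMap_compress _ _ _, fun T hT => ?_, fun n X hX u => ?_⟩
  · ext v
    refine ext_inner_left ℂ fun u => ?_
    rw [inner_compress, hT]
    change ⟪pureT h u, pureT h v⟫_ℂ = ⟪u, v⟫_ℂ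
    rw [inner_pureT, inner_self_eq_norm_sq_to_K, hh]
    simp
  · have := hX fun i => tensorLeft h (u i)
    simpa only [matForm, inner_compress] using this

/-- Both sides are normal in T and agree on elementary tensors. This reduces coefficients of P ⊗ id,
at every matrix level, to coefficients of P. -/
theorem compress_right_comp {P : space R →ₗ[ℂ] space R} (hP : IsNormalMap P)
    {Φ : space (vnTensor R S) →ₗ[ℂ] space (vnTensor R S)} (hΦ : IsNormalMap Φ)
    (h : ∀ x y, Φ (tmul x y) = tmul (P x) y) (k k' : K) (T : space (vnTensor R S)) :
    compress (M := space R) (tensorRight k) (tensorRight k') (compress_right_mem k k') (Φ T) =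
      P (compress (M := space R) (tensorRight k) (tensorRight k') (compress_right_mem k k') T) := by
  have hc := isNormalMap_compress (M := space R) (W := space (vnTensor R S)) (tensorRight k)
    (tensorRight k') (compress_right_mem k k')
  have := IsNormalMap.tensor_ext (hc.comp hΦ) (hP.comp hc) fun x y => by
    rw [LinearMap.comp_apply, LinearMap.comp_apply, h, compress_right_tmul, compress_right_tmul,
      map_smul]
  exact congrArg (fun f => f T) this

theorem tensor_id_pow {P : space R →ₗ[ℂ] space R}
    {Φ : space (vnTensor R S) →ₗ[ℂ] space (vnTensor R S)}
    (h : ∀ x y, Φ (tmul x y) = tmul (P x) y) (m : ℕ) (x : space R) (y : space S) :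
    (Φ ^ m) (tmul x y) = tmul ((P ^ m) x) y := by
  induction m with
  | zero => rfl
  | succ m ih => rw [pow_succ', pow_succ', Module.End.mul_apply, Module.End.mul_apply, ih, h]

theorem norm_compress_right_le (k k' : K) (T : space (vnTensor R S)) :
    ‖compress (M := space R) (tensorRight k) (tensorRight k') (compress_right_mem k k') T‖ ≤
      ‖k‖ * ‖k'‖ * ‖T‖ := by
  change ‖(tensorRight k).adjoint ∘L T.1 ∘L tensorRight k'‖ ≤ _
  calc _ ≤ ‖(tensorRight k : H →L[ℂ] HTensor H K).adjoint‖ *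
        (‖T.1‖ * ‖(tensorRight k' : H →L[ℂ] HTensor H K)‖) :=
        (ContinuousLinearMap.opNorm_comp_le _ _).trans (by
          gcongr; exact ContinuousLinearMap.opNorm_comp_le _ _)
    _ ≤ ‖k‖ * (‖T.1‖ * ‖k'‖) := by
        rw [LinearIsometryEquiv.norm_map]
        gcongr
        · exact norm_tensorRight_le k
        · exact norm_tensorRight_le k'
    _ = ‖k‖ * ‖k'‖ * ‖T‖ := by
        change _ = ‖k‖ * ‖k'‖ * ‖T.1‖
        ring

/-- The amplifications of `Pᵐ ⊗ id` converge to `τ(·)1 ⊗ id` in the norm of the predual. -/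
theorem IsAbsorbing.tendstoNorm_ampMap {τ : space R →ₗ[ℂ] ℂ} {P : space R →ₗ[ℂ] space R}
    (hP : IsNormalUCP P) (hτ : IsNormalUCP (stateMap R τ)) (hPτ : IsAbsorbing P τ)
    {Φ G : space (vnTensor R S) →ₗ[ℂ] space (vnTensor R S)} (hΦ : IsNormalUCP Φ)
    (hG : IsNormalUCP G) (hΦt : ∀ x y, Φ (tmul x y) = tmul (P x) y)
    (hGt : ∀ x y, G (tmul x y) = tmul (stateMap R τ x) y) (n : ℕ)
    {ρ : amp n (space (vnTensor R S)) →ₗ[ℂ] ℂ}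
    (hρ : IsNormalFunctional (amp n (space (vnTensor R S))) ρ) :
    TendstoNorm (fun m => ampMap n (Φ ^ m)) (ampMap n G) ρ := by
  refine TendstoNorm.of_vecFun (fun m X => (hΦ.pow m).norm_ampMap_le X)
    (fun X => hG.norm_ampMap_le X) (dense_span_incl dense_span_pureT n) ?_ hρ
  rintro _ ⟨i, _, ⟨h, k, rfl⟩, rfl⟩ _ ⟨j, _, ⟨h', k', rfl⟩, rfl⟩
  have key : ∀ (Ψ : space (vnTensor R S) →ₗ[ℂ] space (vnTensor R S))
      (Q : space R →ₗ[ℂ] space R), IsNormalUCP Ψ → IsNormalUCP Q →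
      (∀ x y, Ψ (tmul x y) = tmul (Q x) y) → ∀ X : amp n (space (vnTensor R S)),
      ⟪incl n i (pureT h k), (ampMap n Ψ X).1 (incl n j (pureT h' k'))⟫_ℂ =
      ⟪h, (Q (compress (M := space R) (tensorRight k) (tensorRight k')
        (compress_right_mem k k') ⟨entry X.1 i j, X.2 i j⟩)).1 h'⟫_ℂ := by
    intro Ψ Q hΨ hQ hΨt X
    rw [← compress_right_comp hQ.normal hΨ.normal hΨt, inner_compress, incl_inner,
      ← entry_ampMap]
    rfl
  intro ε hε
  -- A slice has norm at most ‖k‖‖k'‖‖X‖, hence the rescaled tolerance; the `+ 1` avoids division by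
  -- zero.
  filter_upwards [hPτ.tendstoNorm_vecFun h h' (ε / (‖k‖ * ‖k'‖ + 1)) (by positivity)] with m hm X
  change ‖⟪incl n i (pureT h k), (ampMap n (Φ ^ m) X).1 (incl n j (pureT h' k'))⟫_ℂ -
    ⟪incl n i (pureT h k), (ampMap n G X).1 (incl n j (pureT h' k'))⟫_ℂ‖ ≤ ε * ‖X‖
  rw [key _ _ (hΦ.pow m) (hP.pow m) (tensor_id_pow hΦt m), key _ _ hG hτ hGt]
  refine (hm _).trans ?_
  calc _ ≤ ε / (‖k‖ * ‖k'‖ + 1) * ((‖k‖ * ‖k'‖ + 1) * ‖X‖) := by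
        gcongr
        refine (norm_compress_right_le _ _ _).trans ?_
        gcongr
        · linarith
        · exact norm_entry_le X.1 i j
    _ = ε * ‖X‖ := by field_simp

/-- G = E ∘ F, where F is G followed by the slice at a unit vector h, and G ∘ E = E. So each of ρ ∘
G and ρ ∘ E is the other one composed with a complete contraction. -/
theorem functionalNorm_ampMap_stateMap [Nontrivial H] {τ : space R →ₗ[ℂ] ℂ}
    (hτ : IsState (space R) τ)
    {G : space (vnTensor R S) →ₗ[ℂ] space (vnTensor R S)} (hG : IsNormalUCP G)
    (hGt : ∀ x y, G (tmul x y) = tmul (stateMap R τ x) y) (n : ℕ)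
    (ρ : amp n (space (vnTensor R S)) →ₗ[ℂ] ℂ) :
    functionalNorm (ρ ∘ₗ ampMap n G) = functionalNorm (ρ ∘ₗ ampMap n (oneTensor R S)) := by
  obtain ⟨h, hh⟩ := exists_norm_eq H zero_le_one
  have hc := isNormalUCP_compress_left (R := R) (S := S) hh
  have hE := isNormalUCP_oneTensor R S
  set F := compress (M := space S) (W := space (vnTensor R S)) (tensorLeft h) (tensorLeft h)
      (compress_left_mem h h) ∘ₗ G with hF
  have hFn : IsNormalUCP F := hc.comp hG
  have h1 : G = oneTensor R S ∘ₗ F := by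
    refine IsNormalMap.tensor_ext hG.normal (hE.comp hFn).normal fun x y => ?_
    rw [hF, LinearMap.comp_apply, LinearMap.comp_apply, hGt, compress_left_tmul]
    ext1
    refine tensor_clm_ext fun u v => ?_
    change opTensor (τ x • 1) y.1 (pureT u v) = opTensor 1 (⟪h, τ x • h⟫_ℂ • y.1) (pureT u v)
    rw [opTensor_pureT, opTensor_pureT, inner_smul_right, inner_self_eq_norm_sq_to_K, hh]
    simp only [one_pow, mul_one, RCLike.ofReal_one]
    exact congrArg _ (TensorProduct.smul_tmul (τ x) u (y.1 v))
  have h2 : G ∘ₗ oneTensor R S = oneTensor R S := LinearMap.ext fun y => by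
    rw [LinearMap.comp_apply, oneTensor_apply, hGt, stateMap_apply,
      hτ.map_one ⟨1, one_mem_space R⟩ rfl, one_smul]
  refine le_antisymm ?_ ?_
  · rw [h1, ampMap_comp, ← LinearMap.comp_assoc]
    exact functionalNorm_comp_le _ fun X => hFn.norm_ampMap_le X
  · rw [← h2, ampMap_comp, ← LinearMap.comp_assoc]
    exact functionalNorm_comp_le _ fun X => hE.norm_ampMap_le X

theorem functionalNorm_comp_of_inverse {M : Submodule ℂ (H →L[ℂ] H)} (ρ : M →ₗ[ℂ] ℂ)
    {A B : M →ₗ[ℂ] M} (hA : ∀ x, ‖A x‖ ≤ ‖x‖) (hB : ∀ x, ‖B x‖ ≤ ‖x‖)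
    (hAB : A ∘ₗ B = LinearMap.id) : functionalNorm (ρ ∘ₗ A) = functionalNorm ρ := by
  refine le_antisymm (functionalNorm_comp_le ρ hA) ?_
  have := functionalNorm_comp_le (ρ ∘ₗ A) hB
  rwa [LinearMap.comp_assoc, hAB, LinearMap.comp_id] at this

/-- On the zero space 0 = 1, so normalisation would give ρ(0) = 1. -/
theorem nontrivial_of_isState {ρ : space R →ₗ[ℂ] ℂ} (hρ : IsState (space R) ρ) : Nontrivial H := by
  by_contra hn
  rw [not_nontrivial_iff_subsingleton] at hn
  have h1 := hρ.map_one 0 (Subsingleton.elim _ _)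
  simp at h1

/-- Tensoring an absorbing UCP map with a *-automorphism. -/
theorem exists_tensorMap_isAsymptoticLift {τ : space R →ₗ[ℂ] ℂ} (hτ : IsTrace R τ)
    {P : space R →ₗ[ℂ] space R} (hP : IsNormalUCP P) (hPτ : IsAbsorbing P τ)
    (α : R.toStarSubalgebra ≃⋆ₐ[ℂ] R.toStarSubalgebra) :
    ∃ L : space (vnTensor R R) →ₗ[ℂ] space (vnTensor R R),
      IsTensorMap P (autLinear R α : space R →ₗ[ℂ] space R) L ∧
      IsAsymptoticLift L (autLinear R α) (oneTensor R R) := by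
  have : Nontrivial H := nontrivial_of_isState hτ.state
  have hα := hτ.isNormalUCP_autLinear α
  have hα' := hτ.isNormalUCP_autLinear α.symm
  have hT := isNormalUCP_stateMap hτ.state hτ.normal
  have hE := isNormalUCP_oneTensor R R
  obtain ⟨Φ, hΦ, hΦt⟩ := exists_tensor_id (S := R) hP
  obtain ⟨G, hG, hGt⟩ := exists_tensor_id (S := R) hT
  obtain ⟨A, hA, hAt⟩ := exists_id_tensor (R := R) hα
  obtain ⟨B, hB, hBt⟩ := exists_id_tensor (R := R) hα'
  have hAB : A ∘ₗ B = LinearMap.id := IsNormalMap.tensor_ext (hA.comp hB).normal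
    (isNormalMap_id _) fun x y => by
      rw [LinearMap.comp_apply, hBt, hAt]
      exact congrArg (tmul x) ((autLinear R α).apply_symm_apply y)
  have hcomm : Commute Φ A := IsNormalMap.tensor_ext (hΦ.comp hA).normal (hA.comp hΦ).normal
    fun x y => by
      change Φ (A _) = A (Φ _)
      rw [hΦt, hAt, hAt, hΦt]
  have hLt : ∀ x y, (Φ ∘ₗ A) (tmul x y) = tmul (P x) (autLinear R α y) := fun x y => by
    rw [LinearMap.comp_apply, hAt, hΦt]; rfl
  have hL := hΦ.comp hA
  refine ⟨Φ ∘ₗ A, ⟨hL.normal, hLt, fun L' hL' hLt' => hL'.tensor_ext hL.normal fun x y => by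
    rw [hLt', hLt]; rfl⟩, ?_⟩
  exact
    { dual_base := isDualOperatorSystem_space _
      dual_lift := isDualOperatorSystem_space _
      ucp_base := hL
      ucp_aut := hα
      ucp_aut_symm := hα'
      ucp_map := hE
      equivariant := fun y => by
        rw [oneTensor_apply, oneTensor_apply, hLt]
        congr 1
        exact (Subtype.ext (hP.unital _ rfl)).symm
      -- E is injective, so the condition at n = 0 already forces y = 0.
      nondegenerate := fun y hy => oneTensor_injective R R (hy 0)
      norm_limit := fun n ρ hρ => by
        -- The factors commute, so Lᵏ = Φᵏ Aᵏ; composing with Aᵏ leaves norms unchanged because Bᵏ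
        -- is a completely contractive right inverse.
        have h1 : ∀ k, functionalNorm (ρ ∘ₗ (ampMap n (Φ ∘ₗ A)) ^ k) =
            functionalNorm (ρ ∘ₗ ampMap n (Φ ^ k)) := fun k => by
          have h2 : ampMap n (Φ ∘ₗ A) ^ k = ampMap n (Φ ^ k) ∘ₗ ampMap n (A ^ k) := by
            rw [← ampMap_pow, ← ampMap_comp]
            exact congrArg (ampMap n) (hcomm.mul_pow k)
          rw [h2, ← LinearMap.comp_assoc]
          refine functionalNorm_comp_of_inverse (B := ampMap n (B ^ k)) _
            (fun X => (hA.pow k).norm_ampMap_le X) (fun X => (hB.pow k).norm_ampMap_le X) ?_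
          rw [← ampMap_comp]
          exact (congrArg (ampMap n) (pow_mul_pow_eq_one k hAB)).trans (ampMap_id n)
        simp only [h1]
        rw [← functionalNorm_ampMap_stateMap hτ.state hG hGt]
        exact (IsAbsorbing.tendstoNorm_ampMap hP hT hPτ hΦ hG hΦt hGt n hρ).tendsto_functionalNorm }

end TensorLift

end

end UCP

theorem proposition9p5 {H : Type*} [NormedAddCommGroup H] [InnerProductSpace ℂ H]
    [CompleteSpace H] (R : VonNeumannAlgebra H) (hR : IsHyperfiniteII1Factor R)
    (τ : space R →ₗ[ℂ] ℂ) (hτ : IsTrace R τ) :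
    (∀ P : space R →ₗ[ℂ] space R, IsNormalUCP P → IsAbsorbing P τ →
      ∀ α : R.toStarSubalgebra ≃⋆ₐ[ℂ] R.toStarSubalgebra,
        ∃ L : space (vnTensor R R) →ₗ[ℂ] space (vnTensor R R),
          IsTensorMap P (autLinear R α : space R →ₗ[ℂ] space R) L ∧
          IsAsymptoticLift L (autLinear R α) (oneTensor R R)) ∧
    (∀ α : R.toStarSubalgebra ≃⋆ₐ[ℂ] R.toStarSubalgebra,
      ∃ (P : space R →ₗ[ℂ] space R) (L : space (vnTensor R R) →ₗ[ℂ] space (vnTensor R R)),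
        IsNormalUCP P ∧ IsAbsorbing P τ ∧
        IsTensorMap P (autLinear R α : space R →ₗ[ℂ] space R) L ∧
        IsAsymptoticLift L (autLinear R α) (oneTensor R R)) := by
  refine ⟨fun P hP hPτ α => exists_tensorMap_isAsymptoticLift hτ hP hPτ α, fun α => ?_⟩
  -- The trace is itself a normal state, so ½(id + τ(·)1) serves as P for every α.
  have hP := isNormalUCP_mixMap hτ.state hτ.normal
  have hPτ := isAbsorbing_mixMap hτ.state hτ.normal
  obtain ⟨L, hL, hLift⟩ := exists_tensorMap_isAsymptoticLift hτ hP hPτ α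
  exact ⟨mixMap R τ, L, hP, hPτ, hL, hLift⟩
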